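/- **Conventions.** A *leg* is a finite set of pairs $a|x$ (outcome $a$, setting $x$). A system of measurement operators $A=\{A_{a|x}\}$ on a Hilbert space is a family of positive operators with $\sum_a A_{a|x}=\mathbb I$ for every $x$; it is projective if all $A_{a|x}$ are projectors. A $q$-partite Bell functional is a real tensor $\mathsf B^{\vec a|\vec x}$, with $\mathsf B[A]=\sum_{\vec a,\vec x}\mathsf B^{\vec a|\vec x}\bigotimes_k A^{(k)}_{a_k|x_k}$; it is *normalized* if the maximum of $\langle\psi|\mathsf B[A]|\psi\rangle$ over all Hilbert spaces $H_k'$ (of any dimension), all systems of measurement operators $A^{(k)}$ on $H'_k$ (POVMs, not necessarily projective) and all unit vectors $\psi\in\bigotimes_kH_k'$ equals $1$. A tensor polynomial of $A$ is a complex linear combination of products of operators $\mathbb I\otimes\dots\otimes A^{(k)}_{a|x}\otimes\dots\otimes\mathbb I$. **Full self-testing.** Let $\bar A^{(k)}$ be projective measurement systems on finite-dimensional Hilbert spaces $H_k$, and $\bar\psi\in\bigotimes_k H_k$ a unit vector with $\{f[\bar A]\bar\psi: f \text{ tensor polynomial}\}=\bigotimes_kH_k$. A normalized Bell functional $\mathsf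 B$ *fully self-tests* $(\bar\psi,\bar A)$ if for every choice of Hilbert spaces $H'_k$, systems of measurement operators $A^{(k)}$ on $H'_k$ (POVMs, not necessarily projective) and unit vector $\psi\in\bigotimes_kH'_k$ with $\langle\psi|\mathsf B[A]|\psi\rangle=1$ there are orthonormal bases $\{|i_k\rangle\}$ of the $H_k$, orthonormal vectors $\psi(\vec i)\in\bigotimes_kH'_k$ with $\psi=\sum_{\vec i}\langle \vec i|\bar\psi\rangle\,\psi(\vec i)$, Hilbert spaces $K_k$, isometries $U_k:H'_k\to H_k\otimes K_k$ and a unit vector $|\mathrm{junk}\rangle\in\bigotimes_kK_k$ such that $$\Big(\bigotimes_kU_k\Big)\Big(\bigotimes_kA^{(k)}_{a_k|x_k}\Big)\psi(\vec i)=\Big(\bigotimes_k\bar A^{(k)}_{a_k|x_k}\,|\vec i\rangle\Big)\otimes|\mathrm{junk}\rangle\qquad\text{for all }\vec a,\vec x,\vec i.$$ **Connector complexes.** A (normalized) $q\to1$ connector is a real tensor $\mathsf C^{\vec a|\vec x}_{b|y}$ such that, for all systems of measurement operators $A^{(1)},\dots,A^{(q)}$, the operators $\mathsf C[A]=\{\mathsf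 C_{b|y}[A]\}$ form a system of measurement operators. A *connector complex* is $\mathcal C=(\mathsf C,\bar A,V)$ with $\mathsf C$ a connector, $\bar A^{(k)}$ measurement systems on finite-dimensional $H_k$ and $V:\bigotimes_kH_k\to H$ a coisometry ($VV^\dagger=\mathbb I$) such that $\bar M_{b|y}:=V\mathsf C_{b|y}[\bar A]V^\dagger$ is a projective measurement system; $I(\mathcal C)$ is the range of $V^\dagger$. It is *fully self-testing*, with real coefficients $\mu=(\mu_{b|y})$ and state $\bar\psi\in I(\mathcal C)$, if $\mu\mathsf C:=\sum_{b,y}\mu_{b|y}\mathsf C_{b|y}$ is normalized and fully self-tests $(\bar\psi,\bar A)$, and $I(\mathcal C)=\{f[\mathsf C[\bar A]]\bar\psi: f\text{ polynomial}\}$. Plugging the output leg of $\mathcal C_1$ into the $k$-th input leg of $\mathcal C_2$ (with the same labels and the same Hilbert space) is *congruent* if $\bar M(\mathcal C_1)=\bar A^{(k)}(\mathcal C_2)$. The contraction has as connector the contracted tensor, as measurements those of the remaining legs, coisometry $V=V(\mathcal C_2)(\mathbb I\otimes V(\mathcal C_1)\otimes\mathbb I)$ with $V(\mathcal C_1)$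 producing factor $k$, coefficients $\mu=\mu(\mathcal C_2)$ and state $\bar\psi=(\mathbb I\otimes V(\mathcal C_1)^\dagger\otimes\mathbb I)\,\bar\psi(\mathcal C_2)$. **Proposition.** Let $\mathcal C^{(n)}$ be obtained from $n\ge1$ fully self-testing connector complexes by successive congruent contractions (forming a tree with one root), and let $\mu(\mathcal C^{(n)})$ and the tensor network state $\bar\psi(\mathcal C^{(n)})$ be the coefficients and state given by the above rule. Then $\mathcal C^{(n)}$ is a connector complex, and the Bell inequality $\langle\mu(\mathcal C^{(n)})\,\mathsf C(\mathcal C^{(n)})[A]\rangle\le1$ is normalized and fully self-tests $\big(\bar\psi(\mathcal C^{(n)}),\bar A(\mathcal C^{(n)})\big)$. -/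

import Mathlib

namespace TightConnectors

/-! ### Hilbert spaces and their tensor products

Every complex Hilbert space has an orthonormal basis, hence is of the form `ℓ²(I)`; finite-dimensional
spaces are those with finite `I`. The Hilbert space tensor product of the spaces `ℓ²(I k)` is
`ℓ²(∀ k, I k)`, the product basis vectors being indexed by tuples. -/

/-- The Hilbert space `ℓ²(I)`. -/
abbrev Hilb (I : Type) : Type := lp (fun _ : I => ℂ) 2

/-- Bounded operators between two such spaces. -/
abbrev Op (I J : Type) : Type := Hilb I →L[ℂ] Hilb J

/-- The basis vector `|i⟩` of `ℓ²(I)`. -/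
noncomputable def ket {I : Type} (i : I) : Hilb I :=
  @lp.single I (fun _ => ℂ) _ (Classical.decEq I) 2 i 1

theorem hilb_norm_sq {I : Type} (f : Hilb I) : ‖f‖ ^ 2 = ∑' i, ‖f i‖ ^ 2 := by
  have := lp.norm_rpow_eq_tsum (p := 2) (by norm_num) f
  simpa using this

theorem hilb_summable {I : Type} (f : Hilb I) : Summable fun i => ‖f i‖ ^ 2 := by
  have := (lp.memℓp f).summable (by norm_num)
  simpa using this

theorem memHilb {I : Type} {f : I → ℂ} (h : Summable fun i => ‖f i‖ ^ 2) :
    Memℓp (E := fun _ : I => ℂ) f 2 := by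
  refine memℓp_gen ?_
  simpa using h

/-- Relabelling of the basis. -/
noncomputable def reindex {I J : Type} (e : I ≃ J) : Hilb I ≃ₗᵢ[ℂ] Hilb J where
  toFun f := ⟨fun j => f (e.symm j),
    memHilb ((e.symm.summable_iff (f := fun i => ‖f i‖ ^ 2)).2 (hilb_summable f))⟩
  invFun f := ⟨fun i => f (e i),
    memHilb ((e.summable_iff (f := fun j => ‖f j‖ ^ 2)).2 (hilb_summable f))⟩
  map_add' f g := rfl
  map_smul' c f := rfl
  left_inv f := by apply lp.ext; funext i; simp
  right_inv f := by apply lp.ext; funext i; simp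
  norm_map' f := by
    refine (pow_left_inj₀ (norm_nonneg _) (norm_nonneg _) two_ne_zero).1 ?_
    rw [hilb_norm_sq, hilb_norm_sq]
    exact e.symm.tsum_eq (fun i => ‖f i‖ ^ 2)

/-- Relabelling of the basis, as an operator. -/
noncomputable def reindexOp {I J : Type} (e : I ≃ J) : Op I J :=
  (reindex e).toContinuousLinearEquiv.toContinuousLinearMap

/-- The component of a vector of `ℓ²(I) ⊗ ℓ²(K)` along the basis vector `|c⟩` of `ℓ²(K)`. -/
noncomputable def slice {I K : Type} (f : Hilb (I × K)) (c : K) : Hilb I :=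
  ⟨fun i => f (i, c), memHilb ((hilb_summable f).comp_injective (Prod.mk_left_injective c))⟩

theorem slice_hasSum {I K : Type} (f : Hilb (I × K)) :
    HasSum (fun c => ‖slice f c‖ ^ 2) (‖f‖ ^ 2) := by
  have h1 : Summable fun p : K × I => ‖f p.swap‖ ^ 2 :=
    ((Equiv.prodComm K I).summable_iff (f := fun p => ‖f p‖ ^ 2)).2 (hilb_summable f)
  have h2 : ∑' p : K × I, ‖f p.swap‖ ^ 2 = ‖f‖ ^ 2 := by
    rw [hilb_norm_sq]
    exact (Equiv.prodComm K I).tsum_eq (fun p => ‖f p‖ ^ 2)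
  have h3 := h1.hasSum.prod_fiberwise (fun c => (h1.prod_factor c).hasSum)
  rw [h2] at h3
  convert h3 using 2 with c
  exact hilb_norm_sq _

theorem ampl_summable {I J K : Type} (T : Op I J) (f : Hilb (I × K)) :
    Summable fun p : J × K => ‖T (slice f p.2) p.1‖ ^ 2 := by
  rw [← (Equiv.prodComm K J).summable_iff]
  refine (summable_prod_of_nonneg (fun p => sq_nonneg _)).2
    ⟨fun c => hilb_summable (T (slice f c)), ?_⟩
  refine Summable.of_nonneg_of_le (fun c => tsum_nonneg fun _ => sq_nonneg _) (fun c => ?_)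
    ((slice_hasSum f).summable.mul_left (‖T‖ ^ 2))
  calc _ = ‖T (slice f c)‖ ^ 2 := (hilb_norm_sq _).symm
    _ ≤ (‖T‖ * ‖slice f c‖) ^ 2 := by gcongr; exact T.le_opNorm _
    _ = _ := by ring

/-- The operator `T ⊗ 𝟙` on `ℓ²(I) ⊗ ℓ²(K)`. -/
noncomputable def ampl {I J : Type} (K : Type) (T : Op I J) : Op (I × K) (J × K) :=
  LinearMap.mkContinuous
    { toFun := fun f => (⟨fun p => T (slice f p.2) p.1, memHilb (ampl_summable T f)⟩ : Hilb (J × K))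
      map_add' := fun f g => by
        apply lp.ext; funext p
        exact congrFun (congrArg (fun h : Hilb J => (h : J → ℂ))
          (T.map_add (slice f p.2) (slice g p.2))) p.1
      map_smul' := fun c f => by
        apply lp.ext; funext p
        exact congrFun (congrArg (fun h : Hilb J => (h : J → ℂ))
          (T.map_smul c (slice f p.2))) p.1 }
    ‖T‖ (fun f => by
      refine (pow_le_pow_iff_left₀ (norm_nonneg _) (by positivity) two_ne_zero).1 ?_
      have h := (slice_hasSum f).mul_left (‖T‖ ^ 2)
      rw [← mul_pow] at h
      refine hasSum_le (fun c => ?_) (slice_hasSum _) h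
      rw [← mul_pow]
      exact pow_le_pow_left₀ (norm_nonneg _) (T.le_opNorm (slice f c)) 2)

theorem ampl_apply {I J K : Type} (T : Op I J) (f : Hilb (I × K)) (p : J × K) :
    ampl K T f p = T (slice f p.2) p.1 := rfl

theorem ket_apply {I : Type} [DecidableEq I] (i j : I) :
    ket i j = if j = i then 1 else 0 := by
  by_cases h : j = i
  · subst h
    rw [if_pos rfl]
    exact @lp.single_apply_self I (fun _ => ℂ) _ (Classical.decEq I) 2 j 1
  · rw [if_neg h]
    exact @lp.single_apply_ne I (fun _ => ℂ) _ (Classical.decEq I) 2 i 1 j h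

theorem reindex_symm_ket {I J : Type} (e : I ≃ J) (j : J) :
    (reindex e).symm (ket j) = ket (e.symm j) := by
  classical
  apply lp.ext; funext i
  change ket j (e i) = _
  simp [ket_apply, Equiv.eq_symm_apply]

/-- Existence of the tensor product of two bounded operators. -/
theorem exists_tensorOp_prod {I J K L : Type} (T : Op I J) (S : Op K L) :
    ∃ R : Op (I × K) (J × L), ∀ i j, R (ket i) j = T (ket i.1) j.1 * S (ket i.2) j.2 := by
  classical
  refine ⟨((reindex (Equiv.prodComm L J)).toContinuousLinearEquiv : Op (L × J) (J × L)) ∘L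
    ampl J S ∘L ((reindex (Equiv.prodComm J K)).toContinuousLinearEquiv : Op (J × K) (K × J)) ∘L
    ampl K T, fun i j => ?_⟩
  have h1 : ∀ c, slice (ket i) c = if c = i.2 then ket i.1 else 0 := fun c => by
    apply lp.ext; funext a
    change ket i (a, c) = _
    obtain ⟨i1, i2⟩ := i
    by_cases h : c = i2 <;> simp [ket_apply, h]
  have h2 : slice (reindex (Equiv.prodComm J K) (ampl K T (ket i))) j.1
      = (T (ket i.1) j.1) • ket i.2 := by
    apply lp.ext; funext c
    change T (slice (ket i) c) j.1 = T (ket i.1) j.1 * ket i.2 c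
    rw [h1]
    by_cases h : c = i.2 <;> simp [ket_apply, h]
  change S (slice (reindex (Equiv.prodComm J K) (ampl K T (ket i))) j.1) j.2 = _
  rw [h2, map_smul]
  rfl

/-- Existence of the tensor product of a finite family of bounded operators. -/
theorem exists_tensorOp {ι : Type} [Fintype ι] (I J : ι → Type) (T : ∀ k, Op (I k) (J k)) :
    ∃ S : Op (∀ k, I k) (∀ k, J k), ∀ i j, S (ket i) j = ∏ k, T k (ket (i k)) (j k) := by
  classical
  revert I J T
  refine Fintype.induction_empty_option
    (P := fun (ι : Type) [Fintype ι] => ∀ (I J : ι → Type) (T : ∀ k, Op (I k) (J k)),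
      ∃ S : Op (∀ k, I k) (∀ k, J k), ∀ i j, S (ket i) j = ∏ k, T k (ket (i k)) (j k))
    ?_ ?_ ?_ ι
  · intro α β _ e ih I J T
    let _ := Fintype.ofEquiv β e.symm
    obtain ⟨S, hS⟩ := ih (fun a => I (e a)) (fun a => J (e a)) (fun a => T (e a))
    refine ⟨((reindex (Equiv.piCongrLeft J e)).toContinuousLinearEquiv : Op _ _) ∘L S ∘L
      ((reindex (Equiv.piCongrLeft I e)).symm.toContinuousLinearEquiv : Op _ _), fun i j => ?_⟩
    change S ((reindex (Equiv.piCongrLeft I e)).symm (ket i)) ((Equiv.piCongrLeft J e).symm j) = _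
    rw [reindex_symm_ket, hS]
    exact Equiv.prod_comp e (fun b => T b (ket (i b)) (j b))
  · intro I J T
    refine ⟨((reindex (Equiv.ofUnique (∀ k, I k) (∀ k, J k))).toContinuousLinearEquiv : Op _ _),
      fun i j => ?_⟩
    change ket i ((Equiv.ofUnique (∀ k, I k) (∀ k, J k)).symm j) = _
    simp [ket_apply, eq_iff_true_of_subsingleton]
  · intro α _ ih I J T
    obtain ⟨S, hS⟩ := ih (fun a => I (some a)) (fun a => J (some a)) (fun a => T (some a))
    obtain ⟨R, hR⟩ := exists_tensorOp_prod (T none) S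
    refine ⟨((reindex (Equiv.piOptionEquivProd (β := J))).symm.toContinuousLinearEquiv : Op _ _) ∘L
      R ∘L ((reindex (Equiv.piOptionEquivProd (β := I))).toContinuousLinearEquiv : Op _ _),
      fun i j => ?_⟩
    have h : reindex (Equiv.piOptionEquivProd (β := I)) (ket i)
        = ket (Equiv.piOptionEquivProd (β := I) i) := by
      rw [LinearIsometryEquiv.eq_symm_apply .. |>.symm, reindex_symm_ket, Equiv.symm_apply_apply]
    change R (reindex (Equiv.piOptionEquivProd (β := I)) (ket i))
      (Equiv.piOptionEquivProd (β := J) j) = _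
    rw [h, hR, Fintype.prod_option, hS]
    rfl

/-- The operator `⨂ₖ T k` on `⨂ₖ ℓ²(I k) = ℓ²(∀ k, I k)`. -/
noncomputable def tensorOp {ι : Type} [Fintype ι] {I J : ι → Type} (T : ∀ k, Op (I k) (J k)) :
    Op (∀ k, I k) (∀ k, J k) :=
  Classical.choose (exists_tensorOp I J T)

theorem tensorOp_ket {ι : Type} [Fintype ι] {I J : ι → Type} (T : ∀ k, Op (I k) (J k))
    (i : ∀ k, I k) (j : ∀ k, J k) : tensorOp T (ket i) j = ∏ k, T k (ket (i k)) (j k) :=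
  Classical.choose_spec (exists_tensorOp I J T) i j

/-- The product vector `⨂ₖ x k` (in finite dimension). -/
noncomputable def prodVec {ι : Type} [Fintype ι] {d : ι → ℕ} (x : ∀ k, Hilb (Fin (d k))) :
    Hilb (∀ k, Fin (d k)) :=
  ⟨fun i => ∏ k, x k (i k), Memℓp.all _⟩

/-- The operator `T` acting on the tensor factor `k`. -/
noncomputable def localOp {ι : Type} [Fintype ι] [DecidableEq ι] {I : ι → Type} (k : ι)
    (T : Op (I k) (I k)) : Op (∀ k, I k) (∀ k, I k) :=
  tensorOp (Function.update (fun j => (1 : Op (I j) (I j))) k T)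

/-! ### Measurements, Bell functionals, connectors -/

/-- The label set of a leg: a finite number of settings, each with a finite number of outcomes. -/
structure Leg where
  settings : ℕ
  outcomes : Fin settings → ℕ

/-- The pairs `a|x`, as `⟨x, a⟩`. -/
abbrev Leg.Event (l : Leg) : Type := Σ x : Fin l.settings, Fin (l.outcomes x)

/-- A family of operators `A_{a|x}` on `ℓ²(I)`. -/
abbrev OpSystem (l : Leg) (I : Type) : Type := l.Event → Op I I

/-- `A` is a system of measurement operators: `(A_{a|x})ₐ` is a POVM for all `x`. -/
def IsPOVM {l : Leg} {I : Type} (A : OpSystem l I) : Prop :=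
  (∀ e, (A e).IsPositive) ∧ ∀ x, ∑ a, A ⟨x, a⟩ = 1

/-- `A` is a system of projective measurements. -/
def IsProjective {l : Leg} {I : Type} (A : OpSystem l I) : Prop :=
  IsPOVM A ∧ ∀ e, A e * A e = A e

section Multipartite

variable {ι : Type} [Fintype ι] [DecidableEq ι] {L : ι → Leg}

/-- A Bell functional `B^{a₁,…,a_q|x₁,…,x_q}`. -/
abbrev BellFunctional (L : ι → Leg) : Type := (∀ k, (L k).Event) → ℝ

/-- The Bell operator `B[A] = ∑_{a,x} B^{a|x} ⨂ₖ A⁽ᵏ⁾_{aₖ|xₖ}`. -/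
noncomputable def bellOp (B : BellFunctional L) {I : ι → Type} (A : ∀ k, OpSystem (L k) (I k)) :
    Op (∀ k, I k) (∀ k, I k) :=
  ∑ e : ∀ k, (L k).Event, (B e : ℂ) • tensorOp fun k => A k (e k)

/-- The set of values `⟨ψ|B[A]|ψ⟩` over all quantum realizations `(ψ, A)`. -/
def quantumValues (B : BellFunctional L) : Set ℝ :=
  {v | ∃ (I : ι → Type) (A : ∀ k, OpSystem (L k) (I k)) (ψ : Hilb (∀ k, I k)),
    (∀ k, IsPOVM (A k)) ∧ ‖ψ‖ = 1 ∧ v = (inner ℂ ψ (bellOp B A ψ)).re}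

/-- A normalized quantum Bell inequality: the maximal quantum value is `1`. -/
def IsNormalized (B : BellFunctional L) : Prop := IsGreatest (quantumValues B) 1

/-- The operators `f[A]`, for `f` a tensor polynomial: sums of products of the operators
`𝟙 ⊗ … ⊗ A⁽ᵏ⁾_{a|x} ⊗ … ⊗ 𝟙`. -/
noncomputable def tensorPolynomials {I : ι → Type} (A : ∀ k, OpSystem (L k) (I k)) :
    Subalgebra ℂ (Op (∀ k, I k) (∀ k, I k)) :=
  Algebra.adjoin ℂ {T | ∃ k e, T = localOp k (A k e)}

/-- The normalized Bell functional `B` fully self-tests the state `ψ'` and the measurements `A'`.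
The isometry of party `k` is `U k : H'ₖ → Hₖ ⊗ Kₖ` with `Hₖ ⊗ Kₖ = ℓ²(Fin (d k) × K k)`; a vector of
`⨂ₖ (Hₖ ⊗ Kₖ)` is a function of the tuples `f` of pairs, and `(φ ⊗ junk) f` is the product of the
coefficient of `φ ∈ ⨂ₖ Hₖ` at the first components and that of `junk ∈ ⨂ₖ Kₖ` at the second. -/
structure FullySelfTests {d : ι → ℕ} (B : BellFunctional L)
    (A' : ∀ k, OpSystem (L k) (Fin (d k))) (ψ' : Hilb (∀ k, Fin (d k))) : Prop where
  projective : ∀ k, IsProjective (A' k)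
  norm_state : ‖ψ'‖ = 1
  cyclic : {v | ∃ f ∈ tensorPolynomials A', v = f ψ'} = Set.univ
  normalized : IsNormalized B
  self_test : ∀ (I : ι → Type) (A : ∀ k, OpSystem (L k) (I k)) (ψ : Hilb (∀ k, I k)),
    (∀ k, IsPOVM (A k)) → ‖ψ‖ = 1 → (inner ℂ ψ (bellOp B A ψ)).re = 1 →
    ∃ (b : ∀ k, OrthonormalBasis (Fin (d k)) ℂ (Hilb (Fin (d k))))
      (Ψ : (∀ k, Fin (d k)) → Hilb (∀ k, I k)),
      Orthonormal ℂ Ψ ∧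
      ψ = ∑ i, (inner ℂ (prodVec fun k => b k (i k)) ψ') • Ψ i ∧
      ∃ (K : ι → Type) (junk : Hilb (∀ k, K k))
        (U : ∀ k, Hilb (I k) →ₗᵢ[ℂ] Hilb (Fin (d k) × K k)),
        ‖junk‖ = 1 ∧
        ∀ (e : ∀ k, (L k).Event) (i : ∀ k, Fin (d k)) (f : ∀ k, Fin (d k) × K k),
          tensorOp (fun k => (U k).toContinuousLinearMap) (tensorOp (fun k => A k (e k)) (Ψ i)) f
            = tensorOp (fun k => A' k (e k)) (prodVec fun k => b k (i k)) (fun k => (f k).1)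
              * junk (fun k => (f k).2)

/-- The tensor of a `q → 1` connector: `C_{b|y}^{a₁,…,a_q|x₁,…,x_q}`. -/
abbrev ConnTensor (L : ι → Leg) (out : Leg) : Type := out.Event → BellFunctional L

/-- The operators `C[A] = {C_{b|y}[A]}`. -/
noncomputable def connOp {out : Leg} (C : ConnTensor L out) {I : ι → Type}
    (A : ∀ k, OpSystem (L k) (I k)) : OpSystem out (∀ k, I k) :=
  fun o => bellOp (C o) A

/-- `C` is a normalized quantum connector: it maps every `q`-partite system of POVMs to a
one-partite system of POVMs. Equivalently, contracting `q` legs of a quantum behaviour with `C`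
always yields a (normalized) quantum behaviour. -/
def IsConnector {out : Leg} (C : ConnTensor L out) : Prop :=
  ∀ (I : ι → Type) (A : ∀ k, OpSystem (L k) (I k)), (∀ k, IsPOVM (A k)) → IsPOVM (connOp C A)

end Multipartite

/-! ### Connector complexes and congruent contractions -/

/-- The label set of a leg together with the dimension of the Hilbert space attached to it. -/
structure Party extends Leg where
  dim : ℕ

/-- The data `(C, A, V)` of a connector complex with output leg (and output space) `out`; its input
legs are indexed by the finite type `ι`. -/
structure ConnectorData (out : Party) where
  ι : Type
  [fintype : Fintype ι]
  [decEq : DecidableEq ι]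
  party : ι → Party
  C : ConnTensor (fun k => (party k).toLeg) out.toLeg
  A : ∀ k, OpSystem (party k).toLeg (Fin (party k).dim)
  V : Op (∀ k, Fin (party k).dim) (Fin out.dim)

attribute [instance] ConnectorData.fintype ConnectorData.decEq

namespace ConnectorData

variable {out : Party}

/-- The space `⨂ₖ Hₖ`. -/
abbrev Space (X : ConnectorData out) : Type := Hilb (∀ k, Fin (X.party k).dim)

/-- `M_{b|y} = V C_{b|y}[A] V†`. -/
noncomputable def M (X : ConnectorData out) : OpSystem out.toLeg (Fin out.dim) :=
  fun o => X.V ∘L connOp X.C X.A o ∘L ContinuousLinearMap.adjoint X.V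

/-- `(C, A, V)` is a connector complex. -/
structure IsConnectorComplex (X : ConnectorData out) : Prop where
  connector : IsConnector X.C
  povm : ∀ k, IsPOVM (X.A k)
  coisometry : X.V ∘L ContinuousLinearMap.adjoint X.V = 1
  projective : IsProjective X.M

/-- The invariant subspace, the range of `V†`. -/
noncomputable def invariantSubspace (X : ConnectorData out) : Submodule ℂ X.Space :=
  LinearMap.range (ContinuousLinearMap.adjoint X.V).toLinearMap

/-- The Bell functional `∑_{b,y} μ_{b|y} C_{b|y}`. -/
def bell (X : ConnectorData out) (μ : out.Event → ℝ) :
    BellFunctional (fun k => (X.party k).toLeg) :=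
  fun e => ∑ o, μ o * X.C o e

/-- The connector complex is fully self-testing, with coefficients `μ` and state `ψ`. -/
structure IsFullySelfTesting (X : ConnectorData out) (μ : out.Event → ℝ) (ψ : X.Space) : Prop where
  self_tests : FullySelfTests (X.bell μ) X.A ψ
  mem_invariant : ψ ∈ X.invariantSubspace
  cyclic : (X.invariantSubspace : Set X.Space)
    = {v | ∃ f ∈ Algebra.adjoin ℂ (Set.range (connOp X.C X.A)), v = f ψ}

section Contraction

variable (X₂ : ConnectorData out) (k : X₂.ι) (X₁ : ConnectorData (X₂.party k))

/-- The input legs after the output leg of `X₁` has been plugged into the leg `k` of `X₂`. -/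
abbrev contractParty : X₁.ι ⊕ {j : X₂.ι // j ≠ k} → Party :=
  Sum.elim X₁.party (fun j => X₂.party j)

/-- `𝟙 ⊗ V(X₁) ⊗ 𝟙`, with `V(X₁)` producing the tensor factor `k` of the space of `X₂`. -/
noncomputable def plug :
    Op (∀ j, Fin (contractParty X₂ k X₁ j).dim) (∀ j, Fin (X₂.party j).dim) :=
  reindexOp (Equiv.piSplitAt k (fun j => Fin (X₂.party j).dim)).symm ∘L
    ampl (∀ j : {j : X₂.ι // j ≠ k}, Fin (X₂.party j).dim) X₁.V ∘L
    reindexOp (Equiv.sumPiEquivProdPi (fun j => Fin (contractParty X₂ k X₁ j).dim))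

/-- The contraction of the output leg of `X₁` with the leg `k` of `X₂`. -/
noncomputable def contract : ConnectorData out where
  ι := X₁.ι ⊕ {j : X₂.ι // j ≠ k}
  party := contractParty X₂ k X₁
  C o e := ∑ c : (X₂.party k).Event,
    X₂.C o ((Equiv.piSplitAt k (fun j => (X₂.party j).Event)).symm (c, fun j => e (Sum.inr j)))
      * X₁.C c (fun l => e (Sum.inl l))
  A j := match j with
    | Sum.inl l => X₁.A l
    | Sum.inr j => X₂.A j
  V := X₂.V ∘L plug X₂ k X₁

/-- The state `(𝟙 ⊗ V(X₁)† ⊗ 𝟙) ψ` of the contraction, for a state `ψ` of `X₂`. -/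
noncomputable def contractState (ψ : X₂.Space) : (contract X₂ k X₁).Space :=
  ContinuousLinearMap.adjoint (plug X₂ k X₁) ψ

end Contraction

/-- `IsCongruentContraction n X μ ψ`: the tuple `X` results from congruently contracting, in a tree,
`n` fully self-testing connector complexes; `μ` are the coefficients of the complex at the root and
`ψ` is the tensor network state obtained by applying to the state of the root complex the adjoint
coisometries of all the others. A contraction is congruent if `M(X₁) = A⁽ᵏ⁾(X₂)`. -/
inductive IsCongruentContraction : {out : Party} → ℕ → (X : ConnectorData out) →
    (out.Event → ℝ) → X.Space → Prop
  | single {out : Party} (X : ConnectorData out) (μ : out.Event → ℝ) (ψ : X.Space)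
      (hX : X.IsConnectorComplex) (hψ : X.IsFullySelfTesting μ ψ) :
      IsCongruentContraction 1 X μ ψ
  | contract {out : Party} {n₁ n₂ : ℕ} (X₂ : ConnectorData out) (μ₂ : out.Event → ℝ) (ψ₂ : X₂.Space)
      (k : X₂.ι) (X₁ : ConnectorData (X₂.party k)) (μ₁ : (X₂.party k).Event → ℝ) (ψ₁ : X₁.Space)
      (h₁ : IsCongruentContraction n₁ X₁ μ₁ ψ₁) (h₂ : IsCongruentContraction n₂ X₂ μ₂ ψ₂)
      (congruent : X₁.M = X₂.A k) :
      IsCongruentContraction (n₁ + n₂) (contract X₂ k X₁) μ₂ (contractState X₂ k X₁ ψ₂)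

end ConnectorData

end TightConnectors

/-! A full self-test is equivalent to a statement without local isometries: every optimal
realization `(ψ, A)` contains the reference, in that a global isometry `W` from the reference space
carries the reference state to `ψ` and intertwines every single-party measurement operator. One
direction (`FullySelfTests.exists_intertwiner`) comes from summing the self-testing identity over
the outcomes of the other parties. The converse (`fullySelfTests_of_intertwiners`, resting on
`exists_local_isometries`) needs each party's reference operators to generate its full matrix
algebra: the matrix units `|a⟩⟨i|` then lift through `W` to local operators, from which the local
isometries and the junk state are built.

This irreducibility is automatic. If `Y` is nonzero and commutes with all reference operators, then
`Y ψ'` is, up to norm, another optimal state, so the self-test together with cyclicity makes `Y` a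
multiple of an isometry. Subtracting an eigenvalue shows that the commutant is scalar
(`FullySelfTests.commutant`), and the density theorem gives the full algebra
(`adjoin_eq_top_of_commutant`).

For a contraction, the contracted Bell operator is that of the upper complex `X₂` with party `k`
measuring `connOp X₁.C`, which is a POVM because `X₁.C` is a connector. So the quantum bound is
inherited, and it is attained because congruence makes `V(X₁)†` intertwine the two reference
realizations. At optimality, the self-test of `X₂` gives `W₂`, which intertwines only the outputs of
`X₁`. For each basis vector `ρ` of the remaining systems, `W₂ (χ ⊗ ρ)`, where `V(X₁)† χ = ψ₁`, is a
top eigenvector of the Bell operator of `X₁`; the self-test of `X₁`, applied with the remaining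
systems as spectators, yields an intertwiner `T ρ`. Triviality of the commutant makes the `T ρ`
orthonormal as operators, and they assemble into an isometry extending `W₂` along `V(X₁)†`
(`FullySelfTests.exists_extension`). The full self-testing property of the complex, cyclicity of the
invariant subspace included, survives each contraction, so induction over the tree applies. -/

open scoped ComplexConjugate
namespace TightConnectors

/-! ### Matrix entries of operators -/

theorem ket_self {I : Type} (i : I) : ket i i = 1 := by
  classical
  simp [ket_apply]

theorem inner_ket_left {I : Type} (i : I) (f : Hilb I) : inner ℂ (ket i) f = f i := by
  classical
  have := lp.inner_single_left (𝕜 := ℂ) (G := fun _ : I => ℂ) i 1 f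
  convert this using 1
  · unfold ket; congr!
  · simp

theorem hasSum_ket {I : Type} (f : Hilb I) : HasSum (fun i => f i • ket i) f := by
  classical
  have := lp.hasSum_single (E := fun _ : I => ℂ) (p := 2) (by norm_num) f
  convert this using 1
  funext i
  apply lp.ext; funext j
  change f i * ket i j = _
  by_cases h : j = i
  · subst h; simp [ket_apply]
  · simp [ket_apply, h]

theorem sum_ket {I : Type} [Fintype I] (f : Hilb I) : ∑ i, f i • ket i = f :=
  (hasSum_fintype _).unique (hasSum_ket f)

theorem map_ext_ket {I : Type} {F : Type*} [AddCommMonoid F] [Module ℂ F] [TopologicalSpace F]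
    [T2Space F] {T S : Hilb I →L[ℂ] F} (h : ∀ i, T (ket i) = S (ket i)) : T = S := by
  ext1 f
  have h1 := (hasSum_ket f).mapL T
  have h2 := (hasSum_ket f).mapL S
  simp only [map_smul, h] at h1 h2
  exact h1.unique h2

/-- Tensor products are specified only by their matrix entries, so operator identities reduce to
identities of numbers, also in infinite dimension. -/
theorem op_ext {I J : Type} {T S : Op I J} (h : ∀ i j, T (ket i) j = S (ket i) j) : T = S :=
  map_ext_ket fun i => lp.ext (funext (h i))

theorem hasSum_op_apply {I J : Type} (T : Op I J) (f : Hilb I) (j : J) :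
    HasSum (fun i => f i * T (ket i) j) (T f j) := by
  have h := ((hasSum_ket f).mapL T).mapL (innerSL ℂ (ket j))
  simpa [inner_ket_left] using h

theorem hasSum_comp_entry {I J K : Type} (S : Op J K) (T : Op I J) (i : I) (k : K) :
    HasSum (fun j => T (ket i) j * S (ket j) k) (S (T (ket i)) k) :=
  hasSum_op_apply S (T (ket i)) k

theorem adjoint_entry {I J : Type} (T : Op I J) (j : J) (i : I) :
    ContinuousLinearMap.adjoint T (ket j) i = conj (T (ket i) j) := by
  rw [← inner_ket_left, ContinuousLinearMap.adjoint_inner_right, ← inner_conj_symm, inner_ket_left]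

theorem hasSum_mul_prod {α β : Type} {f : α → ℂ} {g : β → ℂ} {a b : ℂ} (hf : HasSum f a)
    (hg : HasSum g b) : HasSum (fun p : α × β => f p.1 * g p.2) (a * b) := by
  have h : Summable fun p : α × β => f p.1 * g p.2 :=
    summable_mul_of_summable_norm (f := f) (g := g) hf.summable.norm hg.summable.norm
  exact HasSum.mul hf hg h

/-- Finite products, indexed by `ι`, of convergent series can be expanded. -/
def ExpandsProducts (ι : Type) [Fintype ι] : Prop :=
  ∀ (I : ι → Type) (g : ∀ k, I k → ℂ) (a : ι → ℂ), (∀ k, HasSum (g k) (a k)) →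
    HasSum (fun m : ∀ k, I k => ∏ k, g k (m k)) (∏ k, a k)

/-- Convergent series in `ℂ` converge absolutely, so two of them may be multiplied termwise; adding
one index at a time gives finite products. This is what composing tensor products of operators on
infinite-dimensional spaces requires. -/
theorem hasSum_pi_prod (ι : Type) [Fintype ι] : ExpandsProducts ι := by
  classical
  refine Fintype.induction_empty_option (P := fun (ι : Type) [Fintype ι] => ExpandsProducts ι)
    ?_ ?_ ?_ ι
  · intro α β _ e ih I g a h
    let _ := Fintype.ofEquiv β e.symm
    have h1 := ih (fun x => I (e x)) (fun x => g (e x)) (fun x => a (e x)) (fun x => h (e x))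
    rw [Equiv.prod_comp e a] at h1
    have h4 : (fun m : ∀ x, I (e x) => ∏ x, g (e x) (m x))
        = (fun m : ∀ k, I k => ∏ k, g k (m k)) ∘ (Equiv.piCongrLeft I e) := by
      funext m
      rw [Function.comp_apply, ← Equiv.prod_comp e]
      refine Finset.prod_congr rfl fun x _ => ?_
      rw [Equiv.piCongrLeft_apply_apply]
    rw [h4] at h1
    exact ((Equiv.piCongrLeft I e).hasSum_iff).1 h1
  · intro I g a _
    simp
  · intro α _ ih I g a h
    have h2 := ih (fun x => I (some x)) (fun x => g (some x)) (fun x => a (some x))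
      (fun x => h (some x))
    have h3 := hasSum_mul_prod (h none) h2
    rw [Fintype.prod_option]
    have h4 : (fun m : ∀ k, I k => ∏ k, g k (m k)) = (fun p : I none × (∀ x, I (some x)) =>
        g none p.1 * ∏ x, g (some x) (p.2 x)) ∘ (Equiv.piOptionEquivProd (β := I)) := by
      funext m
      rw [Function.comp_apply, Fintype.prod_option]
      rfl
    rw [h4]
    exact ((Equiv.piOptionEquivProd (β := I)).hasSum_iff).2 h3

/-! ### The calculus of tensor products of operators -/

section TensorOp

variable {ι : Type} [Fintype ι] {I J K : ι → Type}

theorem tensorOp_comp (S : ∀ k, Op (J k) (K k)) (T : ∀ k, Op (I k) (J k)) :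
    tensorOp S ∘L tensorOp T = tensorOp fun k => S k ∘L T k := by
  refine op_ext fun i j => ?_
  rw [tensorOp_ket]
  refine (hasSum_comp_entry (tensorOp S) (tensorOp T) i j).unique ?_
  simp only [tensorOp_ket, ← Finset.prod_mul_distrib]
  exact hasSum_pi_prod ι J (fun k m => T k (ket (i k)) m * S k (ket m) (j k)) _
    fun k => hasSum_comp_entry (S k) (T k) (i k) (j k)

theorem tensorOp_adjoint (T : ∀ k, Op (I k) (J k)) :
    ContinuousLinearMap.adjoint (tensorOp T)
      = tensorOp fun k => ContinuousLinearMap.adjoint (T k) := by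
  refine op_ext fun j i => ?_
  simp only [adjoint_entry, tensorOp_ket, map_prod]

theorem tensorOp_one : tensorOp (fun k => (1 : Op (I k) (I k))) = 1 := by
  classical
  refine op_ext fun i j => ?_
  rw [tensorOp_ket]
  simp only [one_apply_eq_self, ket_apply]
  rw [Finset.prod_ite_zero]
  simp [funext_iff]

/-- The tensor product of operators as a multilinear map. -/
noncomputable def tensorOpMultilinear (I J : ι → Type) :
    MultilinearMap ℂ (fun k => Op (I k) (J k)) (Op (∀ k, I k) (∀ k, J k)) where
  toFun := tensorOp
  map_update_add' T k x y := by
    refine op_ext fun i j => ?_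
    rw [add_apply, lp.coeFn_add, Pi.add_apply]
    simp only [tensorOp_ket]
    rw [Fintype.prod_eq_mul_prod_subtype_ne _ k, Fintype.prod_eq_mul_prod_subtype_ne _ k,
      Fintype.prod_eq_mul_prod_subtype_ne _ k]
    have h : ∀ (z : Op (I k) (J k)) (l : {l // l ≠ k}), Function.update T k z l.1 = T l.1 :=
      fun z l => Function.update_of_ne l.2 _ _
    simp [h, add_mul]
  map_update_smul' T k c x := by
    refine op_ext fun i j => ?_
    rw [smul_apply, lp.coeFn_smul, Pi.smul_apply]
    simp only [tensorOp_ket]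
    rw [Fintype.prod_eq_mul_prod_subtype_ne _ k, Fintype.prod_eq_mul_prod_subtype_ne _ k]
    have h : ∀ (z : Op (I k) (J k)) (l : {l // l ≠ k}), Function.update T k z l.1 = T l.1 :=
      fun z l => Function.update_of_ne l.2 _ _
    simp [h, mul_assoc]

end TensorOp

/-- The tensor product of two operators. -/
noncomputable def tensor2 {I J K L : Type} (T : Op I J) (S : Op K L) : Op (I × K) (J × L) :=
  Classical.choose (exists_tensorOp_prod T S)

section Binary

variable {I J K L M N : Type}

theorem tensor2_ket (T : Op I J) (S : Op K L) (i : I × K) (j : J × L) :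
    tensor2 T S (ket i) j = T (ket i.1) j.1 * S (ket i.2) j.2 :=
  Classical.choose_spec (exists_tensorOp_prod T S) i j

theorem tensor2_comp (T : Op J M) (S : Op L N) (T' : Op I J) (S' : Op K L) :
    tensor2 T S ∘L tensor2 T' S' = tensor2 (T ∘L T') (S ∘L S') := by
  refine op_ext fun i j => ?_
  rw [tensor2_ket]
  refine (hasSum_comp_entry (tensor2 T S) (tensor2 T' S') i j).unique ?_
  have h1 := hasSum_comp_entry T T' i.1 j.1
  have h2 := hasSum_comp_entry S S' i.2 j.2
  have h3 := hasSum_mul_prod h1 h2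
  refine h3.congr_fun fun m => ?_
  simp only [tensor2_ket]
  ring

theorem tensor2_adjoint (T : Op I J) (S : Op K L) :
    ContinuousLinearMap.adjoint (tensor2 T S)
      = tensor2 (ContinuousLinearMap.adjoint T) (ContinuousLinearMap.adjoint S) := by
  refine op_ext fun j i => ?_
  simp only [adjoint_entry, tensor2_ket, map_mul]

theorem tensor2_add_left (T T' : Op I J) (S : Op K L) :
    tensor2 (T + T') S = tensor2 T S + tensor2 T' S := by
  refine op_ext fun j i => ?_
  simp [tensor2_ket, add_mul]

theorem tensor2_smul_left (c : ℂ) (T : Op I J) (S : Op K L) :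
    tensor2 (c • T) S = c • tensor2 T S := by
  refine op_ext fun j i => ?_
  simp [tensor2_ket, mul_assoc]

theorem tensor2_sum_left {α : Type*} (s : Finset α) (T : α → Op I J) (S : Op K L) :
    tensor2 (∑ a ∈ s, T a) S = ∑ a ∈ s, tensor2 (T a) S := by
  let F : Op I J →ₗ[ℂ] Op (I × K) (J × L) :=
    { toFun := fun T => tensor2 T S
      map_add' := fun T T' => tensor2_add_left T T' S
      map_smul' := fun c T => tensor2_smul_left c T S }
  exact map_sum F T s

theorem slice_ket [DecidableEq K] (i : I) (c d : K) :
    slice (ket (i, d)) c = if c = d then ket i else 0 := by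
  classical
  apply lp.ext; funext a
  change ket (i, d) (a, c) = _
  by_cases h : c = d <;> simp [ket_apply, h]

/-- Bridges two descriptions: `ampl` acts slice by slice, so many of its identities hold by
definition, while `tensor2` is symmetric in the factors and multiplicative in both. -/
theorem ampl_eq_tensor2 (T : Op I J) : ampl K T = tensor2 T (1 : Op K K) := by
  classical
  refine op_ext fun i j => ?_
  rw [tensor2_ket, ampl_apply, slice_ket]
  by_cases h : j.2 = i.2 <;> simp [ket_apply, h]

theorem ampl_comp (S : Op J M) (T : Op I J) : ampl K S ∘L ampl K T = ampl K (S ∘L T) := rfl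

theorem ampl_one : ampl K (1 : Op I I) = 1 := rfl

theorem ampl_adjoint (T : Op I J) :
    ContinuousLinearMap.adjoint (ampl K T) = ampl K (ContinuousLinearMap.adjoint T) := by
  rw [ampl_eq_tensor2, tensor2_adjoint, ampl_eq_tensor2]
  congr 1
  exact ContinuousLinearMap.adjoint_id

/-- `slice` as an operator. -/
noncomputable def sliceOp (I : Type) {K : Type} (c : K) : Op (I × K) I :=
  LinearMap.mkContinuous
    { toFun := fun f => slice f c
      map_add' := fun _ _ => rfl
      map_smul' := fun _ _ => rfl } 1 fun f => by
    rw [one_mul]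
    refine (pow_le_pow_iff_left₀ (norm_nonneg _) (norm_nonneg _) two_ne_zero).1 ?_
    exact le_hasSum (slice_hasSum f) c fun _ _ => sq_nonneg _

theorem sliceOp_apply (c : K) (f : Hilb (I × K)) : sliceOp I c f = slice f c := rfl

theorem sliceOp_ampl (c : K) (T : Op I J) : sliceOp J c ∘L ampl K T = T ∘L sliceOp I c := rfl

/-- The operator `x ↦ x ⊗ |c⟩`. -/
noncomputable def tensorKet (I : Type) {K : Type} (c : K) : Op I (I × K) :=
  ContinuousLinearMap.adjoint (sliceOp I c)

/-- The adjoint of the definitional identity `sliceOp_ampl`, applied to `T†`. -/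
theorem ampl_tensorKet (c : K) (T : Op I J) :
    ampl K T ∘L tensorKet I c = tensorKet J c ∘L T := by
  have h := congrArg ContinuousLinearMap.adjoint (sliceOp_ampl c (ContinuousLinearMap.adjoint T))
  rwa [ContinuousLinearMap.adjoint_comp, ContinuousLinearMap.adjoint_comp, ampl_adjoint,
    ContinuousLinearMap.adjoint_adjoint] at h

theorem tensorKet_ket (c : K) (i : I) : tensorKet I c (ket i) = ket (i, c) := by
  classical
  apply lp.ext; funext j
  rw [tensorKet, adjoint_entry, sliceOp_apply]
  obtain ⟨j, d⟩ := j
  rw [slice_ket]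
  by_cases h : c = d
  · subst h; by_cases h' : i = j
    · subst h'; simp [ket_apply]
    · simp [ket_apply, h', Ne.symm h']
  · simp [ket_apply, h, Ne.symm h]

theorem sliceOp_tensorKet [DecidableEq K] (c d : K) :
    sliceOp I c ∘L tensorKet I d = if c = d then 1 else 0 := by
  refine map_ext_ket fun i => ?_
  rw [ContinuousLinearMap.comp_apply, tensorKet_ket, sliceOp_apply, slice_ket]
  split_ifs <;> rfl

theorem tensor2_tensorKet [Fintype K] (S : Op K L) [Fintype L] (c : K) :
    tensor2 (1 : Op I I) S ∘L tensorKet I c = ∑ d, S (ket c) d • tensorKet I d := by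
  classical
  refine op_ext fun i j => ?_
  rw [ContinuousLinearMap.comp_apply, tensorKet_ket, tensor2_ket, sum_apply,
    lp.coeFn_sum, Finset.sum_apply]
  simp only [smul_apply, lp.coeFn_smul, Pi.smul_apply, tensorKet_ket]
  obtain ⟨a, b⟩ := j
  simp [ket_apply, Prod.ext_iff, ite_and, mul_comm]

theorem sum_tensorKet_sliceOp [Fintype K] :
    ∑ c, tensorKet I c ∘L sliceOp I (K := K) c = 1 := by
  classical
  refine map_ext_ket fun i => ?_
  obtain ⟨i, d⟩ := i
  rw [sum_apply]
  simp only [ContinuousLinearMap.comp_apply, sliceOp_apply, slice_ket]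
  rw [Finset.sum_eq_single d]
  · simp [tensorKet_ket]
  · intro c _ h; simp [h]
  · simp

/-! ### Relabelling -/

theorem reindexOp_apply (e : I ≃ J) (f : Hilb I) (j : J) : reindexOp e f j = f (e.symm j) := rfl

theorem reindexOp_ket (e : I ≃ J) (i : I) : reindexOp e (ket i) = ket (e i) := by
  have := reindex_symm_ket e.symm i
  exact this

theorem reindexOp_comp_symm (e : I ≃ J) : reindexOp e ∘L reindexOp e.symm = 1 := by
  refine map_ext_ket fun i => ?_
  simp [reindexOp_ket]

theorem reindexOp_symm_comp (e : I ≃ J) : reindexOp e.symm ∘L reindexOp e = 1 := by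
  refine map_ext_ket fun i => ?_
  simp [reindexOp_ket]

theorem reindexOp_adjoint (e : I ≃ J) :
    ContinuousLinearMap.adjoint (reindexOp e) = reindexOp e.symm := by
  classical
  refine op_ext fun j i => ?_
  rw [adjoint_entry, reindexOp_ket, reindexOp_ket]
  by_cases h : j = e i
  · subst h; simp [ket_apply]
  · have : i ≠ e.symm j := fun h' => h (by simp [h'])
    simp [ket_apply, h, this]

theorem norm_reindexOp (e : I ≃ J) (f : Hilb I) : ‖reindexOp e f‖ = ‖f‖ := (reindex e).norm_map f

end Binary

/-! ### Operators on one tensor factor -/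

section LocalOp

variable {ι : Type} [Fintype ι] [DecidableEq ι] {I J : ι → Type}

theorem tensorOp_sum {α : ι → Type} [∀ k, DecidableEq (α k)] (s : ∀ k, Finset (α k))
    (T : ∀ k, α k → Op (I k) (J k)) :
    tensorOp (fun k => ∑ a ∈ s k, T k a)
      = ∑ r ∈ Fintype.piFinset s, tensorOp fun k => T k (r k) :=
  (tensorOpMultilinear I J).map_sum_finset T s

/-- `localOp` as a linear map. -/
noncomputable def localOpLinear (I : ι → Type) (k : ι) :
    Op (I k) (I k) →ₗ[ℂ] Op (∀ k, I k) (∀ k, I k) :=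
  (tensorOpMultilinear I I).toLinearMap (fun j => (1 : Op (I j) (I j))) k

theorem localOpLinear_apply (k : ι) (T : Op (I k) (I k)) : localOpLinear I k T = localOp k T := rfl

theorem update_comp_update {K : ι → Type} (S : ∀ k, Op (J k) (K k)) (T : ∀ k, Op (I k) (J k))
    (k : ι) (s : Op (J k) (K k)) (t : Op (I k) (J k)) :
    (fun j => Function.update S k s j ∘L Function.update T k t j)
      = Function.update (fun j => S j ∘L T j) k (s ∘L t) := by
  funext j
  by_cases h : j = k
  · subst h; simp
  · simp [h]

theorem localOp_comp (k : ι) (S T : Op (I k) (I k)) :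
    localOp k S ∘L localOp k T = localOp k (S ∘L T) := by
  rw [localOp, localOp, tensorOp_comp, update_comp_update]
  rfl

theorem localOp_one (k : ι) : localOp k (1 : Op (I k) (I k)) = 1 := by
  rw [localOp, Function.update_eq_self, tensorOp_one]

theorem localOp_adjoint (k : ι) (T : Op (I k) (I k)) :
    ContinuousLinearMap.adjoint (localOp k T) = localOp k (ContinuousLinearMap.adjoint T) := by
  rw [localOp, tensorOp_adjoint, localOp]
  congr 1
  funext j
  by_cases h : j = k
  · subst h; simp
  · simp only [Function.update_of_ne h]
    exact ContinuousLinearMap.adjoint_id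

theorem localOp_commute {k l : ι} (h : k ≠ l) (S : Op (I k) (I k)) (T : Op (I l) (I l)) :
    localOp k S ∘L localOp l T = localOp l T ∘L localOp k S := by
  rw [localOp, localOp, tensorOp_comp, tensorOp_comp]
  congr 1
  funext j
  by_cases hk : j = k
  · subst hk; simp [h]; rfl
  · by_cases hl : j = l
    · subst hl; simp [hk]; rfl
    · simp [hk, hl]

/-- Induction over the tensor factors, simultaneously for two product operators. -/
theorem tensorOp_induction (T : ∀ k, Op (I k) (I k)) (S : ∀ k, Op (J k) (J k))
    (P : Op (∀ k, I k) (∀ k, I k) → Op (∀ k, J k) (∀ k, J k) → Prop) (one : P 1 1)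
    (comp : ∀ k X Y, P X Y → P (localOp k (T k) ∘L X) (localOp k (S k) ∘L Y)) :
    P (tensorOp T) (tensorOp S) := by
  have step : ∀ {I : ι → Type} (T : ∀ k, Op (I k) (I k)) (s : Finset ι) (k : ι), k ∉ s →
      tensorOp (fun j => if j ∈ insert k s then T j else 1)
        = localOp k (T k) ∘L tensorOp (fun j => if j ∈ s then T j else 1) := by
    intro I T s k hk
    rw [localOp, tensorOp_comp]
    congr 1
    funext j
    by_cases h : j = k
    · subst h; simp [hk]; rfl
    · simp [h]; rfl
  have key : ∀ s : Finset ι, P (tensorOp fun j => if j ∈ s then T j else 1)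
      (tensorOp fun j => if j ∈ s then S j else 1) := by
    intro s
    induction s using Finset.induction_on with
    | empty => simpa [tensorOp_one] using one
    | insert k s hk ih => rw [step T s k hk, step S s k hk]; exact comp k _ _ ih
  simpa using key Finset.univ

/-- The homomorphism `F` serves two uses at once: the identity for plain realizations, and `amplHom`
for realizations with a spectator system. -/
theorem tensorOp_intertwine {N : Type} {T : ∀ k, Op (I k) (I k)} {S : ∀ k, Op (J k) (J k)}
    (F : Op (∀ k, J k) (∀ k, J k) →ₐ[ℂ] Op N N) (W : Op (∀ k, I k) N)
    (h : ∀ k, F (localOp k (S k)) ∘L W = W ∘L localOp k (T k)) :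
    F (tensorOp S) ∘L W = W ∘L tensorOp T := by
  refine tensorOp_induction T S (fun X Y => F Y ∘L W = W ∘L X) ?_ ?_
  · rw [map_one]; rfl
  · intro k X Y hXY
    have h1 : F (localOp k (S k) ∘L Y) = F (localOp k (S k)) ∘L F Y := map_mul F _ _
    rw [h1, ContinuousLinearMap.comp_assoc, hXY, ← ContinuousLinearMap.comp_assoc, h]
    rfl

end LocalOp

/-! ### Splitting tensor products -/

section Split

variable {α β : Type} [Fintype α] [Fintype β]

theorem tensorOp_sumPi {I J : α ⊕ β → Type} (T : ∀ k, Op (I k) (J k)) :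
    reindexOp (Equiv.sumPiEquivProdPi J) ∘L tensorOp T
      = tensor2 (tensorOp fun a => T (Sum.inl a)) (tensorOp fun b => T (Sum.inr b))
        ∘L reindexOp (Equiv.sumPiEquivProdPi I) := by
  refine op_ext fun i j => ?_
  rw [ContinuousLinearMap.comp_apply, ContinuousLinearMap.comp_apply, reindexOp_apply,
    reindexOp_ket, tensor2_ket, tensorOp_ket, tensorOp_ket, tensorOp_ket, Fintype.prod_sum_type]
  rfl

theorem localOp_sumPi_inl [DecidableEq α] [DecidableEq β] {I : α ⊕ β → Type} (a : α)
    (T : Op (I (Sum.inl a)) (I (Sum.inl a))) :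
    reindexOp (Equiv.sumPiEquivProdPi I) ∘L localOp (Sum.inl a) T
      = tensor2 (localOp (I := fun a => I (Sum.inl a)) a T) 1
        ∘L reindexOp (Equiv.sumPiEquivProdPi I) := by
  rw [localOp, tensorOp_sumPi]
  congr 2
  · rw [localOp]
    congr 1
    funext j
    by_cases h : j = a
    · subst h; simp
    · simp [h]
  · simp [tensorOp_one]

theorem localOp_sumPi_inr [DecidableEq α] [DecidableEq β] {I : α ⊕ β → Type} (b : β)
    (T : Op (I (Sum.inr b)) (I (Sum.inr b))) :
    reindexOp (Equiv.sumPiEquivProdPi I) ∘L localOp (Sum.inr b) T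
      = tensor2 1 (localOp (I := fun b => I (Sum.inr b)) b T)
        ∘L reindexOp (Equiv.sumPiEquivProdPi I) := by
  rw [localOp, tensorOp_sumPi]
  congr 2
  · simp [tensorOp_one]
  · rw [localOp]
    congr 1
    funext j
    by_cases h : j = b
    · subst h; simp
    · simp [h]

variable {ι : Type} [Fintype ι] [DecidableEq ι]

theorem tensorOp_piSplitAt (k : ι) {I J : ι → Type} (T : ∀ k, Op (I k) (J k)) :
    reindexOp (Equiv.piSplitAt k J) ∘L tensorOp T
      = tensor2 (T k) (tensorOp fun j : {j // j ≠ k} => T j)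
        ∘L reindexOp (Equiv.piSplitAt k I) := by
  refine op_ext fun i j => ?_
  obtain ⟨j, rfl⟩ := (Equiv.piSplitAt k J).surjective j
  rw [ContinuousLinearMap.comp_apply, ContinuousLinearMap.comp_apply, reindexOp_apply,
    reindexOp_ket, tensor2_ket, tensorOp_ket, tensorOp_ket, Equiv.symm_apply_apply,
    Fintype.prod_eq_mul_prod_subtype_ne _ k]
  rfl

theorem localOp_piSplitAt_self (k : ι) {I : ι → Type} (T : Op (I k) (I k)) :
    reindexOp (Equiv.piSplitAt k I) ∘L localOp k T
      = tensor2 T 1 ∘L reindexOp (Equiv.piSplitAt k I) := by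
  rw [localOp, tensorOp_piSplitAt]
  congr 2
  · simp
  · rw [← tensorOp_one]
    congr 1
    funext j
    simp [j.2]

theorem localOp_piSplitAt_ne (k : ι) {I : ι → Type} (j : {j // j ≠ k}) (T : Op (I j) (I j)) :
    reindexOp (Equiv.piSplitAt k I) ∘L localOp j.1 T
      = tensor2 1 (localOp (I := fun j : {j // j ≠ k} => I j) j T)
        ∘L reindexOp (Equiv.piSplitAt k I) := by
  rw [localOp, tensorOp_piSplitAt]
  congr 2
  · simp [j.2.symm]
  · rw [localOp]
    congr 1
    funext l
    by_cases h : l = j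
    · subst h; simp
    · have : l.1 ≠ j.1 := fun h' => h (Subtype.ext h')
      simp [h, this]

end Split

/-! ### Bell operators with a distinguished party -/

section SplitBell

variable {ι : Type} [Fintype ι] [DecidableEq ι] {L : ι → Leg}

/-- The Bell operator, with the party `k` split off. -/
noncomputable def splitBell (k : ι) (B : BellFunctional L) {Ik : Type} {Ir : {j // j ≠ k} → Type}
    (Ak : OpSystem (L k) Ik) (Ar : ∀ j : {j // j ≠ k}, OpSystem (L j) (Ir j)) :
    Op (Ik × ∀ j, Ir j) (Ik × ∀ j, Ir j) :=
  ∑ p : (L k).Event × ∀ j : {j // j ≠ k}, (L j).Event,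
    (B ((Equiv.piSplitAt k (fun j => (L j).Event)).symm p) : ℂ) •
      tensor2 (Ak p.1) (tensorOp fun j => Ar j (p.2 j))

theorem bellOp_piSplitAt (k : ι) (B : BellFunctional L) {I : ι → Type}
    (A : ∀ k, OpSystem (L k) (I k)) :
    reindexOp (Equiv.piSplitAt k I) ∘L bellOp B A
      = splitBell k B (A k) (fun j => A j) ∘L reindexOp (Equiv.piSplitAt k I) := by
  rw [bellOp, splitBell, ContinuousLinearMap.finsetSum_comp,
    ContinuousLinearMap.comp_finsetSum]
  refine Fintype.sum_equiv (Equiv.piSplitAt k (fun j => (L j).Event)) _ _ fun e => ?_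
  rw [ContinuousLinearMap.comp_smul, tensorOp_piSplitAt, Equiv.symm_apply_apply,
    ContinuousLinearMap.smul_comp]
  rfl

theorem forall_of_split {α : Type} {k : α} {p : α → Prop} (hk : p k)
    (hr : ∀ j : {j // j ≠ k}, p j) (j : α) : p j := by
  by_cases h : j = k
  · subst h; exact hk
  · exact hr ⟨j, h⟩

/-- To prove a property of realizations with a distinguished party it is enough to prove it for
those obtained from an ordinary realization. -/
theorem split_induction (k : ι)
    {P : ∀ (Ik : Type) (Ir : {j // j ≠ k} → Type), OpSystem (L k) Ik →
      (∀ j : {j // j ≠ k}, OpSystem (L j) (Ir j)) → Prop}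
    (h : ∀ (I : ι → Type) (A : ∀ j, OpSystem (L j) (I j)),
      P (I k) (fun j => I j) (A k) (fun j => A j))
    (Ik : Type) (Ir : {j // j ≠ k} → Type) (Ak : OpSystem (L k) Ik)
    (Ar : ∀ j : {j // j ≠ k}, OpSystem (L j) (Ir j)) : P Ik Ir Ak Ar := by
  -- Substituting along the surjectivity of the splitting makes the separate data literal
  -- restrictions of one family, so that no casts between types arise.
  obtain ⟨I, hI⟩ := (Equiv.piSplitAt k (fun _ : ι => Type)).surjective (Ik, Ir)
  obtain ⟨rfl, rfl⟩ := Prod.mk.inj hI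
  obtain ⟨A, hA⟩ := (Equiv.piSplitAt k (fun j => OpSystem (L j) (I j))).surjective (Ak, Ar)
  obtain ⟨rfl, rfl⟩ := Prod.mk.inj hA
  exact h I A

/-- Only the factor `k` changes; `V ⊗ 𝟙` passes the other factors unaltered, term by term. -/
theorem splitBell_comp_ampl {k : ι} {Ik Jk : Type} {Ir : {j // j ≠ k} → Type}
    (B : BellFunctional L) (Ak : OpSystem (L k) Ik) (Bk : OpSystem (L k) Jk)
    (Ar : ∀ j : {j // j ≠ k}, OpSystem (L j) (Ir j)) (V : Op Jk Ik)
    (h : ∀ c, Ak c ∘L V = V ∘L Bk c) :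
    splitBell k B Ak Ar ∘L ampl _ V = ampl _ V ∘L splitBell k B Bk Ar := by
  rw [splitBell, splitBell, ContinuousLinearMap.finsetSum_comp,
    ContinuousLinearMap.comp_finsetSum]
  refine Finset.sum_congr rfl fun p _ => ?_
  rw [ContinuousLinearMap.comp_smul, ContinuousLinearMap.smul_comp, ampl_eq_tensor2, tensor2_comp,
    tensor2_comp, h]
  rfl

end SplitBell

/-! ### Measurement systems -/

theorem IsPOVM.adjoint_eq {l : Leg} {I : Type} {A : OpSystem l I} (h : IsPOVM A) (e : l.Event) :
    ContinuousLinearMap.adjoint (A e) = A e :=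
  (h.1 e).isSelfAdjoint.adjoint_eq

theorem IsPOVM.conj {l : Leg} {I J : Type} {A : OpSystem l I} (h : IsPOVM A) (S : Op I J)
    (hS : S ∘L ContinuousLinearMap.adjoint S = 1) :
    IsPOVM fun e => S ∘L A e ∘L ContinuousLinearMap.adjoint S := by
  refine ⟨fun e => (h.1 e).conj_adjoint S, fun x => ?_⟩
  have h1 : ∑ a, S ∘L A ⟨x, a⟩ ∘L ContinuousLinearMap.adjoint S
      = S ∘L (∑ a, A ⟨x, a⟩) ∘L ContinuousLinearMap.adjoint S := by
    rw [ContinuousLinearMap.finsetSum_comp, ContinuousLinearMap.comp_finsetSum]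
  rw [h1, h.2 x]
  exact hS

theorem IsPOVM.of_reindex {l : Leg} {I J : Type} {A : OpSystem l I} {B : OpSystem l J}
    (e : I ≃ J) (h : IsPOVM A) (hAB : ∀ o, reindexOp e ∘L A o = B o ∘L reindexOp e) :
    IsPOVM B := by
  have := h.conj (reindexOp e) (by rw [reindexOp_adjoint]; exact reindexOp_comp_symm e)
  convert this using 2 with o
  rw [reindexOp_adjoint, ← ContinuousLinearMap.comp_assoc, hAB, ContinuousLinearMap.comp_assoc,
    reindexOp_comp_symm]
  rfl

section Bell

variable {ι : Type} [Fintype ι] [DecidableEq ι] {L : ι → Leg}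

theorem IsConnector.split {out : Leg} {C : ConnTensor L out} (hC : IsConnector C) (k : ι) :
    ∀ (Ik : Type) (Ir : {j // j ≠ k} → Type) (Ak : OpSystem (L k) Ik)
      (Ar : ∀ j : {j // j ≠ k}, OpSystem (L j) (Ir j)),
      IsPOVM Ak → (∀ j, IsPOVM (Ar j)) → IsPOVM fun o => splitBell k (C o) Ak Ar := by
  refine split_induction k ?_
  intro I A hk hr
  have hA : ∀ j, IsPOVM (A j) := forall_of_split hk hr
  exact (hC I A hA).of_reindex (Equiv.piSplitAt k I) fun o => bellOp_piSplitAt k (C o) A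

end Bell

/-! ### Finite families of vectors, isometries and maximizers of quadratic forms -/

instance finiteDimensional_hilb (I : Type) [Finite I] : FiniteDimensional ℂ (Hilb I) := by
  let F : Hilb I →ₗ[ℂ] (I → ℂ) :=
    { toFun := fun f i => f i, map_add' := fun _ _ => rfl, map_smul' := fun _ _ => rfl }
  exact FiniteDimensional.of_injective F fun f g h => lp.ext h

/-- `T ↦ T ⊗ 𝟙` as a homomorphism of algebras. -/
noncomputable def amplHom (I K : Type) : Op I I →ₐ[ℂ] Op (I × K) (I × K) where
  toFun := ampl K
  map_one' := rfl
  map_mul' _ _ := rfl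
  map_zero' := rfl
  map_add' _ _ := rfl
  commutes' _ := rfl

theorem amplHom_apply {I K : Type} (T : Op I I) : amplHom I K T = ampl K T := rfl

/-- The operator with `|i⟩ ↦ v i`. -/
noncomputable def familyOp {I J : Type} [Fintype I] (v : I → Hilb J) : Op I J :=
  ∑ i, (innerSL ℂ (ket i)).smulRight (v i)

section FamilyOp

variable {I J : Type} [Fintype I]

theorem familyOp_apply (v : I → Hilb J) (f : Hilb I) : familyOp v f = ∑ i, f i • v i := by
  simp [familyOp, sum_apply, inner_ket_left]

theorem familyOp_ket (v : I → Hilb J) (i : I) : familyOp v (ket i) = v i := by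
  classical
  simp [familyOp_apply, ket_apply]

theorem adjoint_familyOp_apply (v : I → Hilb J) (f : Hilb J) (i : I) :
    ContinuousLinearMap.adjoint (familyOp v) f i = inner ℂ (v i) f := by
  rw [← inner_ket_left, ContinuousLinearMap.adjoint_inner_right, familyOp_ket]

theorem adjoint_comp_familyOp {v : I → Hilb J} (hv : Orthonormal ℂ v) :
    ContinuousLinearMap.adjoint (familyOp v) ∘L familyOp v = 1 := by
  classical
  refine op_ext fun i j => ?_
  rw [ContinuousLinearMap.comp_apply, adjoint_familyOp_apply, familyOp_ket,
    orthonormal_iff_ite.1 hv]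
  simp [ket_apply]

end FamilyOp

theorem norm_of_adjoint_comp {I J : Type} {W : Op I J}
    (hW : ContinuousLinearMap.adjoint W ∘L W = 1) (f : Hilb I) : ‖W f‖ = ‖f‖ := by
  have h : inner ℂ (W f) (W f) = inner ℂ f f := by
    rw [← ContinuousLinearMap.adjoint_inner_right, ← ContinuousLinearMap.comp_apply, hW]
    rfl
  rw [inner_self_eq_norm_sq_to_K, inner_self_eq_norm_sq_to_K] at h
  exact (pow_left_inj₀ (norm_nonneg _) (norm_nonneg _) two_ne_zero).1 (by exact_mod_cast h)

theorem injective_of_adjoint_comp {I J : Type} {W : Op I J}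
    (hW : ContinuousLinearMap.adjoint W ∘L W = 1) : Function.Injective W := fun x y h => by
  have := congrArg (ContinuousLinearMap.adjoint W) h
  rw [← ContinuousLinearMap.comp_apply, ← ContinuousLinearMap.comp_apply, hW] at this
  exact this

theorem inner_of_adjoint_comp {I J : Type} {W : Op I J}
    (hW : ContinuousLinearMap.adjoint W ∘L W = 1) (f g : Hilb I) :
    inner ℂ (W f) (W g) = inner ℂ f g := by
  rw [← ContinuousLinearMap.adjoint_inner_right, ← ContinuousLinearMap.comp_apply, hW]
  rfl

/-- A maximizer of the quadratic form of a self-adjoint operator is an eigenvector. -/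
theorem eq_self_of_maximal {I : Type} {T : Op I I} (hT : ContinuousLinearMap.adjoint T = T)
    (hle : ∀ v, (inner ℂ v (T v)).re ≤ ‖v‖ ^ 2) {ψ : Hilb I}
    (hψ : (inner ℂ ψ (T ψ)).re = ‖ψ‖ ^ 2) : T ψ = ψ := by
  set D : Op I I := 1 - T with hD
  have hDs : ContinuousLinearMap.adjoint D = D := by
    rw [hD, map_sub, hT]
    congr 1
    exact ContinuousLinearMap.adjoint_id
  have hq : ∀ v, (inner ℂ v (D v)).re = ‖v‖ ^ 2 - (inner ℂ v (T v)).re := fun v => by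
    have h1 : D v = v - T v := rfl
    rw [h1, inner_sub_right, Complex.sub_re, inner_self_eq_norm_sq_to_K]
    norm_cast
  -- The form of `D = 1 - T` is nonnegative and vanishes at `ψ`. At `ψ - s D ψ` its linear term in
  -- `s` is `-2 s ‖D ψ‖²`, which must vanish.
  have h0 : ∀ s : ℝ, 0 ≤ - 2 * s * ‖D ψ‖ ^ 2 + s ^ 2 * (inner ℂ (D ψ) (D (D ψ))).re := by
    intro s
    have h1 : 0 ≤ (inner ℂ (ψ - (s : ℂ) • D ψ) (D (ψ - (s : ℂ) • D ψ))).re := by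
      rw [hq]; linarith [hle (ψ - (s : ℂ) • D ψ)]
    have h2 : (inner ℂ ψ (D ψ)).re = 0 := by rw [hq, hψ]; ring
    have h3 : inner ℂ ψ (D (D ψ)) = inner ℂ (D ψ) (D ψ) := by
      rw [← ContinuousLinearMap.adjoint_inner_left, hDs]
    have h4 : (inner ℂ (D ψ) (D ψ)).re = ‖D ψ‖ ^ 2 := by
      rw [inner_self_eq_norm_sq_to_K]; norm_cast
    rw [map_sub, map_smul, inner_sub_left, inner_sub_right, inner_sub_right, inner_smul_left,
      inner_smul_left, inner_smul_right, inner_smul_right, h3] at h1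
    simp only [Complex.sub_re, Complex.mul_re, Complex.conj_ofReal, Complex.ofReal_re,
      Complex.ofReal_im, zero_mul, sub_zero, h2, h4] at h1
    linarith
  have hc : 0 ≤ (inner ℂ (D ψ) (D (D ψ))).re := by rw [hq]; linarith [hle (D ψ)]
  set a := ‖D ψ‖ ^ 2
  set c := (inner ℂ (D ψ) (D (D ψ))).re
  have ha : a = 0 := by
    have ha0 : 0 ≤ a := sq_nonneg _
    by_contra hne
    have hpos : 0 < a := lt_of_le_of_ne ha0 (Ne.symm hne)
    -- This `s` makes the expression `-s² (c + 2)`, negative unless `a = 0`; the `+ 1` keeps the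
    -- denominator positive when `c = 0`.
    have h1 := h0 (a / (c + 1))
    have h2 : - 2 * (a / (c + 1)) * a + (a / (c + 1)) ^ 2 * c
        = - (a / (c + 1)) ^ 2 * (c + 2) := by field_simp; ring
    rw [h2] at h1
    have : 0 < (a / (c + 1)) ^ 2 * (c + 2) := by positivity
    linarith
  have hDψ : D ψ = 0 := by simpa [a] using ha
  have : ψ - T ψ = 0 := hDψ
  exact (sub_eq_zero.1 this).symm

/-- The events with setting `x`. -/
def settingEvents (l : Leg) (x : Fin l.settings) : Finset l.Event :=
  Finset.univ.map (Function.Embedding.sigmaMk x)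

theorem IsPOVM.sum_settingEvents {l : Leg} {I : Type} {A : OpSystem l I} (h : IsPOVM A)
    (x : Fin l.settings) : ∑ e ∈ settingEvents l x, A e = 1 := by
  rw [settingEvents, Finset.sum_map]
  exact h.2 x

/-! ### Consequences of a full self-test for the reference realization -/

section Reference

variable {ι : Type} [Fintype ι] [DecidableEq ι] {L : ι → Leg}

theorem sum_tensorOp_eq_one {I : ι → Type} {A : ∀ k, OpSystem (L k) (I k)}
    (hA : ∀ k, IsPOVM (A k)) (e₀ : ∀ k, (L k).Event) :
    ∑ r ∈ Fintype.piFinset (fun k => settingEvents (L k) (e₀ k).1), tensorOp (fun k => A k (r k))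
      = 1 := by
  rw [← tensorOp_sum, ← tensorOp_one]
  congr 1
  funext k
  exact (hA k).sum_settingEvents _

/-- Summing out all outcomes of the other parties, at the settings of `e₀`, turns their factors into
`𝟙`. This recovers single-party operators from the full products, the only operators that the
self-test mentions. -/
theorem sum_tensorOp_eq_localOp {I : ι → Type} {A : ∀ k, OpSystem (L k) (I k)}
    (hA : ∀ k, IsPOVM (A k)) (e₀ : ∀ k, (L k).Event) (k : ι) (e : (L k).Event) :
    ∑ r ∈ Fintype.piFinset (Function.update (fun k => settingEvents (L k) (e₀ k).1) k {e}),
      tensorOp (fun k => A k (r k)) = localOp k (A k e) := by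
  rw [← tensorOp_sum, localOp]
  congr 1
  funext j
  by_cases h : j = k
  · subst h; simp
  · simp only [Function.update_of_ne h]
    exact (hA j).sum_settingEvents _

theorem bellOp_adjoint (B : BellFunctional L) {I : ι → Type} {A : ∀ k, OpSystem (L k) (I k)}
    (hA : ∀ k, IsPOVM (A k)) : ContinuousLinearMap.adjoint (bellOp B A) = bellOp B A := by
  rw [bellOp, map_sum]
  refine Finset.sum_congr rfl fun e _ => ?_
  rw [map_smulₛₗ, tensorOp_adjoint]
  simp [(hA _).adjoint_eq]

theorem bellOp_intertwine {I J : ι → Type} {N : Type} {A : ∀ k, OpSystem (L k) (I k)}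
    {A' : ∀ k, OpSystem (L k) (J k)} (F : Op (∀ k, I k) (∀ k, I k) →ₐ[ℂ] Op N N)
    {W : Op (∀ k, J k) N} (h : ∀ k e, F (localOp k (A k e)) ∘L W = W ∘L localOp k (A' k e))
    (B : BellFunctional L) : F (bellOp B A) ∘L W = W ∘L bellOp B A' := by
  rw [bellOp, bellOp, map_sum, ContinuousLinearMap.finsetSum_comp,
    ContinuousLinearMap.comp_finsetSum]
  refine Finset.sum_congr rfl fun e _ => ?_
  rw [map_smul, ContinuousLinearMap.smul_comp, ContinuousLinearMap.comp_smul,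
    tensorOp_intertwine F W fun k => h k (e k)]

theorem IsNormalized.re_inner_le {B : BellFunctional L} (hB : IsNormalized B) {I : ι → Type}
    {A : ∀ k, OpSystem (L k) (I k)} (hA : ∀ k, IsPOVM (A k)) (v : Hilb (∀ k, I k)) :
    (inner ℂ v (bellOp B A v)).re ≤ ‖v‖ ^ 2 := by
  by_cases hv : v = 0
  · simp [hv]
  have hn : ‖v‖ ≠ 0 := norm_ne_zero_iff.2 hv
  have h := hB.2 ⟨I, A, ((‖v‖⁻¹ : ℝ) : ℂ) • v, hA, by simp [norm_smul, hn], rfl⟩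
  rw [map_smul, inner_smul_left, inner_smul_right, Complex.conj_ofReal, Complex.re_ofReal_mul,
    Complex.re_ofReal_mul, ← mul_assoc, ← mul_inv, inv_mul_le_iff₀ (by positivity)] at h
  nlinarith

variable {d : ι → ℕ} {B : BellFunctional L} {A' : ∀ k, OpSystem (L k) (Fin (d k))}
  {ψ' : Hilb (∀ k, Fin (d k))}

/-- In a full self-test, every optimal realization contains the reference realization. -/
theorem FullySelfTests.exists_intertwiner (h : FullySelfTests B A' ψ') {I : ι → Type}
    {A : ∀ k, OpSystem (L k) (I k)} (hA : ∀ k, IsPOVM (A k)) {ψ : Hilb (∀ k, I k)}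
    (hψ : ‖ψ‖ = 1) (hv : (inner ℂ ψ (bellOp B A ψ)).re = 1) :
    ∃ W : Op (∀ k, Fin (d k)) (∀ k, I k), ContinuousLinearMap.adjoint W ∘L W = 1 ∧ W ψ' = ψ ∧
      ∀ k e, localOp k (A k e) ∘L W = W ∘L localOp k (A' k e) := by
  obtain ⟨b, Ψ, hΨ, hψΨ, K, junk, U, -, hU⟩ := h.self_test I A ψ hA hψ hv
  -- If some party had no event, the Bell operator would be an empty sum and could not have the
  -- value `1`.
  obtain ⟨e₀⟩ : Nonempty (∀ k, (L k).Event) := by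
    by_contra hne
    rw [not_nonempty_iff] at hne
    simp [bellOp] at hv
  have hA' : ∀ k, IsPOVM (A' k) := fun k => (h.projective k).1
  -- `R` is the unitary from the standard product basis to the one supplied by the self-test; `W`
  -- below sends that basis to `Ψ`.
  set R : Op (∀ k, Fin (d k)) (∀ k, Fin (d k)) := tensorOp fun k => familyOp (b k)
  have hRket : ∀ i, R (ket i) = prodVec fun k => b k (i k) := fun i => by
    apply lp.ext; funext j
    rw [tensorOp_ket]
    simp only [familyOp_ket]
    rfl
  have hR1 : ContinuousLinearMap.adjoint R ∘L R = 1 := by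
    rw [tensorOp_adjoint, tensorOp_comp, ← tensorOp_one]
    congr 1
    funext k
    exact adjoint_comp_familyOp (b k).orthonormal
  have hR2 : R ∘L ContinuousLinearMap.adjoint R = 1 := by
    rw [tensorOp_adjoint, tensorOp_comp, ← tensorOp_one]
    congr 1
    funext k
    ext1 f
    rw [ContinuousLinearMap.comp_apply, familyOp_apply]
    simp only [adjoint_familyOp_apply]
    exact (b k).sum_repr' f
  set W : Op (∀ k, Fin (d k)) (∀ k, I k) := familyOp Ψ ∘L ContinuousLinearMap.adjoint R with hW
  have hWR : W ∘L R = familyOp Ψ := by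
    rw [hW, ContinuousLinearMap.comp_assoc, hR1]; rfl
  have hWW : ContinuousLinearMap.adjoint W ∘L W = 1 := by
    rw [hW, ContinuousLinearMap.adjoint_comp, ContinuousLinearMap.adjoint_adjoint,
      ContinuousLinearMap.comp_assoc,
      ← ContinuousLinearMap.comp_assoc (ContinuousLinearMap.adjoint (familyOp Ψ)),
      adjoint_comp_familyOp hΨ]
    exact hR2
  have hR_surj : ∀ φ, ∃ g, φ = R g := fun φ =>
    ⟨ContinuousLinearMap.adjoint R φ, by
      rw [← ContinuousLinearMap.comp_apply, hR2]; rfl⟩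
  set UU := tensorOp (fun k => (U k).toContinuousLinearMap)
  have key : ∀ (e : ∀ k, (L k).Event) (φ) (f : ∀ k, Fin (d k) × K k),
      UU (tensorOp (fun k => A k (e k)) (W φ)) f
        = tensorOp (fun k => A' k (e k)) φ (fun k => (f k).1) * junk (fun k => (f k).2) := by
    intro e φ f
    obtain ⟨g, rfl⟩ := hR_surj φ
    rw [← ContinuousLinearMap.comp_apply W R, hWR, familyOp_apply]
    have hRg : R g = ∑ i, g i • prodVec fun k => b k (i k) := by
      conv_lhs => rw [← sum_ket g]
      simp [hRket]
    rw [hRg]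
    simp only [map_sum, map_smul, lp.coeFn_sum, lp.coeFn_smul, Finset.sum_apply, Pi.smul_apply, hU,
      Finset.sum_mul, smul_eq_mul, mul_assoc]
  have key_sum : ∀ (s : Finset (∀ k, (L k).Event)) (φ) (f : ∀ k, Fin (d k) × K k),
      UU ((∑ e ∈ s, tensorOp (fun k => A k (e k))) (W φ)) f
        = (∑ e ∈ s, tensorOp (fun k => A' k (e k))) φ (fun k => (f k).1)
          * junk (fun k => (f k).2) := by
    intro s φ f
    simp only [sum_apply, map_sum, lp.coeFn_sum, Finset.sum_apply, key, Finset.sum_mul]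
  have hUinj : Function.Injective UU := by
    refine injective_of_adjoint_comp ?_
    rw [tensorOp_adjoint, tensorOp_comp, ← tensorOp_one]
    congr 1
    funext k
    exact (U k).adjoint_comp_self
  refine ⟨W, hWW, ?_, fun k e => ?_⟩
  · rw [hW, ContinuousLinearMap.comp_apply, familyOp_apply, hψΨ]
    refine Finset.sum_congr rfl fun i _ => ?_
    rw [← inner_ket_left, ContinuousLinearMap.adjoint_inner_right, hRket]
  · ext1 φ
    rw [ContinuousLinearMap.comp_apply, ContinuousLinearMap.comp_apply]
    refine hUinj (lp.ext (funext fun f => ?_))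
    -- Both `localOp k (A k e) (W φ)` and `W (localOp k (A' k e) φ)` are mapped by the local
    -- isometries to `localOp k (A' k e) φ ⊗ junk`; the first uses the sum giving a local operator,
    -- the second the sum giving `𝟙`.
    have h1 := key_sum
      (Fintype.piFinset (Function.update (fun k => settingEvents (L k) (e₀ k).1) k {e})) φ f
    have h2 := key_sum (Fintype.piFinset (fun k => settingEvents (L k) (e₀ k).1))
      (localOp k (A' k e) φ) f
    rw [sum_tensorOp_eq_localOp hA, sum_tensorOp_eq_localOp hA'] at h1
    rw [sum_tensorOp_eq_one hA, sum_tensorOp_eq_one hA'] at h2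
    exact h1.trans h2.symm

theorem FullySelfTests.povm (h : FullySelfTests B A' ψ') (k : ι) : IsPOVM (A' k) :=
  (h.projective k).1

/-- Normalization only says that some realization attains `1`; that value is pulled back to the
reference along the intertwiner. -/
theorem FullySelfTests.value_reference (h : FullySelfTests B A' ψ') :
    (inner ℂ ψ' (bellOp B A' ψ')).re = 1 := by
  obtain ⟨I, A, ψ, hA, hψ, hv⟩ := h.normalized.1
  obtain ⟨W, hW, rfl, hinter⟩ := h.exists_intertwiner hA hψ hv.symm
  have h1 := bellOp_intertwine (AlgHom.id ℂ _) hinter B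
  rw [AlgHom.id_apply] at h1
  rw [← ContinuousLinearMap.comp_apply, h1, ContinuousLinearMap.comp_apply,
    inner_of_adjoint_comp hW] at hv
  exact hv.symm

theorem FullySelfTests.bellOp_reference (h : FullySelfTests B A' ψ') : bellOp B A' ψ' = ψ' := by
  refine eq_self_of_maximal (bellOp_adjoint B h.povm) (h.normalized.re_inner_le h.povm) ?_
  rw [h.value_reference, h.norm_state, one_pow]

/-- A subspace containing the reference state and invariant under all measurement operators is the
whole space. -/
theorem FullySelfTests.eq_top (h : FullySelfTests B A' ψ')
    (S : Submodule ℂ (Hilb (∀ k, Fin (d k)))) (hψ : ψ' ∈ S)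
    (hS : ∀ k e, ∀ v ∈ S, localOp k (A' k e) v ∈ S) : S = ⊤ := by
  rw [Submodule.eq_top_iff']
  intro v
  have hv : v ∈ {v | ∃ f ∈ tensorPolynomials A', v = f ψ'} := by rw [h.cyclic]; trivial
  obtain ⟨f, hf, rfl⟩ := hv
  have : ∀ w ∈ S, f w ∈ S := by
    induction hf using Algebra.adjoin_induction with
    | mem T hT => obtain ⟨k, e, rfl⟩ := hT; exact hS k e
    | algebraMap c => exact fun w hw => S.smul_mem c hw
    | add T T' _ _ h1 h2 => exact fun w hw => S.add_mem (h1 w hw) (h2 w hw)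
    | mul T T' _ _ h1 h2 => exact fun w hw => h1 _ (h2 w hw)
  exact this _ hψ

/-- The set where `X` and `Y` agree is an invariant subspace containing `ψ'`, hence everything. -/
theorem FullySelfTests.intertwiner_ext (h : FullySelfTests B A' ψ') {N : Type}
    {G : ∀ k, (L k).Event → Op N N} {X Y : Op (∀ k, Fin (d k)) N}
    (hX : ∀ k e, G k e ∘L X = X ∘L localOp k (A' k e))
    (hY : ∀ k e, G k e ∘L Y = Y ∘L localOp k (A' k e)) (hψ : X ψ' = Y ψ') : X = Y := by
  have := h.eq_top (LinearMap.eqLocus X.toLinearMap Y.toLinearMap) hψ fun k e v hv => by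
    have h1 := DFunLike.congr_fun (hX k e) v
    have h2 := DFunLike.congr_fun (hY k e) v
    have h3 : X v = Y v := hv
    change X (localOp k (A' k e) v) = Y (localOp k (A' k e) v)
    simp only [ContinuousLinearMap.comp_apply] at h1 h2
    rw [← h1, ← h2, h3]
  ext1 v
  have hv : v ∈ LinearMap.eqLocus X.toLinearMap Y.toLinearMap := by rw [this]; trivial
  exact hv

/-- The reference measurements act irreducibly. -/
theorem FullySelfTests.commutant (h : FullySelfTests B A' ψ')
    {Z : Op (∀ k, Fin (d k)) (∀ k, Fin (d k))}
    (hZ : ∀ k e, localOp k (A' k e) ∘L Z = Z ∘L localOp k (A' k e)) :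
    ∃ z : ℂ, Z = z • 1 := by
  -- Schur-type step: `Y ψ'` is again fixed by the Bell operator, so after normalization the
  -- self-test yields an isometric intertwiner with the same value at `ψ'`. By uniqueness it is a
  -- multiple of `Y`.
  have inj : ∀ Y : Op (∀ k, Fin (d k)) (∀ k, Fin (d k)),
      (∀ k e, localOp k (A' k e) ∘L Y = Y ∘L localOp k (A' k e)) → Y ≠ 0 →
      Function.Injective Y := by
    intro Y hY hY0
    have hYψ : Y ψ' ≠ 0 := fun h0 => hY0 (h.intertwiner_ext hY (Y := 0) (by simp) (by simp [h0]))
    have hn : ‖Y ψ'‖ ≠ 0 := norm_ne_zero_iff.2 hYψ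
    have hB : bellOp B A' (Y ψ') = Y ψ' := by
      have h1 := bellOp_intertwine (AlgHom.id ℂ _) hY B
      rw [AlgHom.id_apply] at h1
      rw [← ContinuousLinearMap.comp_apply, h1, ContinuousLinearMap.comp_apply,
        h.bellOp_reference]
    have hunit : ‖((‖Y ψ'‖⁻¹ : ℝ) : ℂ) • Y ψ'‖ = 1 := by simp [norm_smul, hn]
    obtain ⟨W, hW, hWψ, hWint⟩ := h.exists_intertwiner h.povm (ψ := ((‖Y ψ'‖⁻¹ : ℝ) : ℂ) • Y ψ')
      hunit (by
        rw [map_smul, hB, inner_self_eq_norm_sq_to_K, hunit]; simp)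
    have hYW : ((‖Y ψ'‖⁻¹ : ℝ) : ℂ) • Y = W :=
      h.intertwiner_ext (fun k e => by
        rw [ContinuousLinearMap.comp_smul, hY, ContinuousLinearMap.smul_comp]) hWint hWψ.symm
    intro x y hxy
    refine injective_of_adjoint_comp hW ?_
    rw [← hYW, smul_apply, smul_apply, hxy]
  have : Nontrivial (Hilb (∀ k, Fin (d k))) :=
    nontrivial_of_ne ψ' 0 (norm_ne_zero_iff.1 (by rw [h.norm_state]; norm_num))
  -- For an eigenvalue `z`, the operator `Z - z` lies in the commutant and has a kernel, so it must
  -- vanish.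
  obtain ⟨z, hz⟩ := Module.End.exists_eigenvalue Z.toLinearMap
  obtain ⟨v, hv, hv0⟩ := hz.exists_hasEigenvector
  refine ⟨z, ?_⟩
  by_contra hne
  refine hv0 (inj (Z - z • 1) (fun k e => ?_) (sub_ne_zero.2 hne) ?_)
  · rw [ContinuousLinearMap.comp_sub, ContinuousLinearMap.sub_comp, hZ,
      ContinuousLinearMap.comp_smul, ContinuousLinearMap.smul_comp]
    rfl
  · rw [map_zero]
    have : Z v = z • v := Module.End.mem_eigenspace_iff.1 hv
    change Z v - z • v = 0
    rw [this, sub_self]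

end Reference

/-! ### Irreducibility and the full matrix algebra -/

/-- A self-adjoint set of operators with trivial commutant generates the full matrix algebra. -/
theorem adjoin_eq_top_of_commutant {I : Type} [Fintype I] {s : Set (Op I I)}
    (hs : ∀ T ∈ s, ContinuousLinearMap.adjoint T = T)
    (hc : ∀ Z : Op I I, (∀ T ∈ s, T ∘L Z = Z ∘L T) → ∃ z : ℂ, Z = z • 1) :
    Algebra.adjoin ℂ s = ⊤ := by
  classical
  set R := Algebra.adjoin ℂ s with hR
  have hstar : ∀ r ∈ R, ContinuousLinearMap.adjoint r ∈ R := by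
    intro r hr
    induction hr using Algebra.adjoin_induction with
    | mem T hT => rw [hs T hT]; exact Algebra.subset_adjoin hT
    | algebraMap c =>
      have : ContinuousLinearMap.adjoint (algebraMap ℂ (Op I I) c)
          = algebraMap ℂ (Op I I) (conj c) := by
        rw [Algebra.algebraMap_eq_smul_one, Algebra.algebraMap_eq_smul_one, map_smulₛₗ]
        congr 1
        exact ContinuousLinearMap.adjoint_id
      rw [this]
      exact R.algebraMap_mem _
    | add T T' _ _ h1 h2 => rw [map_add]; exact R.add_mem h1 h2
    | mul T T' _ _ h1 h2 =>
      have : ContinuousLinearMap.adjoint (T * T')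
          = ContinuousLinearMap.adjoint T' * ContinuousLinearMap.adjoint T :=
        ContinuousLinearMap.adjoint_comp T T'
      rw [this]
      exact R.mul_mem h2 h1
  have hsmul : ∀ (r : R) (v : Hilb I), r • v = (r : Op I I) v := fun _ _ => rfl
  -- Since `R` is closed under adjoints, the orthogonal complement of an invariant subspace is
  -- invariant.
  have : IsSemisimpleModule R (Hilb I) := by
    rw [isSemisimpleModule_iff]
    refine ⟨fun p => ?_⟩
    let p' : Submodule ℂ (Hilb I) :=
      { carrier := p
        add_mem' := p.add_mem
        zero_mem' := p.zero_mem
        smul_mem' := fun c v hv => p.smul_mem (algebraMap ℂ R c) hv }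
    let q : Submodule R (Hilb I) :=
      { carrier := p'ᗮ
        add_mem' := p'ᗮ.add_mem
        zero_mem' := p'ᗮ.zero_mem
        smul_mem' := fun r v hv => by
          refine (Submodule.mem_orthogonal p' _).2 fun u hu => ?_
          rw [hsmul, ← ContinuousLinearMap.adjoint_inner_left]
          exact (Submodule.mem_orthogonal p' v).1 hv _
            (p.smul_mem ⟨_, hstar r.1 r.2⟩ hu) }
    refine ⟨q, ?_⟩
    constructor
    · rw [Submodule.disjoint_def]
      intro x hx hx'
      exact (Submodule.disjoint_def.1 p'.orthogonal_disjoint) x hx hx'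
    · rw [codisjoint_iff, Submodule.eq_top_iff']
      intro x
      have hx : x ∈ p' ⊔ p'ᗮ := by rw [Submodule.sup_orthogonal_of_hasOrthogonalProjection]; trivial
      obtain ⟨y, hy, z, hz, rfl⟩ := Submodule.mem_sup.1 hx
      exact Submodule.mem_sup.2 ⟨y, hy, z, hz, rfl⟩
  rw [Algebra.eq_top_iff]
  intro X
  have hscalar : ∀ g : Module.End R (Hilb I), ∃ z : ℂ, ∀ v, g v = z • v := by
    intro g
    let g' : Hilb I →ₗ[ℂ] Hilb I :=
      { toFun := g
        map_add' := map_add g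
        map_smul' := fun c v => map_smul g (algebraMap ℂ R c) v }
    obtain ⟨z, hz⟩ := hc g'.toContinuousLinearMap fun T hT => by
      ext1 v
      exact (map_smul g (⟨T, Algebra.subset_adjoin hT⟩ : R) v).symm
    exact ⟨z, fun v => DFunLike.congr_fun hz v⟩
  -- All `R`-endomorphisms are scalars, so every linear `X` commutes with them; the density theorem
  -- then finds an element of `R` agreeing with `X` on the finite basis.
  let f : Module.End (Module.End R (Hilb I)) (Hilb I) :=
    { toFun := X
      map_add' := map_add X
      map_smul' := fun g v => by
        obtain ⟨z, hz⟩ := hscalar g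
        change X (g v) = g (X v)
        rw [hz, hz, map_smul] }
  obtain ⟨r, hr⟩ := jacobson_density f (Finset.univ.image ket)
  have : X = r := map_ext_ket fun i => hr (ket i) (by simp)
  rw [this]
  exact r.2

section Reference

variable {ι : Type} [Fintype ι] [DecidableEq ι] {L : ι → Leg}

/-- Freezing the other indices at `i` reads `T` off `localOp k T`. Once some index tuple exists,
`localOp k` therefore loses no information. -/
theorem localOp_update_entry {I : ι → Type} (k : ι) (T : Op (I k) (I k)) (i : ∀ k, I k)
    (a b : I k) :
    localOp k T (ket (Function.update i k a)) (Function.update i k b) = T (ket a) b := by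
  rw [localOp, tensorOp_ket, Fintype.prod_eq_mul_prod_subtype_ne _ k, Finset.prod_eq_one]
  · simp
  · intro j _
    rw [Function.update_of_ne j.2, Function.update_of_ne j.2, Function.update_of_ne j.2,
      one_apply_eq_self, ket_self]

theorem exists_index {I : Type} {ψ : Hilb I} (h : ‖ψ‖ = 1) : Nonempty I := by
  by_contra hne
  rw [not_nonempty_iff] at hne
  have : ψ = 0 := lp.ext (funext fun i => hne.elim i)
  simp [this] at h

variable {d : ι → ℕ} {B : BellFunctional L} {A' : ∀ k, OpSystem (L k) (Fin (d k))}
  {ψ' : Hilb (∀ k, Fin (d k))}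

/-- The reference measurements of each party generate the full matrix algebra. -/
theorem FullySelfTests.adjoin_eq_top (h : FullySelfTests B A' ψ') (k : ι) :
    Algebra.adjoin ℂ (Set.range (A' k)) = ⊤ := by
  refine adjoin_eq_top_of_commutant ?_ fun Z hZ => ?_
  · rintro _ ⟨e, rfl⟩
    exact (h.povm k).adjoint_eq e
  · obtain ⟨i⟩ := exists_index h.norm_state
    -- Acting on factor `k` alone, `Z` also commutes with the other parties, so the commutant of the
    -- whole system applies.
    obtain ⟨z, hz⟩ := h.commutant (Z := localOp k Z) fun j e => by
      by_cases hj : j = k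
      · subst hj
        rw [localOp_comp, localOp_comp, hZ _ ⟨e, rfl⟩]
      · exact localOp_commute hj _ _
    refine ⟨z, op_ext fun a b => ?_⟩
    rw [← localOp_update_entry k Z i a b, ← localOp_update_entry k (z • 1) i a b, hz,
      ← localOpLinear_apply, map_smul, localOpLinear_apply, localOp_one]

end Reference

/-! ### Embeddings of basis sets -/

section Embedding

variable {I J K : Type}

/-- The restriction of the coefficients along an injection of the basis sets. -/
noncomputable def restrictOp (j : I ↪ J) : Op J I :=
  LinearMap.mkContinuous
    { toFun := fun f => (⟨fun i => f (j i),
        memHilb ((hilb_summable f).comp_injective j.injective)⟩ : Hilb I)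
      map_add' := fun _ _ => rfl
      map_smul' := fun _ _ => rfl } 1 fun f => by
    rw [one_mul]
    refine (pow_le_pow_iff_left₀ (norm_nonneg _) (norm_nonneg _) two_ne_zero).1 ?_
    rw [hilb_norm_sq, hilb_norm_sq]
    exact tsum_comp_le_tsum_of_inj (hilb_summable f) (fun _ => sq_nonneg _) j.injective

theorem restrictOp_apply (j : I ↪ J) (f : Hilb J) (i : I) : restrictOp j f i = f (j i) := rfl

/-- The isometry induced by an injection of the basis sets. -/
noncomputable def embedOp (j : I ↪ J) : Op I J := ContinuousLinearMap.adjoint (restrictOp j)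

theorem embedOp_apply (j : I ↪ J) (f : Hilb I) (i : I) : embedOp j f (j i) = f i := by
  classical
  rw [← inner_ket_left, embedOp, ContinuousLinearMap.adjoint_inner_right, ← inner_ket_left]
  congr 1
  apply lp.ext; funext a
  simp [restrictOp_apply, ket_apply]

theorem embedOp_apply_of_notMem (j : I ↪ J) (f : Hilb I) {b : J} (hb : ∀ i, j i ≠ b) :
    embedOp j f b = 0 := by
  classical
  rw [← inner_ket_left, embedOp, ContinuousLinearMap.adjoint_inner_right]
  have : restrictOp j (ket b) = 0 := by
    apply lp.ext; funext a
    simp [restrictOp_apply, ket_apply, hb]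
  rw [this, inner_zero_left]

theorem restrictOp_embedOp (j : I ↪ J) : restrictOp j ∘L embedOp j = 1 := by
  ext1 f
  apply lp.ext; funext i
  exact embedOp_apply j f i

theorem restrictOp_embedOp_of_ne (j : I ↪ J) (l : K ↪ J) (h : ∀ i k, l k ≠ j i) :
    restrictOp j ∘L embedOp l = 0 := by
  ext1 f
  apply lp.ext; funext i
  exact embedOp_apply_of_notMem l f (h i)

theorem embedOp_ket (j : I ↪ J) (i : I) : embedOp j (ket i) = ket (j i) := by
  classical
  apply lp.ext; funext b
  by_cases hb : ∃ a, j a = b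
  · obtain ⟨a, rfl⟩ := hb
    simp [embedOp_apply, ket_apply]
  · push Not at hb
    rw [embedOp_apply_of_notMem j _ hb]
    simp [ket_apply, (hb i).symm]

theorem embedOp_comp (l : J ↪ K) (j : I ↪ J) :
    embedOp l ∘L embedOp j = embedOp (j.trans l) := by
  refine map_ext_ket fun i => ?_
  simp [embedOp_ket]

theorem adjoint_embedOp (j : I ↪ J) : ContinuousLinearMap.adjoint (embedOp j) = restrictOp j :=
  ContinuousLinearMap.adjoint_adjoint _

theorem tensorOp_embedOp {ι : Type} [Fintype ι] {I J : ι → Type} (j : ∀ k, I k ↪ J k) :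
    tensorOp (fun k => embedOp (j k)) = embedOp (Function.Embedding.piCongrRight j) := by
  classical
  refine op_ext fun i b => ?_
  rw [tensorOp_ket, embedOp_ket]
  simp only [embedOp_ket, ket_apply]
  rw [Finset.prod_ite_zero]
  simp [funext_iff]

end Embedding

/-! ### Local isometries from an intertwiner -/

/-- The operator `|a⟩⟨b|`. -/
noncomputable def matrixUnit {I : Type} (a b : I) : Op I I := (innerSL ℂ (ket b)).smulRight (ket a)

theorem matrixUnit_apply {I : Type} (a b : I) (f : Hilb I) : matrixUnit a b f = f b • ket a := by
  simp [matrixUnit, inner_ket_left]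

theorem adjoint_matrixUnit {I : Type} (a b : I) :
    ContinuousLinearMap.adjoint (matrixUnit a b) = matrixUnit b a := by
  classical
  refine op_ext fun i j => ?_
  rw [adjoint_entry, matrixUnit_apply, matrixUnit_apply]
  rw [lp.coeFn_smul, Pi.smul_apply, lp.coeFn_smul, Pi.smul_apply, ket_apply, ket_apply, ket_apply,
    ket_apply]
  by_cases h1 : i = a <;> by_cases h2 : j = b <;> simp [h1, h2, eq_comm] <;>
    first | exact fun h => h2 h.symm | exact fun h => h1 h.symm

theorem sum_matrixUnit {I : Type} [Fintype I] (a : I) :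
    ∑ i, matrixUnit i a ∘L matrixUnit a i = 1 := by
  ext1 f
  rw [sum_apply]
  simp only [ContinuousLinearMap.comp_apply, matrixUnit_apply]
  simp [ket_self, sum_ket]

theorem tensorOp_matrixUnit {ι : Type} [Fintype ι] {I : ι → Type} (a b : ∀ k, I k) :
    tensorOp (fun k => matrixUnit (a k) (b k)) = matrixUnit a b := by
  classical
  refine op_ext fun i j => ?_
  rw [tensorOp_ket]
  simp only [matrixUnit_apply, lp.coeFn_smul, Pi.smul_apply, ket_apply, smul_eq_mul,
    Finset.prod_mul_distrib]
  rw [Finset.prod_ite_zero, Finset.prod_ite_zero]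
  simp [funext_iff]

/-- If `(T ⊗ 𝟙) w = 0`, then the projection onto the kernel of `T` fixes `w`. -/
theorem ampl_starProjection_ker {I K : Type} (T : Op I I) (w : Hilb (I × K))
    (hw : ampl K T w = 0) : ampl K (LinearMap.ker T.toLinearMap).starProjection w = w := by
  apply lp.ext; funext p
  rw [ampl_apply]
  have h : slice w p.2 ∈ LinearMap.ker T.toLinearMap := by
    have := congrArg (sliceOp I p.2) hw
    rw [map_zero] at this
    exact this
  rw [Submodule.starProjection_eq_self_iff.2 h]
  rfl

section Local

variable {ι : Type} [Fintype ι] [DecidableEq ι]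

/-- The hypothesis places the range of `W` in `ker T ⊗ (rest)`: every slice of `W v` along the other
factors lies in `ker T`. -/
theorem localOp_starProjection_ker {I : ι → Type} {N : Type} (k : ι) (T : Op (I k) (I k))
    (W : Op N (∀ k, I k)) (hW : localOp k T ∘L W = 0) :
    localOp k (LinearMap.ker T.toLinearMap).starProjection ∘L W = W := by
  ext1 v
  have h1 := DFunLike.congr_fun (localOp_piSplitAt_self k T) (W v)
  have h2 := DFunLike.congr_fun
    (localOp_piSplitAt_self k (LinearMap.ker T.toLinearMap).starProjection) (W v)
  have h3 : localOp k T (W v) = 0 := DFunLike.congr_fun hW v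
  rw [← ampl_eq_tensor2] at h1 h2
  simp only [ContinuousLinearMap.comp_apply] at h1 h2 ⊢
  rw [h3, map_zero] at h1
  rw [ampl_starProjection_ker T _ h1.symm] at h2
  exact (reindex (Equiv.piSplitAt k I)).injective h2

variable {L : ι → Leg} {J I : ι → Type} {A' : ∀ k, OpSystem (L k) (J k)}
  {A : ∀ k, OpSystem (L k) (I k)}

/-- The same polynomial in the operators `A k` lifts one in `A' k`. The adjoint is carried along
because later `Y† Y`, and not only `Y`, must be controlled on the range of `W`. -/
theorem exists_lift (hA' : ∀ k, IsPOVM (A' k)) (hA : ∀ k, IsPOVM (A k))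
    {W : Op (∀ k, J k) (∀ k, I k)}
    (hW : ∀ k e, localOp k (A k e) ∘L W = W ∘L localOp k (A' k e)) (k : ι) {X : Op (J k) (J k)}
    (hX : X ∈ Algebra.adjoin ℂ (Set.range (A' k))) :
    ∃ Y : Op (I k) (I k), localOp k Y ∘L W = W ∘L localOp k X ∧
      localOp k (ContinuousLinearMap.adjoint Y) ∘L W
        = W ∘L localOp k (ContinuousLinearMap.adjoint X) := by
  have intertwine_comp : ∀ {Y Y' : Op (I k) (I k)} {X X' : Op (J k) (J k)},
      localOp k Y ∘L W = W ∘L localOp k X → localOp k Y' ∘L W = W ∘L localOp k X' →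
      localOp k (Y ∘L Y') ∘L W = W ∘L localOp k (X ∘L X') := by
    intro Y Y' X X' h h'
    rw [← localOp_comp, ← localOp_comp, ContinuousLinearMap.comp_assoc, h',
      ← ContinuousLinearMap.comp_assoc, h, ContinuousLinearMap.comp_assoc]
  have intertwine_add : ∀ {Y Y' : Op (I k) (I k)} {X X' : Op (J k) (J k)},
      localOp k Y ∘L W = W ∘L localOp k X → localOp k Y' ∘L W = W ∘L localOp k X' →
      localOp k (Y + Y') ∘L W = W ∘L localOp k (X + X') := by
    intro Y Y' X X' h h'
    rw [← localOpLinear_apply, ← localOpLinear_apply, map_add, map_add,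
      ContinuousLinearMap.add_comp, ContinuousLinearMap.comp_add]
    exact congrArg₂ (· + ·) h h'
  have intertwine_scalar : ∀ c : ℂ, localOp k (c • (1 : Op (I k) (I k))) ∘L W
      = W ∘L localOp k (c • (1 : Op (J k) (J k))) := by
    intro c
    rw [← localOpLinear_apply, ← localOpLinear_apply, map_smul, map_smul, localOpLinear_apply,
      localOpLinear_apply, localOp_one, localOp_one, ContinuousLinearMap.smul_comp,
      ContinuousLinearMap.comp_smul]
    rfl
  have adjoint_scalar : ∀ (H : Type) (c : ℂ),
      ContinuousLinearMap.adjoint (c • (1 : Op H H)) = conj c • (1 : Op H H) := by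
    intro H c
    rw [map_smulₛₗ]
    congr 1
    exact ContinuousLinearMap.adjoint_id
  induction hX using Algebra.adjoin_induction with
  | mem T hT =>
    obtain ⟨e, rfl⟩ := hT
    refine ⟨A k e, hW k e, ?_⟩
    rw [(hA k).adjoint_eq, (hA' k).adjoint_eq, hW]
  | algebraMap c =>
    rw [Algebra.algebraMap_eq_smul_one]
    refine ⟨c • 1, intertwine_scalar c, ?_⟩
    rw [adjoint_scalar, adjoint_scalar]
    exact intertwine_scalar _
  | add T T' _ _ h1 h2 =>
    obtain ⟨Y, hY, hY'⟩ := h1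
    obtain ⟨Z, hZ, hZ'⟩ := h2
    refine ⟨Y + Z, intertwine_add hY hZ, ?_⟩
    rw [map_add, map_add]
    exact intertwine_add hY' hZ'
  | mul T T' _ _ h1 h2 =>
    obtain ⟨Y, hY, hY'⟩ := h1
    obtain ⟨Z, hZ, hZ'⟩ := h2
    refine ⟨Y ∘L Z, intertwine_comp hY hZ, ?_⟩
    have : ContinuousLinearMap.adjoint (T * T')
        = ContinuousLinearMap.adjoint T' ∘L ContinuousLinearMap.adjoint T :=
      ContinuousLinearMap.adjoint_comp T T'
    rw [this, ContinuousLinearMap.adjoint_comp]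
    exact intertwine_comp hZ' hY'

end Local

/-- The injection `c ↦ (i, c)`. -/
def pairEmbedding {α β : Type} (i : α) : β ↪ α × β := ⟨fun c => (i, c), fun _ _ h => (Prod.mk.inj h).2⟩

/-- If `∑ᵢ (Y i)† Y i` is the identity on the range of the projection `P`, then
`v ↦ ∑ᵢ |i⟩ ⊗ Y i v` can be modified outside the range of `P` to an isometry. -/
theorem exists_isometry_extension {F I : Type} [Fintype F] (a : F) (Y : F → Op I I)
    (P : Op I I) (hP : P ∘L P = P) (hPa : ContinuousLinearMap.adjoint P = P)
    (hY : (∑ i, ContinuousLinearMap.adjoint (Y i) ∘L Y i) ∘L P = P) :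
    ∃ U : Hilb I →ₗᵢ[ℂ] Hilb (F × (I ⊕ I)), U.toContinuousLinearMap ∘L P
      = (∑ i, embedOp (Function.Embedding.inl.trans (pairEmbedding i)) ∘L Y i) ∘L P := by
  classical
  set j : F → (I ↪ F × (I ⊕ I)) := fun i => Function.Embedding.inl.trans (pairEmbedding i) with hj
  -- A second copy of `I`, orthogonal to all the images `j i`, receives the complement of the range
  -- of `P`; `a` merely picks a component of `F`.
  set j' : I ↪ F × (I ⊕ I) := Function.Embedding.inr.trans (pairEmbedding a) with hj'
  set Q : Op I (F × (I ⊕ I)) := ∑ i, embedOp (j i) ∘L Y i with hQ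
  set T : Op I (F × (I ⊕ I)) := Q ∘L P + embedOp j' ∘L (1 - P) with hT
  have h1 : ContinuousLinearMap.adjoint Q ∘L Q = ∑ i, ContinuousLinearMap.adjoint (Y i) ∘L Y i := by
    rw [hQ, map_sum, ContinuousLinearMap.finsetSum_comp]
    refine Finset.sum_congr rfl fun i _ => ?_
    rw [ContinuousLinearMap.comp_finsetSum, Finset.sum_eq_single i]
    · rw [ContinuousLinearMap.adjoint_comp, adjoint_embedOp, ContinuousLinearMap.comp_assoc,
        ← ContinuousLinearMap.comp_assoc (restrictOp (j i)), restrictOp_embedOp]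
      rfl
    · intro l _ hl
      rw [ContinuousLinearMap.adjoint_comp, adjoint_embedOp, ContinuousLinearMap.comp_assoc,
        ← ContinuousLinearMap.comp_assoc (restrictOp (j i)), restrictOp_embedOp_of_ne]
      · simp
      · intro x y h
        exact hl (Prod.mk.inj h).1
    · simp
  have h2 : ContinuousLinearMap.adjoint (embedOp j') ∘L Q = 0 := by
    rw [hQ, ContinuousLinearMap.comp_finsetSum]
    refine Finset.sum_eq_zero fun i _ => ?_
    rw [adjoint_embedOp, ← ContinuousLinearMap.comp_assoc, restrictOp_embedOp_of_ne]
    · simp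
    · intro x y h
      exact Sum.inl_ne_inr (Prod.mk.inj h).2
  have h3 : ∀ v w, inner ℂ (Q v) (embedOp j' w) = 0 := fun v w => by
    rw [← inner_conj_symm, ← ContinuousLinearMap.adjoint_inner_right,
      ← ContinuousLinearMap.comp_apply, h2]
    simp
  have h4 : ∀ v, ‖embedOp j' v‖ = ‖v‖ :=
    norm_of_adjoint_comp (by rw [adjoint_embedOp, restrictOp_embedOp])
  have h5 : ∀ v, ‖Q (P v)‖ ^ 2 = ‖P v‖ ^ 2 := fun v => by
    have : inner ℂ (Q (P v)) (Q (P v)) = inner ℂ (P v) (P v) := by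
      rw [← ContinuousLinearMap.adjoint_inner_right, ← ContinuousLinearMap.comp_apply, h1,
        ← ContinuousLinearMap.comp_apply _ P, hY]
    rw [inner_self_eq_norm_sq_to_K, inner_self_eq_norm_sq_to_K] at this
    exact_mod_cast this
  have h6 : ∀ v, inner ℂ (P v) (v - P v) = 0 := fun v => by
    rw [← ContinuousLinearMap.adjoint_inner_right, hPa, map_sub, ← ContinuousLinearMap.comp_apply,
      hP, sub_self, inner_zero_right]
  have hnorm : ∀ v, ‖T v‖ = ‖v‖ := fun v => by
    refine (pow_left_inj₀ (norm_nonneg _) (norm_nonneg _) two_ne_zero).1 ?_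
    have e1 : T v = Q (P v) + embedOp j' (v - P v) := rfl
    have e2 := norm_add_sq_eq_norm_sq_add_norm_sq_of_inner_eq_zero _ _ (h3 (P v) (v - P v))
    have e3 := norm_add_sq_eq_norm_sq_add_norm_sq_of_inner_eq_zero _ _ (h6 v)
    rw [add_sub_cancel] at e3
    rw [h4] at e2
    rw [e1]
    nlinarith [h5 v]
  refine ⟨⟨T.toLinearMap, hnorm⟩, ?_⟩
  ext1 v
  change Q (P (P v)) + embedOp j' (P v - P (P v)) = Q (P v)
  have : P (P v) = P v := DFunLike.congr_fun hP v
  rw [this, sub_self, map_zero, add_zero]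

section Dilation

variable {ι : Type} [Fintype ι] [DecidableEq ι] {L : ι → Leg} {d : ι → ℕ} {I : ι → Type}
  {A' : ∀ k, OpSystem (L k) (Fin (d k))} {A : ∀ k, OpSystem (L k) (I k)}

/-- An intertwiner of irreducible measurements factorizes by local isometries. -/
theorem exists_local_isometries (hA' : ∀ k, IsPOVM (A' k)) (hA : ∀ k, IsPOVM (A k))
    (htop : ∀ k, Algebra.adjoin ℂ (Set.range (A' k)) = ⊤) (a : ∀ k, Fin (d k))
    {W : Op (∀ k, Fin (d k)) (∀ k, I k)} (hiso : ContinuousLinearMap.adjoint W ∘L W = 1)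
    (hW : ∀ k e, localOp k (A k e) ∘L W = W ∘L localOp k (A' k e)) :
    ∃ (K : ι → Type) (junk : Hilb (∀ k, K k))
      (U : ∀ k, Hilb (I k) →ₗᵢ[ℂ] Hilb (Fin (d k) × K k)), ‖junk‖ = 1 ∧
      ∀ (φ : Hilb (∀ k, Fin (d k))) (f : ∀ k, Fin (d k) × K k),
        tensorOp (fun k => (U k).toContinuousLinearMap) (W φ) f
          = φ (fun k => (f k).1) * junk (fun k => (f k).2) := by
  classical
  have hlift : ∀ k (i : Fin (d k)), ∃ Y : Op (I k) (I k),
      localOp k Y ∘L W = W ∘L localOp k (matrixUnit (a k) i) ∧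
      localOp k (ContinuousLinearMap.adjoint Y) ∘L W = W ∘L localOp k (matrixUnit i (a k)) := by
    intro k i
    rw [← adjoint_matrixUnit (a k) i]
    exact exists_lift hA' hA hW k (by rw [htop k]; trivial)
  choose Y hY hY' using hlift
  -- Since `∑ᵢ |i⟩⟨a|a⟩⟨i| = 𝟙`, `D k` acts trivially on the range of `W`, though perhaps not
  -- elsewhere. The projection `P k` onto its fixed vectors isolates the part where `v ↦ ∑ᵢ |i⟩ ⊗ Y
  -- k i v` is isometric.
  set D : ∀ k, Op (I k) (I k) := fun k => ∑ i, ContinuousLinearMap.adjoint (Y k i) ∘L Y k i with hD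
  have hDW : ∀ k, localOp k (D k) ∘L W = W := by
    intro k
    rw [hD, ← localOpLinear_apply, map_sum, ContinuousLinearMap.finsetSum_comp]
    have : ∀ i, localOpLinear I k (ContinuousLinearMap.adjoint (Y k i) ∘L Y k i) ∘L W
        = W ∘L localOpLinear (fun k => Fin (d k)) k
          (matrixUnit i (a k) ∘L matrixUnit (a k) i) := by
      intro i
      rw [localOpLinear_apply, localOpLinear_apply, ← localOp_comp, ← localOp_comp,
        ContinuousLinearMap.comp_assoc, hY, ← ContinuousLinearMap.comp_assoc, hY',
        ContinuousLinearMap.comp_assoc]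
    simp only [this]
    rw [← ContinuousLinearMap.comp_finsetSum, ← map_sum, sum_matrixUnit, localOpLinear_apply,
      localOp_one]
    rfl
  set P : ∀ k, Op (I k) (I k) := fun k => (LinearMap.ker (D k - 1).toLinearMap).starProjection
    with hPdef
  have hPW : ∀ k, localOp k (P k) ∘L W = W := by
    intro k
    refine localOp_starProjection_ker k (D k - 1) W ?_
    rw [← localOpLinear_apply, map_sub, localOpLinear_apply, localOpLinear_apply, localOp_one,
      ContinuousLinearMap.sub_comp, hDW]
    exact sub_self W
  have hext : ∀ k, ∃ U : Hilb (I k) →ₗᵢ[ℂ] Hilb (Fin (d k) × (I k ⊕ I k)),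
      U.toContinuousLinearMap ∘L P k
        = (∑ i, embedOp (Function.Embedding.inl.trans (pairEmbedding i)) ∘L Y k i) ∘L P k := by
    intro k
    refine exists_isometry_extension (a k) (Y k) (P k) ?_ ?_ ?_
    · exact Submodule.isIdempotentElem_starProjection _
    · exact (isSelfAdjoint_starProjection _).adjoint_eq
    · ext1 v
      have h1 : P k v ∈ LinearMap.ker (D k - 1).toLinearMap :=
        Submodule.starProjection_apply_mem _ v
      have h2 : D k (P k v) - P k v = 0 := h1
      exact sub_eq_zero.1 h2
  choose U hU using hext
  have htensorP : tensorOp P ∘L W = W := by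
    have := tensorOp_intertwine (T := fun k => (1 : Op (Fin (d k)) (Fin (d k)))) (S := P)
      (AlgHom.id ℂ _) W fun k => by
        rw [AlgHom.id_apply, hPW, localOp_one]; rfl
    rw [AlgHom.id_apply, tensorOp_one] at this
    exact this
  -- The junk state is the image of the base vector `|a⟩`, placed in the first copy of each `I k`;
  -- the second copies serve only to complete the isometries.
  set junk : Hilb (∀ k, I k ⊕ I k) := tensorOp (fun k => embedOp Function.Embedding.inl) (W (ket a))
    with hjunk
  refine ⟨fun k => I k ⊕ I k, junk, U, ?_, fun φ f => ?_⟩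
  · rw [hjunk, norm_of_adjoint_comp, norm_of_adjoint_comp hiso]
    · have : (inner ℂ (ket a) (ket a) : ℂ) = 1 := by rw [inner_ket_left, ket_self]
      rw [inner_self_eq_norm_sq_to_K] at this
      have h : ‖ket a‖ ^ 2 = 1 := Complex.ofReal_injective (by push_cast; exact this)
      exact (pow_eq_one_iff_of_nonneg (norm_nonneg _) two_ne_zero).1 h
    · rw [tensorOp_adjoint, tensorOp_comp, ← tensorOp_one]
      congr 1
      funext k
      rw [adjoint_embedOp, restrictOp_embedOp]
  · have h1 : tensorOp (fun k => (U k).toContinuousLinearMap) ∘L W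
        = tensorOp (fun k => ∑ i, embedOp (Function.Embedding.inl.trans (pairEmbedding i))
            ∘L Y k i) ∘L W := by
      conv_lhs => rw [← htensorP]
      conv_rhs => rw [← htensorP]
      rw [← ContinuousLinearMap.comp_assoc, ← ContinuousLinearMap.comp_assoc, tensorOp_comp,
        tensorOp_comp]
      simp only [hU]
    -- The product of the lifts represents `|a⟩⟨i|` on the whole reference space, so it extracts the
    -- coefficient `φ i` and resets the vector to `|a⟩`.
    have h2 : ∀ i : ∀ k, Fin (d k), tensorOp (fun k => Y k (i k)) (W φ) = φ i • W (ket a) := by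
      intro i
      have := tensorOp_intertwine (T := fun k => matrixUnit (a k) (i k)) (S := fun k => Y k (i k))
        (AlgHom.id ℂ _) W fun k => hY k (i k)
      rw [AlgHom.id_apply] at this
      rw [← ContinuousLinearMap.comp_apply, this, ContinuousLinearMap.comp_apply,
        tensorOp_matrixUnit, matrixUnit_apply, map_smul]
    have h3 : ∀ i : ∀ k, Fin (d k),
        tensorOp (fun k => embedOp (Function.Embedding.inl.trans (pairEmbedding (i k)))
          ∘L Y k (i k)) (W φ) f
        = if i = (fun k => (f k).1) then φ i * junk (fun k => (f k).2) else 0 := by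
      intro i
      rw [← tensorOp_comp, ContinuousLinearMap.comp_apply, h2, map_smul]
      have h4 : tensorOp (fun k => embedOp ((Function.Embedding.inl (β := I k)).trans
          (pairEmbedding (i k)))) (W (ket a))
          = embedOp (Function.Embedding.piCongrRight fun k => pairEmbedding (i k)) junk := by
        rw [hjunk, ← tensorOp_embedOp, ← ContinuousLinearMap.comp_apply (tensorOp _) (tensorOp _),
          tensorOp_comp]
        simp only [embedOp_comp]
      rw [h4, lp.coeFn_smul, Pi.smul_apply, smul_eq_mul]
      split_ifs with hi
      · congr 1
        have hf : f = (Function.Embedding.piCongrRight fun k => pairEmbedding (i k))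
            (fun k => (f k).2) := by
          funext k
          change f k = (i k, (f k).2)
          rw [hi]
        conv_lhs => rw [hf]
        rw [embedOp_apply]
      · rw [embedOp_apply_of_notMem, mul_zero]
        intro x hx
        refine hi (funext fun k => ?_)
        rw [← hx]
        rfl
    rw [← ContinuousLinearMap.comp_apply, h1, ContinuousLinearMap.comp_apply, tensorOp_sum,
      sum_apply, lp.coeFn_sum, Finset.sum_apply]
    simp only [h3, Fintype.piFinset_univ]
    simp

end Dilation

theorem orthonormal_ket (I : Type) : Orthonormal ℂ (ket : I → Hilb I) := by
  classical
  rw [orthonormal_iff_ite]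
  intro i j
  rw [inner_ket_left]
  simp [ket_apply]

/-- The orthonormal basis `|i⟩`. -/
noncomputable def ketBasis (I : Type) [Fintype I] : OrthonormalBasis I ℂ (Hilb I) :=
  OrthonormalBasis.mk (orthonormal_ket I) fun f _ => by
    rw [← sum_ket f]
    exact Submodule.sum_mem _ fun i _ => Submodule.smul_mem _ _ (Submodule.subset_span ⟨i, rfl⟩)

theorem ketBasis_apply {I : Type} [Fintype I] (i : I) : ketBasis I i = ket i := by
  simp [ketBasis]

/-! ### Transport of intertwiners along relabellings -/

section Transport

variable {I J I' J' : Type} (e₁ : I ≃ I') (e₂ : J ≃ J') {W : Op J I}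

theorem reindexOp_symm_intertwine {T : Op J J} {Y : Op J' J'}
    (hY : reindexOp e₂ ∘L T = Y ∘L reindexOp e₂) :
    T ∘L reindexOp e₂.symm = reindexOp e₂.symm ∘L Y := by
  have h1 := congrArg (fun T => reindexOp e₂.symm ∘L T ∘L reindexOp e₂.symm) hY
  simp only [ContinuousLinearMap.comp_assoc, reindexOp_comp_symm] at h1
  rw [← ContinuousLinearMap.comp_assoc, reindexOp_symm_comp] at h1
  exact h1

theorem transport_intertwine {S : Op I I} {T : Op J J} {X : Op I' I'} {Y : Op J' J'}
    (h : S ∘L W = W ∘L T) (hX : reindexOp e₁ ∘L S = X ∘L reindexOp e₁)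
    (hY : reindexOp e₂ ∘L T = Y ∘L reindexOp e₂) :
    X ∘L (reindexOp e₁ ∘L W ∘L reindexOp e₂.symm)
      = (reindexOp e₁ ∘L W ∘L reindexOp e₂.symm) ∘L Y := by
  rw [← ContinuousLinearMap.comp_assoc, ← hX, ContinuousLinearMap.comp_assoc,
    ← ContinuousLinearMap.comp_assoc S, h, ContinuousLinearMap.comp_assoc,
    ContinuousLinearMap.comp_assoc, ContinuousLinearMap.comp_assoc,
    reindexOp_symm_intertwine e₂ hY]

theorem adjoint_comp_transport (hW : ContinuousLinearMap.adjoint W ∘L W = 1) :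
    ContinuousLinearMap.adjoint (reindexOp e₁ ∘L W ∘L reindexOp e₂.symm)
      ∘L (reindexOp e₁ ∘L W ∘L reindexOp e₂.symm) = 1 := by
  rw [ContinuousLinearMap.adjoint_comp, ContinuousLinearMap.adjoint_comp, reindexOp_adjoint,
    reindexOp_adjoint, Equiv.symm_symm, ContinuousLinearMap.comp_assoc,
    ← ContinuousLinearMap.comp_assoc (reindexOp e₁.symm), reindexOp_symm_comp]
  change (reindexOp e₂ ∘L ContinuousLinearMap.adjoint W) ∘L W ∘L reindexOp e₂.symm = 1
  rw [ContinuousLinearMap.comp_assoc, ← ContinuousLinearMap.comp_assoc _ W, hW]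
  exact reindexOp_comp_symm e₂

end Transport

/-! ### From intertwiners back to self-tests; self-tests with spectator systems -/

section Reference

variable {ι : Type} [Fintype ι] [DecidableEq ι] {L : ι → Leg} {d : ι → ℕ}
  {A' : ∀ k, OpSystem (L k) (Fin (d k))} {ψ' : Hilb (∀ k, Fin (d k))}

theorem prodVec_ket (i : ∀ k, Fin (d k)) : prodVec (fun k => ket (i k)) = ket i := by
  apply lp.ext; funext j
  change ∏ k, ket (i k) (j k) = ket i j
  simp only [ket_apply]
  rw [Finset.prod_ite_zero]
  simp [funext_iff]

/-- If all optimal realizations contain the reference realization and the reference measurements are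
irreducible, then the Bell functional fully self-tests. -/
theorem fullySelfTests_of_intertwiners {B : BellFunctional L} (proj : ∀ k, IsProjective (A' k))
    (hψ' : ‖ψ'‖ = 1) (cyclic : {v | ∃ f ∈ tensorPolynomials A', v = f ψ'} = Set.univ)
    (normalized : IsNormalized B) (htop : ∀ k, Algebra.adjoin ℂ (Set.range (A' k)) = ⊤)
    (hinter : ∀ (I : ι → Type) (A : ∀ k, OpSystem (L k) (I k)) (ψ : Hilb (∀ k, I k)),
      (∀ k, IsPOVM (A k)) → ‖ψ‖ = 1 → (inner ℂ ψ (bellOp B A ψ)).re = 1 →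
      ∃ W : Op (∀ k, Fin (d k)) (∀ k, I k), ContinuousLinearMap.adjoint W ∘L W = 1 ∧ W ψ' = ψ ∧
        ∀ k e, localOp k (A k e) ∘L W = W ∘L localOp k (A' k e)) :
    FullySelfTests B A' ψ' where
  projective := proj
  norm_state := hψ'
  cyclic := cyclic
  normalized := normalized
  self_test I A ψ hA hψ hv := by
    obtain ⟨W, hiso, hWψ, hW⟩ := hinter I A ψ hA hψ hv
    obtain ⟨a⟩ := exists_index hψ'
    obtain ⟨K, junk, U, hjunk, hU⟩ :=
      exists_local_isometries (fun k => (proj k).1) hA htop a hiso hW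
    have hb : ∀ i : ∀ k, Fin (d k), (prodVec fun k => ketBasis (Fin (d k)) (i k)) = ket i := by
      intro i
      simp only [ketBasis_apply]
      exact prodVec_ket i
    -- The standard bases do: an intertwiner already treats all product bases alike, so `Ψ i = W
    -- |i⟩` may be taken.
    refine ⟨fun k => ketBasis (Fin (d k)), fun i => W (ket i), ?_, ?_, K, junk, U, hjunk,
      fun e i f => ?_⟩
    · classical
      rw [orthonormal_iff_ite]
      intro i j
      rw [inner_of_adjoint_comp hiso]
      exact orthonormal_iff_ite.1 (orthonormal_ket _) i j
    · simp only [hb, inner_ket_left]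
      rw [← hWψ]
      conv_lhs => rw [← sum_ket ψ']
      simp
    · have h1 := tensorOp_intertwine (T := fun k => A' k (e k)) (S := fun k => A k (e k))
        (AlgHom.id ℂ _) W fun k => hW k (e k)
      rw [AlgHom.id_apply] at h1
      rw [hb, ← ContinuousLinearMap.comp_apply (tensorOp fun k => A k (e k)) W, h1,
        ContinuousLinearMap.comp_apply, hU]

variable {B : BellFunctional L}

/-- Slices of a state along a spectator system are fixed vectors of arbitrary norm, possibly zero.
The exact norm of `T v` is recorded so that slices can later be reassembled. -/
theorem FullySelfTests.exists_scaled_intertwiner (h : FullySelfTests B A' ψ') {I : ι → Type}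
    {A : ∀ k, OpSystem (L k) (I k)} (hA : ∀ k, IsPOVM (A k)) {w : Hilb (∀ k, I k)}
    (hw : bellOp B A w = w) :
    ∃ T : Op (∀ k, Fin (d k)) (∀ k, I k), (∀ v, ‖T v‖ = ‖w‖ * ‖v‖) ∧ T ψ' = w ∧
      ∀ k e, localOp k (A k e) ∘L T = T ∘L localOp k (A' k e) := by
  by_cases h0 : w = 0
  · exact ⟨0, by simp [h0], by simp [h0], by simp⟩
  have hn : ‖w‖ ≠ 0 := norm_ne_zero_iff.2 h0
  have hunit : ‖((‖w‖⁻¹ : ℝ) : ℂ) • w‖ = 1 := by simp [norm_smul, hn]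
  obtain ⟨W, hiso, hWψ, hW⟩ := h.exists_intertwiner hA hunit (by
    rw [map_smul, hw, inner_self_eq_norm_sq_to_K, hunit]; simp)
  refine ⟨((‖w‖ : ℝ) : ℂ) • W, fun v => ?_, ?_, fun k e => ?_⟩
  · rw [smul_apply, norm_smul, norm_of_adjoint_comp hiso]
    simp
  · rw [smul_apply, hWψ, smul_smul, ← Complex.ofReal_mul, mul_inv_cancel₀ hn]
    simp
  · rw [ContinuousLinearMap.comp_smul, hW, ContinuousLinearMap.smul_comp]

/-- The self-test in the presence of an additional system `ℓ²(R)`. -/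
theorem FullySelfTests.exists_ampl_intertwiner (h : FullySelfTests B A' ψ') {I : ι → Type}
    {A : ∀ k, OpSystem (L k) (I k)} (hA : ∀ k, IsPOVM (A k)) {R : Type}
    {w : Hilb ((∀ k, I k) × R)} (hw : ampl R (bellOp B A) w = w) :
    ∃ T : Op (∀ k, Fin (d k)) ((∀ k, I k) × R), T ψ' = w ∧
      ∀ k e, ampl R (localOp k (A k e)) ∘L T = T ∘L localOp k (A' k e) := by
  -- `ampl` acts on each slice separately, so every slice is a fixed vector of the Bell operator.
  have hslice : ∀ r, bellOp B A (slice w r) = slice w r := fun r =>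
    congrArg (fun v => slice v r) hw
  choose T hTn hTψ hT using fun r => h.exists_scaled_intertwiner hA (hslice r)
  -- `R` may be infinite; square-summability follows from `‖T r v‖ = ‖slice w r‖ ‖v‖`.
  have hsum : ∀ v, Summable fun p : (∀ k, I k) × R => ‖T p.2 v p.1‖ ^ 2 := by
    intro v
    rw [← (Equiv.prodComm R (∀ k, I k)).summable_iff]
    refine (summable_prod_of_nonneg (fun p => sq_nonneg _)).2
      ⟨fun r => hilb_summable (T r v), ?_⟩
    refine ((slice_hasSum w).summable.mul_right (‖v‖ ^ 2)).congr fun r => ?_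
    rw [← mul_pow, ← hTn r v]
    exact hilb_norm_sq (T r v)
  let T' : Hilb (∀ k, Fin (d k)) →ₗ[ℂ] Hilb ((∀ k, I k) × R) :=
    { toFun := fun v => ⟨fun p => T p.2 v p.1, memHilb (hsum v)⟩
      map_add' := fun v v' => by
        apply lp.ext; funext p
        exact congrFun (congrArg (fun f : Hilb (∀ k, I k) => (f : (∀ k, I k) → ℂ))
          ((T p.2).map_add v v')) p.1
      map_smul' := fun c v => by
        apply lp.ext; funext p
        exact congrFun (congrArg (fun f : Hilb (∀ k, I k) => (f : (∀ k, I k) → ℂ))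
          ((T p.2).map_smul c v)) p.1 }
  refine ⟨LinearMap.toContinuousLinearMap T', ?_, fun k e => ?_⟩
  · apply lp.ext; funext p
    change T p.2 ψ' p.1 = w p
    rw [hTψ]
    rfl
  · ext1 v
    apply lp.ext; funext p
    change localOp k (A k e) (T p.2 v) p.1 = T p.2 (localOp k (A' k e) v) p.1
    rw [← ContinuousLinearMap.comp_apply, hT]
    rfl

/-- Two intertwiners into an arbitrary space are proportional to a common isometry, in the sense
that their Gram operator is a scalar. -/
theorem FullySelfTests.adjoint_comp_intertwiners (h : FullySelfTests B A' ψ') {N : Type}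
    {G : ∀ k, (L k).Event → Op N N} (hG : ∀ k e, ContinuousLinearMap.adjoint (G k e) = G k e)
    {X Y : Op (∀ k, Fin (d k)) N} (hX : ∀ k e, G k e ∘L X = X ∘L localOp k (A' k e))
    (hY : ∀ k e, G k e ∘L Y = Y ∘L localOp k (A' k e)) :
    ContinuousLinearMap.adjoint X ∘L Y = (inner ℂ (X ψ') (Y ψ') : ℂ) • 1 := by
  have hX' : ∀ k e, localOp k (A' k e) ∘L ContinuousLinearMap.adjoint X
      = ContinuousLinearMap.adjoint X ∘L G k e := fun k e => by
    have := congrArg ContinuousLinearMap.adjoint (hX k e)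
    rw [ContinuousLinearMap.adjoint_comp, ContinuousLinearMap.adjoint_comp, hG, localOp_adjoint,
      (h.povm k).adjoint_eq] at this
    exact this.symm
  -- `X† Y` commutes with the reference operators, so it is a scalar, and the state `ψ'` evaluates
  -- it.
  obtain ⟨z, hz⟩ := h.commutant (Z := ContinuousLinearMap.adjoint X ∘L Y) fun k e => by
    rw [← ContinuousLinearMap.comp_assoc, hX', ContinuousLinearMap.comp_assoc, hY,
      ContinuousLinearMap.comp_assoc]
  have : inner ℂ (X ψ') (Y ψ') = z := by
    rw [← ContinuousLinearMap.adjoint_inner_right, ← ContinuousLinearMap.comp_apply, hz,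
      smul_apply, inner_smul_right, one_apply_eq_self, inner_self_eq_norm_sq_to_K, h.norm_state]
    simp
  rw [this, hz]

/-- The self-test, with the party `k` split off. -/
theorem FullySelfTests.exists_split_intertwiner (h : FullySelfTests B A' ψ') (k : ι) :
    ∀ (Ik : Type) (Ir : {j // j ≠ k} → Type) (Ak : OpSystem (L k) Ik)
      (Ar : ∀ j : {j // j ≠ k}, OpSystem (L j) (Ir j)),
      IsPOVM Ak → (∀ j, IsPOVM (Ar j)) → ∀ ψ : Hilb (Ik × ∀ j, Ir j), ‖ψ‖ = 1 →
      (inner ℂ ψ (splitBell k B Ak Ar ψ)).re = 1 →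
      ∃ W : Op (Fin (d k) × ∀ j : {j // j ≠ k}, Fin (d j)) (Ik × ∀ j, Ir j),
        ContinuousLinearMap.adjoint W ∘L W = 1 ∧
        W (reindexOp (Equiv.piSplitAt k fun j => Fin (d j)) ψ') = ψ ∧
        (∀ e, ampl _ (Ak e) ∘L W = W ∘L ampl _ (A' k e)) ∧
        ∀ (j : {j // j ≠ k}) (e : (L j).Event),
          tensor2 1 (localOp j (Ar j e)) ∘L W
            = W ∘L tensor2 1 (localOp (I := fun j : {j // j ≠ k} => Fin (d j)) j (A' j e)) := by
  refine split_induction k ?_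
  intro I A hk hr ψ hψ hv
  have hA : ∀ j, IsPOVM (A j) := forall_of_split hk hr
  set e₁ := Equiv.piSplitAt k I
  set e₂ := Equiv.piSplitAt k fun j => Fin (d j)
  have hψe : reindexOp e₁ (reindexOp e₁.symm ψ) = ψ :=
    DFunLike.congr_fun (reindexOp_comp_symm e₁) ψ
  obtain ⟨W, hiso, hWψ, hW⟩ := h.exists_intertwiner hA (ψ := reindexOp e₁.symm ψ)
    (by rw [norm_reindexOp, hψ]) (by
      have h1 := DFunLike.congr_fun (bellOp_piSplitAt k B A) (reindexOp e₁.symm ψ)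
      rw [ContinuousLinearMap.comp_apply, ContinuousLinearMap.comp_apply, hψe] at h1
      rw [← reindexOp_adjoint, ContinuousLinearMap.adjoint_inner_left, reindexOp_adjoint, h1, hv])
  refine ⟨reindexOp e₁ ∘L W ∘L reindexOp e₂.symm, ?_, ?_, fun e => ?_, fun j e => ?_⟩
  · exact adjoint_comp_transport e₁ e₂ hiso
  · have : reindexOp e₂.symm (reindexOp e₂ ψ') = ψ' :=
      DFunLike.congr_fun (reindexOp_symm_comp e₂) ψ'
    rw [ContinuousLinearMap.comp_apply, ContinuousLinearMap.comp_apply, this, hWψ, hψe]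
  · rw [ampl_eq_tensor2, ampl_eq_tensor2]
    have h1 := localOp_piSplitAt_self k (I := I) (A k e)
    have h2 := localOp_piSplitAt_self k (I := fun j => Fin (d j)) (A' k e)
    exact transport_intertwine e₁ e₂ (hW k e) h1 h2
  · have h1 := localOp_piSplitAt_ne k (I := I) j (A j e)
    have h2 := localOp_piSplitAt_ne k (I := fun j => Fin (d j)) j (A' j e)
    exact transport_intertwine e₁ e₂ (hW j e) h1 h2

theorem IsNormalized.split_re_inner_le (hB : IsNormalized B) (k : ι) :
    ∀ (Ik : Type) (Ir : {j // j ≠ k} → Type) (Ak : OpSystem (L k) Ik)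
      (Ar : ∀ j : {j // j ≠ k}, OpSystem (L j) (Ir j)),
      IsPOVM Ak → (∀ j, IsPOVM (Ar j)) → ∀ ψ : Hilb (Ik × ∀ j, Ir j),
      (inner ℂ ψ (splitBell k B Ak Ar ψ)).re ≤ ‖ψ‖ ^ 2 := by
  refine split_induction k ?_
  intro I A hk hr ψ
  have hA : ∀ j, IsPOVM (A j) := forall_of_split hk hr
  set e₁ := Equiv.piSplitAt k I
  have hψe : reindexOp e₁ (reindexOp e₁.symm ψ) = ψ :=
    DFunLike.congr_fun (reindexOp_comp_symm e₁) ψ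
  have h1 := DFunLike.congr_fun (bellOp_piSplitAt k B A) (reindexOp e₁.symm ψ)
  rw [ContinuousLinearMap.comp_apply, ContinuousLinearMap.comp_apply, hψe] at h1
  have h2 := hB.re_inner_le hA (reindexOp e₁.symm ψ)
  rw [norm_reindexOp, ← reindexOp_adjoint, ContinuousLinearMap.adjoint_inner_left,
    reindexOp_adjoint, h1] at h2
  exact h2

end Reference

theorem inner_tensorKet {I K : Type} [DecidableEq K] (c d : K) (x y : Hilb I) :
    inner ℂ (tensorKet I c x) (tensorKet I d y) = if c = d then inner ℂ x y else 0 := by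
  have h : inner ℂ (tensorKet I c x) (tensorKet I d y) = inner ℂ x (sliceOp I c (tensorKet I d y)) :=
    ContinuousLinearMap.adjoint_inner_left _ _ _
  rw [h, ← ContinuousLinearMap.comp_apply, sliceOp_tensorKet]
  split_ifs <;> simp

theorem ampl_comp_tensor2 {I J K : Type} (T : Op I J) (S : Op K K) :
    ampl K T ∘L tensor2 1 S = tensor2 1 S ∘L ampl K T := by
  rw [ampl_eq_tensor2, tensor2_comp, tensor2_comp]
  rfl

/-! ### Extending an intertwiner from the outputs of a connector to its inputs -/

section Glue

variable {ι : Type} [Fintype ι] [DecidableEq ι] {L : ι → Leg} {out : Leg} {d : ι → ℕ}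
  {C : ConnTensor L out} {A' : ∀ k, OpSystem (L k) (Fin (d k))} {ψ' : Hilb (∀ k, Fin (d k))}

theorem bellOp_sum_mul (μ : out.Event → ℝ) {I : ι → Type} (A : ∀ k, OpSystem (L k) (I k)) :
    bellOp (fun e => ∑ o, μ o * C o e) A = ∑ o, (μ o : ℂ) • connOp C A o := by
  simp only [connOp, bellOp, Finset.smul_sum, smul_smul]
  rw [Finset.sum_comm]
  refine Finset.sum_congr rfl fun e _ => ?_
  push_cast
  rw [Finset.sum_smul]

set_option maxHeartbeats 1000000 in
/-- Let a connector be fully self-testing, and let `V†` embed its output space as the cyclic subspace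
of the state `ψ' = V† χ`. An isometry that intertwines the output measurements, in the presence
of further systems, extends along `V†` to one that intertwines the input measurements. -/
theorem FullySelfTests.exists_extension {μ : out.Event → ℝ}
    (h : FullySelfTests (fun e => ∑ o, μ o * C o e) A' ψ') {O : Type} {V : Op (∀ k, Fin (d k)) O}
    (hV : V ∘L ContinuousLinearMap.adjoint V = 1) {M : OpSystem out O}
    (hM : ∀ c, connOp C A' c ∘L ContinuousLinearMap.adjoint V
      = ContinuousLinearMap.adjoint V ∘L M c)
    (hM' : ∀ c, V ∘L connOp C A' c = M c ∘L V)
    {χ : Hilb O} (hχ : ContinuousLinearMap.adjoint V χ = ψ')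
    (hcyc : ∀ S : Submodule ℂ (Hilb (∀ k, Fin (d k))), ψ' ∈ S →
      (∀ c, ∀ v ∈ S, connOp C A' c v ∈ S) → ∀ x, ContinuousLinearMap.adjoint V x ∈ S)
    {R R' : Type} [Fintype R'] {I : ι → Type} {A : ∀ k, OpSystem (L k) (I k)}
    (hA : ∀ k, IsPOVM (A k)) {W₂ : Op (O × R') ((∀ k, I k) × R)}
    (hW₂ : ContinuousLinearMap.adjoint W₂ ∘L W₂ = 1)
    (hW₂M : ∀ c, ampl R (connOp C A c) ∘L W₂ = W₂ ∘L ampl R' (M c)) :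
    ∃ W : Op ((∀ k, Fin (d k)) × R') ((∀ k, I k) × R),
      ContinuousLinearMap.adjoint W ∘L W = 1 ∧
      W ∘L ampl R' (ContinuousLinearMap.adjoint V) = W₂ ∧
      (∀ k e, ampl R (localOp k (A k e)) ∘L W = W ∘L ampl R' (localOp k (A' k e))) ∧
      ∀ (S : Op R R) (S' : Op R' R'), tensor2 1 S ∘L W₂ = W₂ ∘L tensor2 1 S' →
        tensor2 1 S ∘L W = W ∘L tensor2 1 S' := by
  classical
  have hVχ : V ψ' = χ := by
    rw [← hχ, ← ContinuousLinearMap.comp_apply, hV]; rfl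
  have hVadj : ContinuousLinearMap.adjoint (ContinuousLinearMap.adjoint V)
      ∘L ContinuousLinearMap.adjoint V = 1 := by
    rw [ContinuousLinearMap.adjoint_adjoint, hV]
  have hχn : ‖χ‖ = 1 := by rw [← norm_of_adjoint_comp hVadj, hχ, h.norm_state]
  -- `V†` is injective and intertwines, so the eigenvector equation for `ψ' = V† χ` descends to `χ`.
  have hμM : (∑ c, (μ c : ℂ) • M c) χ = χ := by
    refine injective_of_adjoint_comp hVadj ?_
    rw [← ContinuousLinearMap.comp_apply, ContinuousLinearMap.comp_finsetSum]
    simp only [ContinuousLinearMap.comp_smul, ← hM]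
    simp only [← ContinuousLinearMap.smul_comp]
    rw [← ContinuousLinearMap.finsetSum_comp, ContinuousLinearMap.comp_apply, hχ,
      ← bellOp_sum_mul, h.bellOp_reference]
  have hw : ∀ ρ : R', ampl R (bellOp (fun e => ∑ o, μ o * C o e) A) (W₂ (tensorKet O ρ χ))
      = W₂ (tensorKet O ρ χ) := by
    intro ρ
    have h1 : ampl R (bellOp (fun e => ∑ o, μ o * C o e) A) ∘L W₂
        = W₂ ∘L ampl R' (∑ c, (μ c : ℂ) • M c) := by
      rw [bellOp_sum_mul, ← amplHom_apply, ← amplHom_apply, map_sum, map_sum,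
        ContinuousLinearMap.finsetSum_comp, ContinuousLinearMap.comp_finsetSum]
      refine Finset.sum_congr rfl fun c _ => ?_
      rw [map_smul, map_smul, ContinuousLinearMap.smul_comp, ContinuousLinearMap.comp_smul,
        amplHom_apply, amplHom_apply, hW₂M]
    rw [← ContinuousLinearMap.comp_apply, h1, ContinuousLinearMap.comp_apply,
      ← ContinuousLinearMap.comp_apply (ampl R' _), ampl_tensorKet,
      ContinuousLinearMap.comp_apply, hμM]
  choose T hTψ hT using fun ρ => h.exists_ampl_intertwiner hA (hw ρ)
  -- `T ρ` and `W₂ (V · ⊗ |ρ⟩)` agree at `ψ'` and are both compatible with the connector operators,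
  -- so they agree on the cyclic subspace, which contains the range of `V†`.
  have hTV : ∀ ρ, T ρ ∘L ContinuousLinearMap.adjoint V = W₂ ∘L tensorKet O ρ := by
    intro ρ
    have hTC : ∀ c, ampl R (connOp C A c) ∘L T ρ = T ρ ∘L connOp C A' c := fun c =>
      bellOp_intertwine (amplHom (∀ k, I k) R) (hT ρ) (C c)
    ext1 x
    have hx := hcyc (LinearMap.eqLocus (T ρ).toLinearMap (W₂ ∘L tensorKet O ρ ∘L V).toLinearMap)
      (by
        change T ρ ψ' = W₂ (tensorKet O ρ (V ψ'))
        rw [hTψ, hVχ])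
      (fun c v hv => by
        have hv' : T ρ v = W₂ (tensorKet O ρ (V v)) := hv
        change T ρ (connOp C A' c v) = W₂ (tensorKet O ρ (V (connOp C A' c v)))
        rw [← ContinuousLinearMap.comp_apply, ← hTC, ContinuousLinearMap.comp_apply, hv',
          ← ContinuousLinearMap.comp_apply, hW₂M, ContinuousLinearMap.comp_apply,
          ← ContinuousLinearMap.comp_apply (ampl R' _), ampl_tensorKet,
          ContinuousLinearMap.comp_apply, ← ContinuousLinearMap.comp_apply V, hM']
        rfl) x
    have hx' : T ρ (ContinuousLinearMap.adjoint V x)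
      = W₂ (tensorKet O ρ (V (ContinuousLinearMap.adjoint V x))) := hx
    rw [← ContinuousLinearMap.comp_apply V, hV] at hx'
    exact hx'
  set W : Op ((∀ k, Fin (d k)) × R') ((∀ k, I k) × R) := ∑ ρ, T ρ ∘L sliceOp _ ρ with hW
  have hWket : ∀ ρ, W ∘L tensorKet _ ρ = T ρ := by
    intro ρ
    rw [hW, ContinuousLinearMap.finsetSum_comp, Finset.sum_eq_single ρ]
    · rw [ContinuousLinearMap.comp_assoc, sliceOp_tensorKet, if_pos rfl]
      rfl
    · intro σ _ hσ
      rw [ContinuousLinearMap.comp_assoc, sliceOp_tensorKet, if_neg hσ]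
      simp
    · simp
  refine ⟨W, ?_, ?_, fun k e => ?_, fun S S' hS => ?_⟩
  -- By triviality of the commutant the Gram operator of `T ρ` and `T σ` is the scalar `⟨χ ⊗ ρ|χ ⊗
  -- σ⟩ = δ`, since `W₂` is an isometry.
  · have hgram : ∀ ρ σ, ContinuousLinearMap.adjoint (T ρ) ∘L T σ
        = if ρ = σ then 1 else 0 := by
      intro ρ σ
      rw [h.adjoint_comp_intertwiners (G := fun k e => ampl R (localOp k (A k e)))
        (fun k e => by rw [ampl_adjoint, localOp_adjoint, (hA k).adjoint_eq]) (hT ρ) (hT σ),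
        hTψ, hTψ, inner_of_adjoint_comp hW₂, inner_tensorKet, inner_self_eq_norm_sq_to_K, hχn]
      split_ifs <;> simp
    rw [hW, map_sum, ContinuousLinearMap.finsetSum_comp, ← sum_tensorKet_sliceOp]
    refine Finset.sum_congr rfl fun ρ _ => ?_
    rw [ContinuousLinearMap.comp_finsetSum, Finset.sum_eq_single ρ]
    · rw [ContinuousLinearMap.adjoint_comp, ContinuousLinearMap.comp_assoc,
        ← ContinuousLinearMap.comp_assoc (ContinuousLinearMap.adjoint (T ρ)), hgram, if_pos rfl]
      rfl
    · intro σ _ hσ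
      rw [ContinuousLinearMap.adjoint_comp, ContinuousLinearMap.comp_assoc,
        ← ContinuousLinearMap.comp_assoc (ContinuousLinearMap.adjoint (T ρ)), hgram,
        if_neg (Ne.symm hσ)]
      simp
    · simp
  · rw [hW, ContinuousLinearMap.finsetSum_comp]
    simp only [ContinuousLinearMap.comp_assoc, sliceOp_ampl]
    simp only [← ContinuousLinearMap.comp_assoc, hTV]
    simp only [ContinuousLinearMap.comp_assoc]
    rw [← ContinuousLinearMap.comp_finsetSum, sum_tensorKet_sliceOp]
    rfl
  · rw [hW, ContinuousLinearMap.finsetSum_comp, ContinuousLinearMap.comp_finsetSum]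
    refine Finset.sum_congr rfl fun ρ _ => ?_
    rw [ContinuousLinearMap.comp_assoc, sliceOp_ampl, ← ContinuousLinearMap.comp_assoc, hT,
      ContinuousLinearMap.comp_assoc]
  -- Uniqueness of intertwiners: both sides intertwine the input measurements, and at `ψ'` the
  -- equation is the assumed relation for `W₂` evaluated on `χ ⊗ |ρ⟩`.
  · have hTS : ∀ ρ, tensor2 1 S ∘L T ρ = ∑ σ, S' (ket ρ) σ • T σ := by
      intro ρ
      refine h.intertwiner_ext (G := fun k e => ampl R (localOp k (A k e))) (fun k e => ?_)
        (fun k e => ?_) ?_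
      · rw [← ContinuousLinearMap.comp_assoc, ampl_comp_tensor2, ContinuousLinearMap.comp_assoc,
          hT, ContinuousLinearMap.comp_assoc]
      · rw [ContinuousLinearMap.finsetSum_comp, ContinuousLinearMap.comp_finsetSum]
        refine Finset.sum_congr rfl fun σ _ => ?_
        rw [ContinuousLinearMap.comp_smul, hT, ContinuousLinearMap.smul_comp]
      · rw [ContinuousLinearMap.comp_apply, hTψ, ← ContinuousLinearMap.comp_apply, hS,
          ContinuousLinearMap.comp_apply, ← ContinuousLinearMap.comp_apply (tensor2 1 S'),
          tensor2_tensorKet, sum_apply, sum_apply, map_sum]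
        refine Finset.sum_congr rfl fun σ _ => ?_
        rw [smul_apply, smul_apply, map_smul, hTψ]
    refine map_ext_ket fun i => ?_
    obtain ⟨i, ρ⟩ := i
    rw [← tensorKet_ket, ← ContinuousLinearMap.comp_apply, ← ContinuousLinearMap.comp_apply,
      ContinuousLinearMap.comp_assoc, hWket, hTS, ContinuousLinearMap.comp_assoc,
      tensor2_tensorKet, ContinuousLinearMap.comp_finsetSum]
    simp only [ContinuousLinearMap.comp_smul, hWket]

end Glue

/-! ### Contracted Bell operators and inserted coisometries -/

theorem splitBell_sum_mul {ι : Type} [Fintype ι] [DecidableEq ι] {L : ι → Leg} {out : Leg}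
    (C : ConnTensor L out) (μ : out.Event → ℝ) {k : ι} {Ik : Type} {Ir : {j // j ≠ k} → Type}
    (Ak : OpSystem (L k) Ik) (Ar : ∀ j : {j // j ≠ k}, OpSystem (L j) (Ir j)) :
    splitBell k (fun e => ∑ o, μ o * C o e) Ak Ar
      = ∑ o, (μ o : ℂ) • splitBell k (C o) Ak Ar := by
  simp only [splitBell, Finset.smul_sum, smul_smul]
  rw [Finset.sum_comm]
  refine Finset.sum_congr rfl fun e _ => ?_
  push_cast
  rw [Finset.sum_smul]

/-- By multilinearity, inserting the connector into party `k` collects exactly the coefficients of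
the contracted tensor. -/
theorem splitBell_connOp {ι₁ ι : Type} [Fintype ι₁] [DecidableEq ι₁] [Fintype ι] [DecidableEq ι]
    {L₁ : ι₁ → Leg} {L : ι → Leg} (k : ι) (B : BellFunctional L) (C : ConnTensor L₁ (L k))
    {I₁ : ι₁ → Type} {Ir : {j // j ≠ k} → Type} (A : ∀ l, OpSystem (L₁ l) (I₁ l))
    (Ar : ∀ j : {j // j ≠ k}, OpSystem (L j) (Ir j)) :
    splitBell k B (connOp C A) Ar
      = ∑ p : (∀ l, (L₁ l).Event) × ∀ j : {j // j ≠ k}, (L j).Event,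
        ((∑ c, B ((Equiv.piSplitAt k (fun j => (L j).Event)).symm (c, p.2)) * C c p.1 : ℝ) : ℂ) •
          tensor2 (tensorOp fun l => A l (p.1 l)) (tensorOp fun j => Ar j (p.2 j)) := by
  simp only [splitBell, connOp, bellOp, tensor2_sum_left, tensor2_smul_left, Finset.smul_sum,
    smul_smul]
  rw [Fintype.sum_prod_type, Fintype.sum_prod_type, Finset.sum_comm]
  simp only [Complex.ofReal_sum, Complex.ofReal_mul, Finset.sum_smul]
  rw [Finset.sum_comm (s := (Finset.univ : Finset (∀ l, (L₁ l).Event)))]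
  refine Finset.sum_congr rfl fun er _ => ?_
  exact Finset.sum_comm

/-- The operator `V ⊗ 𝟙`, with the tensor products written in other coordinates. -/
noncomputable def plugOp {P Q G O R : Type} (e₁ : P ≃ G × R) (e₂ : Q ≃ O × R) (V : Op G O) :
    Op P Q :=
  reindexOp e₂.symm ∘L ampl R V ∘L reindexOp e₁

section PlugOp

variable {P Q G O R : Type} (e₁ : P ≃ G × R) (e₂ : Q ≃ O × R) {V : Op G O}

theorem adjoint_plugOp : ContinuousLinearMap.adjoint (plugOp e₁ e₂ V)
    = plugOp e₂ e₁ (ContinuousLinearMap.adjoint V) := by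
  rw [plugOp, ContinuousLinearMap.adjoint_comp, ContinuousLinearMap.adjoint_comp,
    reindexOp_adjoint, reindexOp_adjoint, Equiv.symm_symm, ampl_adjoint]
  rfl

theorem plugOp_comp_adjoint (hV : V ∘L ContinuousLinearMap.adjoint V = 1) :
    plugOp e₁ e₂ V ∘L ContinuousLinearMap.adjoint (plugOp e₁ e₂ V) = 1 := by
  rw [adjoint_plugOp, plugOp, plugOp, ContinuousLinearMap.comp_assoc,
    ContinuousLinearMap.comp_assoc, ← ContinuousLinearMap.comp_assoc (reindexOp e₁),
    reindexOp_comp_symm]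
  change reindexOp e₂.symm ∘L ampl R V ∘L ampl R (ContinuousLinearMap.adjoint V) ∘L reindexOp e₂ = 1
  rw [← ContinuousLinearMap.comp_assoc (ampl R V), ampl_comp, hV, ampl_one]
  exact reindexOp_symm_comp e₂

theorem comp_adjoint_plugOp {T : Op P P} {S : Op Q Q} {T' : Op (G × R) (G × R)}
    {S' : Op (O × R) (O × R)} (hT : reindexOp e₁ ∘L T = T' ∘L reindexOp e₁)
    (hS : reindexOp e₂ ∘L S = S' ∘L reindexOp e₂)
    (h : T' ∘L ampl R (ContinuousLinearMap.adjoint V)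
      = ampl R (ContinuousLinearMap.adjoint V) ∘L S') :
    T ∘L ContinuousLinearMap.adjoint (plugOp e₁ e₂ V)
      = ContinuousLinearMap.adjoint (plugOp e₁ e₂ V) ∘L S := by
  rw [adjoint_plugOp, plugOp, ← ContinuousLinearMap.comp_assoc, reindexOp_symm_intertwine _ hT,
    ContinuousLinearMap.comp_assoc, ← ContinuousLinearMap.comp_assoc T', h,
    ContinuousLinearMap.comp_assoc, ← hS, ContinuousLinearMap.comp_assoc,
    ContinuousLinearMap.comp_assoc]

end PlugOp

namespace ConnectorData

variable {out : Party}

/-! ### The invariant subspace of a fully self-testing connector complex -/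

section Invariant

variable {X : ConnectorData out} {μ : out.Event → ℝ} {ψ : X.Space}

/-- The range of `V†` is a cyclic subspace, hence stable under the connector operators; on it the
projection `V† V` is the identity. -/
theorem IsFullySelfTesting.connOp_comp_adjoint (hψ : X.IsFullySelfTesting μ ψ)
    (hX : X.IsConnectorComplex) (c : out.Event) :
    connOp X.C X.A c ∘L ContinuousLinearMap.adjoint X.V
      = ContinuousLinearMap.adjoint X.V ∘L X.M c := by
  ext1 x
  have hx : ContinuousLinearMap.adjoint X.V x ∈ (X.invariantSubspace : Set X.Space) := ⟨x, rfl⟩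
  rw [hψ.cyclic] at hx
  obtain ⟨f, hf, hfx⟩ := hx
  have hy : connOp X.C X.A c (ContinuousLinearMap.adjoint X.V x)
      ∈ (X.invariantSubspace : Set X.Space) := by
    rw [hψ.cyclic]
    exact ⟨connOp X.C X.A c * f,
      Subalgebra.mul_mem _ (Algebra.subset_adjoin ⟨c, rfl⟩) hf, by rw [hfx]; rfl⟩
  obtain ⟨y, hy⟩ := hy
  have hy' : ContinuousLinearMap.adjoint X.V y
      = connOp X.C X.A c (ContinuousLinearMap.adjoint X.V x) := hy
  change connOp X.C X.A c (ContinuousLinearMap.adjoint X.V x) = ContinuousLinearMap.adjoint X.V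
    (X.V (connOp X.C X.A c (ContinuousLinearMap.adjoint X.V x)))
  rw [← hy', ← ContinuousLinearMap.comp_apply X.V, hX.coisometry]
  rfl

theorem IsFullySelfTesting.comp_connOp (hψ : X.IsFullySelfTesting μ ψ)
    (hX : X.IsConnectorComplex) (c : out.Event) :
    X.V ∘L connOp X.C X.A c = X.M c ∘L X.V := by
  have h := congrArg ContinuousLinearMap.adjoint (hψ.connOp_comp_adjoint hX c)
  rw [ContinuousLinearMap.adjoint_comp, ContinuousLinearMap.adjoint_comp,
    ContinuousLinearMap.adjoint_adjoint, hX.projective.1.adjoint_eq, connOp,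
    bellOp_adjoint _ hX.povm] at h
  exact h

/-- Cyclicity restated as minimality: the invariant subspace lies in every subspace that contains
`ψ` and is stable under the connector operators. This is the form consumed by
`FullySelfTests.exists_extension`. -/
theorem IsFullySelfTesting.adjoint_mem (hψ : X.IsFullySelfTesting μ ψ)
    (S : Submodule ℂ X.Space) (hS : ψ ∈ S) (hC : ∀ c, ∀ v ∈ S, connOp X.C X.A c v ∈ S)
    (x : Hilb (Fin out.dim)) : ContinuousLinearMap.adjoint X.V x ∈ S := by
  have hx : ContinuousLinearMap.adjoint X.V x ∈ (X.invariantSubspace : Set X.Space) := ⟨x, rfl⟩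
  rw [hψ.cyclic] at hx
  obtain ⟨f, hf, hfx⟩ := hx
  rw [hfx]
  have : ∀ w ∈ S, f w ∈ S := by
    clear hfx
    induction hf using Algebra.adjoin_induction with
    | mem T hT => obtain ⟨c, rfl⟩ := hT; exact hC c
    | algebraMap c => exact fun w hw => S.smul_mem c hw
    | add T T' _ _ h1 h2 => exact fun w hw => S.add_mem (h1 w hw) (h2 w hw)
    | mul T T' _ _ h1 h2 => exact fun w hw => h1 _ (h2 w hw)
  exact this _ hS

end Invariant

/-! ### The contraction -/

section Contraction

variable (X₂ : ConnectorData out) (k : X₂.ι) (X₁ : ConnectorData (X₂.party k))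

/-- The connector of the contraction. -/
noncomputable def contractTensor :
    ConnTensor (fun j => (contractParty X₂ k X₁ j).toLeg) out.toLeg :=
  (contract X₂ k X₁).C

/-- The measurements of the contraction. -/
noncomputable def contractOps :
    ∀ j, OpSystem (contractParty X₂ k X₁ j).toLeg (Fin (contractParty X₂ k X₁ j).dim) :=
  (contract X₂ k X₁).A

variable {X₂ k X₁} in
/-- The measurements of the parties of `X₁`. -/
def inlOps {I : X₁.ι ⊕ {j : X₂.ι // j ≠ k} → Type}
    (A : ∀ j, OpSystem (contractParty X₂ k X₁ j).toLeg (I j)) (l : X₁.ι) :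
    OpSystem (X₁.party l).toLeg (I (Sum.inl l)) :=
  A (Sum.inl l)

variable {X₂ k X₁} in
/-- The measurements of the remaining parties of `X₂`. -/
def inrOps {I : X₁.ι ⊕ {j : X₂.ι // j ≠ k} → Type}
    (A : ∀ j, OpSystem (contractParty X₂ k X₁ j).toLeg (I j)) (j : {j : X₂.ι // j ≠ k}) :
    OpSystem (X₂.party j).toLeg (I (Sum.inr j)) :=
  A (Sum.inr j)

/-- The tuples of labels of the contraction, as pairs of tuples. -/
def contractEventEquiv : (∀ j, (contractParty X₂ k X₁ j).Event) ≃
    (∀ l, (X₁.party l).Event) × ∀ j : {j : X₂.ι // j ≠ k}, (X₂.party j).Event :=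
  Equiv.sumPiEquivProdPi _

/-- The basis of the space of the contraction, as a set of pairs. -/
def contractEquiv : (∀ j, Fin (contractParty X₂ k X₁ j).dim) ≃
    (∀ l, Fin (X₁.party l).dim) × ∀ j : {j : X₂.ι // j ≠ k}, Fin (X₂.party j).dim :=
  Equiv.sumPiEquivProdPi _

/-- For arbitrary realizations, the contraction is `X₂` with party `k` measuring the system produced
by `X₁`. Every property of `X₂` quantified over all POVMs thus becomes applicable. -/
theorem connOp_contract {I : X₁.ι ⊕ {j : X₂.ι // j ≠ k} → Type}
    (A : ∀ j, OpSystem (contractParty X₂ k X₁ j).toLeg (I j)) (o : out.Event) :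
    reindexOp (Equiv.sumPiEquivProdPi I) ∘L connOp (contractTensor X₂ k X₁) A o
      = splitBell k (X₂.C o) (connOp X₁.C (inlOps A)) (inrOps A)
        ∘L reindexOp (Equiv.sumPiEquivProdPi I) := by
  have h1 : ∀ e : ∀ j, (contractParty X₂ k X₁ j).Event,
      reindexOp (Equiv.sumPiEquivProdPi I) ∘L tensorOp (fun j => A j (e j))
        = tensor2 (tensorOp fun l => inlOps A l ((contractEventEquiv X₂ k X₁ e).1 l))
            (tensorOp fun j => inrOps A j ((contractEventEquiv X₂ k X₁ e).2 j))
          ∘L reindexOp (Equiv.sumPiEquivProdPi I) := fun e => tensorOp_sumPi _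
  have h2 : ∀ e, contractTensor X₂ k X₁ o e = ∑ c, X₂.C o ((Equiv.piSplitAt k _).symm
      (c, (contractEventEquiv X₂ k X₁ e).2)) * X₁.C c (contractEventEquiv X₂ k X₁ e).1 :=
    fun e => rfl
  rw [connOp, bellOp, ContinuousLinearMap.comp_finsetSum]
  simp only [ContinuousLinearMap.comp_smul, h1]
  simp only [← ContinuousLinearMap.smul_comp]
  rw [← ContinuousLinearMap.finsetSum_comp, splitBell_connOp]
  congr 1
  refine Fintype.sum_equiv (contractEventEquiv X₂ k X₁) _ _ fun e => ?_
  rw [h2]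

theorem bellOp_contract (μ : out.Event → ℝ) {I : X₁.ι ⊕ {j : X₂.ι // j ≠ k} → Type}
    (A : ∀ j, OpSystem (contractParty X₂ k X₁ j).toLeg (I j)) :
    reindexOp (Equiv.sumPiEquivProdPi I)
        ∘L bellOp (fun e => ∑ o, μ o * contractTensor X₂ k X₁ o e) A
      = splitBell k (fun e => ∑ o, μ o * X₂.C o e) (connOp X₁.C (inlOps A)) (inrOps A)
        ∘L reindexOp (Equiv.sumPiEquivProdPi I) := by
  rw [bellOp_sum_mul, splitBell_sum_mul, ContinuousLinearMap.comp_finsetSum,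
    ContinuousLinearMap.finsetSum_comp]
  refine Finset.sum_congr rfl fun o _ => ?_
  rw [ContinuousLinearMap.comp_smul, connOp_contract, ContinuousLinearMap.smul_comp]

theorem connOp_contractOps (o : out.Event) :
    reindexOp (contractEquiv X₂ k X₁)
        ∘L connOp (contractTensor X₂ k X₁) (contractOps X₂ k X₁) o
      = splitBell k (X₂.C o) (connOp X₁.C X₁.A) (fun j => X₂.A j)
        ∘L reindexOp (contractEquiv X₂ k X₁) :=
  connOp_contract X₂ k X₁ (contractOps X₂ k X₁) o

theorem localOp_contractOps_inl (l : X₁.ι) (e : (X₁.party l).Event) :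
    reindexOp (contractEquiv X₂ k X₁) ∘L
        localOp (I := fun j => Fin (contractParty X₂ k X₁ j).dim) (Sum.inl l)
          (contractOps X₂ k X₁ (Sum.inl l) e)
      = ampl _ (localOp l (X₁.A l e)) ∘L reindexOp (contractEquiv X₂ k X₁) := by
  rw [ampl_eq_tensor2]
  exact localOp_sumPi_inl (I := fun j => Fin (contractParty X₂ k X₁ j).dim) l (contractOps X₂ k X₁ (Sum.inl l) e)

theorem localOp_contractOps_inr (j : {j : X₂.ι // j ≠ k}) (e : (X₂.party j).Event) :
    reindexOp (contractEquiv X₂ k X₁) ∘L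
        localOp (I := fun j => Fin (contractParty X₂ k X₁ j).dim) (Sum.inr j)
          (contractOps X₂ k X₁ (Sum.inr j) e)
      = tensor2 1 (localOp (I := fun j : {j : X₂.ι // j ≠ k} => Fin (X₂.party j).dim) j (X₂.A j e))
        ∘L reindexOp (contractEquiv X₂ k X₁) :=
  localOp_sumPi_inr (I := fun j => Fin (contractParty X₂ k X₁ j).dim) j (contractOps X₂ k X₁ (Sum.inr j) e)

theorem plug_eq : plug X₂ k X₁
    = plugOp (contractEquiv X₂ k X₁) (Equiv.piSplitAt k fun j => Fin (X₂.party j).dim) X₁.V := rfl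

variable {X₂ k X₁}

theorem plug_comp_adjoint (hV : X₁.V ∘L ContinuousLinearMap.adjoint X₁.V = 1) :
    plug X₂ k X₁ ∘L ContinuousLinearMap.adjoint (plug X₂ k X₁) = 1 := by
  rw [plug_eq]
  exact plugOp_comp_adjoint _ _ hV

variable {μ₁ : (X₂.party k).Event → ℝ} {ψ₁ : X₁.Space}

/-- Congruence enters here: `V(X₁)†` intertwines the connector operators of `X₁` with `X₁.M`, which
is what party `k` of `X₂` measures in its reference. -/
theorem connOp_comp_adjoint_plug (hX₁ : X₁.IsConnectorComplex)
    (hψ₁ : X₁.IsFullySelfTesting μ₁ ψ₁) (congruent : X₁.M = X₂.A k) (o : out.Event) :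
    connOp (contractTensor X₂ k X₁) (contractOps X₂ k X₁) o
        ∘L ContinuousLinearMap.adjoint (plug X₂ k X₁)
      = ContinuousLinearMap.adjoint (plug X₂ k X₁) ∘L connOp X₂.C X₂.A o := by
  rw [plug_eq]
  refine comp_adjoint_plugOp _ _ (connOp_contractOps X₂ k X₁ o)
    (bellOp_piSplitAt k (X₂.C o) X₂.A) ?_
  refine splitBell_comp_ampl (X₂.C o) _ _ _ _ fun c => ?_
  rw [← congruent]
  exact hψ₁.connOp_comp_adjoint hX₁ c

theorem M_contract (hX₁ : X₁.IsConnectorComplex) (hψ₁ : X₁.IsFullySelfTesting μ₁ ψ₁)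
    (congruent : X₁.M = X₂.A k) : (contract X₂ k X₁).M = X₂.M := by
  funext o
  have h1 := connOp_comp_adjoint_plug hX₁ hψ₁ congruent o
  have h2 := plug_comp_adjoint (X₂ := X₂) (k := k) hX₁.coisometry
  change (X₂.V ∘L plug X₂ k X₁) ∘L connOp (contractTensor X₂ k X₁) (contractOps X₂ k X₁) o ∘L
    ContinuousLinearMap.adjoint (X₂.V ∘L plug X₂ k X₁) = _
  rw [ContinuousLinearMap.adjoint_comp, ← ContinuousLinearMap.comp_assoc (connOp _ _ _), h1,
    ContinuousLinearMap.comp_assoc, ContinuousLinearMap.comp_assoc,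
    ← ContinuousLinearMap.comp_assoc (plug X₂ k X₁), h2]
  rfl

theorem isPOVM_contractOps (hX₂ : X₂.IsConnectorComplex) (hX₁ : X₁.IsConnectorComplex) :
    ∀ j, IsPOVM (contractOps X₂ k X₁ j)
  | Sum.inl l => hX₁.povm l
  | Sum.inr j => hX₂.povm j

theorem isConnector_contractTensor (hX₂ : X₂.IsConnectorComplex) (hX₁ : X₁.IsConnectorComplex) :
    IsConnector (contractTensor X₂ k X₁) := by
  intro I A hA
  refine (hX₂.connector.split k _ _ _ _ (hX₁.connector _ _ fun l => hA (Sum.inl l))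
    fun j => hA (Sum.inr j)).of_reindex (Equiv.sumPiEquivProdPi I).symm fun o => ?_
  exact (reindexOp_symm_intertwine _ (connOp_contract X₂ k X₁ A o)).symm

theorem isConnectorComplex_contract (hX₂ : X₂.IsConnectorComplex) (hX₁ : X₁.IsConnectorComplex)
    (hψ₁ : X₁.IsFullySelfTesting μ₁ ψ₁) (congruent : X₁.M = X₂.A k) :
    (contract X₂ k X₁).IsConnectorComplex where
  connector := isConnector_contractTensor hX₂ hX₁
  povm := isPOVM_contractOps hX₂ hX₁
  coisometry := by
    change (X₂.V ∘L plug X₂ k X₁) ∘L ContinuousLinearMap.adjoint (X₂.V ∘L plug X₂ k X₁) = 1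
    rw [ContinuousLinearMap.adjoint_comp, ContinuousLinearMap.comp_assoc,
      ← ContinuousLinearMap.comp_assoc (plug X₂ k X₁), plug_comp_adjoint hX₁.coisometry]
    exact hX₂.coisometry
  projective := by
    rw [M_contract hX₁ hψ₁ congruent]
    exact hX₂.projective

end Contraction

end ConnectorData

/-! ### Moving polynomials through an intertwiner -/

section Adjoin

variable {α I J : Type} {S : α → Op I I} {T : α → Op J J} {W : Op J I}

/-- Applying the same polynomial on both sides suffices. This and its converse below give the two
inclusions in the cyclicity of the contracted invariant subspace. -/
theorem exists_adjoin_intertwine (h : ∀ a, S a ∘L W = W ∘L T a) {f : Op J J}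
    (hf : f ∈ Algebra.adjoin ℂ (Set.range T)) :
    ∃ g ∈ Algebra.adjoin ℂ (Set.range S), g ∘L W = W ∘L f := by
  induction hf using Algebra.adjoin_induction with
  | mem x hx =>
    obtain ⟨a, rfl⟩ := hx
    exact ⟨S a, Algebra.subset_adjoin ⟨a, rfl⟩, h a⟩
  | algebraMap c =>
    refine ⟨algebraMap ℂ _ c, Subalgebra.algebraMap_mem _ _, ?_⟩
    rw [Algebra.algebraMap_eq_smul_one, Algebra.algebraMap_eq_smul_one,
      ContinuousLinearMap.smul_comp, ContinuousLinearMap.comp_smul]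
    rfl
  | add x y _ _ hx hy =>
    obtain ⟨g, hg, hg'⟩ := hx
    obtain ⟨g₂, hg₂, hg₂'⟩ := hy
    exact ⟨g + g₂, Subalgebra.add_mem _ hg hg₂, by
      rw [ContinuousLinearMap.add_comp, hg', hg₂', ContinuousLinearMap.comp_add]⟩
  | mul x y _ _ hx hy =>
    obtain ⟨g, hg, hg'⟩ := hx
    obtain ⟨g₂, hg₂, hg₂'⟩ := hy
    refine ⟨g * g₂, Subalgebra.mul_mem _ hg hg₂, ?_⟩
    change (g ∘L g₂) ∘L W = W ∘L (x ∘L y)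
    rw [ContinuousLinearMap.comp_assoc, hg₂', ← ContinuousLinearMap.comp_assoc, hg',
      ContinuousLinearMap.comp_assoc]

theorem exists_adjoin_intertwine' (h : ∀ a, S a ∘L W = W ∘L T a) {g : Op I I}
    (hg : g ∈ Algebra.adjoin ℂ (Set.range S)) :
    ∃ f ∈ Algebra.adjoin ℂ (Set.range T), g ∘L W = W ∘L f := by
  induction hg using Algebra.adjoin_induction with
  | mem x hx =>
    obtain ⟨a, rfl⟩ := hx
    exact ⟨T a, Algebra.subset_adjoin ⟨a, rfl⟩, h a⟩
  | algebraMap c =>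
    refine ⟨algebraMap ℂ _ c, Subalgebra.algebraMap_mem _ _, ?_⟩
    rw [Algebra.algebraMap_eq_smul_one, Algebra.algebraMap_eq_smul_one,
      ContinuousLinearMap.smul_comp, ContinuousLinearMap.comp_smul]
    rfl
  | add x y _ _ hx hy =>
    obtain ⟨g, hg, hg'⟩ := hx
    obtain ⟨g₂, hg₂, hg₂'⟩ := hy
    exact ⟨g + g₂, Subalgebra.add_mem _ hg hg₂, by
      rw [ContinuousLinearMap.add_comp, hg', hg₂', ContinuousLinearMap.comp_add]⟩
  | mul x y _ _ hx hy =>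
    obtain ⟨g, hg, hg'⟩ := hx
    obtain ⟨g₂, hg₂, hg₂'⟩ := hy
    refine ⟨g * g₂, Subalgebra.mul_mem _ hg hg₂, ?_⟩
    change (x ∘L y) ∘L W = W ∘L (g ∘L g₂)
    rw [ContinuousLinearMap.comp_assoc, hg₂', ← ContinuousLinearMap.comp_assoc, hg',
      ContinuousLinearMap.comp_assoc]

end Adjoin

/-! ### Cyclicity through invariant subspaces -/

section Cyclic

variable {ι : Type} [Fintype ι] [DecidableEq ι] {L : ι → Leg} {I : ι → Type}
  {A : ∀ k, OpSystem (L k) (I k)}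

/-- The orbit of `ψ` under the tensor polynomials is itself an invariant subspace containing `ψ`. -/
theorem cyclic_of_forall_submodule {ψ : Hilb (∀ k, I k)}
    (h : ∀ S : Submodule ℂ (Hilb (∀ k, I k)), ψ ∈ S →
      (∀ k e, ∀ v ∈ S, localOp k (A k e) v ∈ S) → S = ⊤) :
    {v | ∃ f ∈ tensorPolynomials A, v = f ψ} = Set.univ := by
  have h1 := h ((Subalgebra.toSubmodule (tensorPolynomials A)).map
    (ContinuousLinearMap.apply ℂ (Hilb (∀ k, I k)) ψ).toLinearMap)
    ⟨1, Subalgebra.one_mem _, rfl⟩ (by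
      rintro k e _ ⟨f, hf, rfl⟩
      exact ⟨localOp k (A k e) * f,
        Subalgebra.mul_mem _ (Algebra.subset_adjoin ⟨k, e, rfl⟩) hf, rfl⟩)
  refine Set.eq_univ_of_forall fun v => ?_
  obtain ⟨f, hf, hfv⟩ := h1.ge (Submodule.mem_top (x := v))
  exact ⟨f, hf, hfv.symm⟩

theorem ampl_bellOp_mem {R : Type} (S : Submodule ℂ (Hilb ((∀ k, I k) × R)))
    (hS : ∀ k e, ∀ v ∈ S, ampl R (localOp k (A k e)) v ∈ S) (B : BellFunctional L)
    {v : Hilb ((∀ k, I k) × R)} (hv : v ∈ S) : ampl R (bellOp B A) v ∈ S := by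
  rw [← amplHom_apply, bellOp, map_sum, sum_apply]
  refine S.sum_mem fun e _ => ?_
  rw [map_smul, smul_apply]
  refine S.smul_mem _ ?_
  exact tensorOp_induction (fun k => A k (e k)) (fun k => A k (e k))
    (fun X _ => ∀ w ∈ S, ampl R X w ∈ S) (fun w hw => hw)
    (fun k X _ hX w hw => hS k (e k) _ (hX w hw)) v hv

end Cyclic

section Cyclic

variable {ι : Type} [Fintype ι] [DecidableEq ι] {L : ι → Leg} {d : ι → ℕ} {B : BellFunctional L}
  {A' : ∀ k, OpSystem (L k) (Fin (d k))} {ψ' : Hilb (∀ k, Fin (d k))}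

/-- For each fixed `ρ`, the vectors `w` with `w ⊗ |ρ⟩` in `S` form an invariant subspace containing
the cyclic state; finitely many `ρ` then span everything. -/
theorem FullySelfTests.ampl_mem (h : FullySelfTests B A' ψ') {R : Type} [Fintype R]
    (S : Submodule ℂ (Hilb ((∀ k, Fin (d k)) × R)))
    (hS : ∀ k e, ∀ v ∈ S, ampl R (localOp k (A' k e)) v ∈ S)
    (hψ : ∀ ρ : R, tensorKet _ ρ ψ' ∈ S) (v : Hilb ((∀ k, Fin (d k)) × R)) : v ∈ S := by
  have hket : ∀ (ρ : R) w, tensorKet (∀ k, Fin (d k)) ρ w ∈ S := by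
    intro ρ w
    have hFl : ∀ k e, ampl R (localOp k (A' k e)) ∘L tensorKet (∀ k, Fin (d k)) ρ
        = tensorKet (∀ k, Fin (d k)) ρ ∘L localOp k (A' k e) :=
      fun _ _ => ampl_tensorKet _ _
    generalize hF : tensorKet (∀ k, Fin (d k)) ρ = F at hFl
    have hmem : ∀ w, w ∈ S.comap F.toLinearMap ↔ F w ∈ S := fun w => Iff.rfl
    have h1 := h.eq_top (S.comap F.toLinearMap) ((hmem _).2 (hF ▸ hψ ρ)) fun k e w hw => by
      rw [hmem] at hw ⊢
      rw [← ContinuousLinearMap.comp_apply, ← hFl]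
      exact hS k e _ hw
    rw [← hmem, h1]
    trivial
  have h1 : v = ∑ ρ, tensorKet _ ρ (sliceOp _ ρ v) := by
    have := DFunLike.congr_fun (sum_tensorKet_sliceOp (I := ∀ k, Fin (d k)) (K := R)) v
    rw [sum_apply] at this
    exact this.symm
  rw [h1]
  exact S.sum_mem fun ρ _ => hket ρ _

theorem FullySelfTests.split_mem (h : FullySelfTests B A' ψ') (k : ι) {N : Type}
    (S : Submodule ℂ (Hilb N)) (F : Op (Fin (d k) × ∀ j : {j // j ≠ k}, Fin (d j)) N)
    (hψ : F (reindexOp (Equiv.piSplitAt k fun j => Fin (d j)) ψ') ∈ S)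
    (hk : ∀ c v, F v ∈ S → F (ampl _ (A' k c) v) ∈ S)
    (hr : ∀ (j : {j // j ≠ k}) (c : (L j).Event) v, F v ∈ S → F (tensor2 1
      (localOp (I := fun j : {j // j ≠ k} => Fin (d j)) j (A' j c)) v) ∈ S)
    (v : Hilb (Fin (d k) × ∀ j : {j // j ≠ k}, Fin (d j))) : F v ∈ S := by
  set e₂ := Equiv.piSplitAt k fun j => Fin (d j)
  have h1 := h.eq_top (S.comap (F ∘L reindexOp e₂).toLinearMap) hψ (by
    refine forall_of_split (k := k) (fun c v hv => ?_) (fun j c v hv => ?_)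
    · have h2 := DFunLike.congr_fun
        (localOp_piSplitAt_self k (I := fun j => Fin (d j)) (A' k c)) v
      rw [← ampl_eq_tensor2] at h2
      exact (congrArg (fun w => F w ∈ S) h2).mpr (hk c _ hv)
    · have h2 := DFunLike.congr_fun
        (localOp_piSplitAt_ne k (I := fun j => Fin (d j)) j (A' j c)) v
      exact (congrArg (fun w => F w ∈ S) h2).mpr (hr j c _ hv))
  have h3 : F (reindexOp e₂ (reindexOp e₂.symm v)) ∈ S :=
    h1.ge (Submodule.mem_top (x := reindexOp e₂.symm v))
  rwa [← ContinuousLinearMap.comp_apply (reindexOp e₂), reindexOp_comp_symm] at h3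

end Cyclic

/-! ### Contraction of two fully self-testing complexes -/

namespace ConnectorData

section Contraction

variable {out : Party} {X₂ : ConnectorData out} {μ₂ : out.Event → ℝ} {ψ₂ : X₂.Space} {k : X₂.ι}
  {X₁ : ConnectorData (X₂.party k)} {μ₁ : (X₂.party k).Event → ℝ} {ψ₁ : X₁.Space}

theorem bellOp_comp_adjoint_plug (hX₁ : X₁.IsConnectorComplex)
    (hψ₁ : X₁.IsFullySelfTesting μ₁ ψ₁) (congruent : X₁.M = X₂.A k) :
    bellOp (fun e => ∑ o, μ₂ o * contractTensor X₂ k X₁ o e) (contractOps X₂ k X₁)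
        ∘L ContinuousLinearMap.adjoint (plug X₂ k X₁)
      = ContinuousLinearMap.adjoint (plug X₂ k X₁)
        ∘L bellOp (fun e => ∑ o, μ₂ o * X₂.C o e) X₂.A := by
  rw [bellOp_sum_mul, bellOp_sum_mul, ContinuousLinearMap.comp_finsetSum,
    ContinuousLinearMap.finsetSum_comp]
  refine Finset.sum_congr rfl fun o _ => ?_
  rw [ContinuousLinearMap.comp_smul, ContinuousLinearMap.smul_comp,
    connOp_comp_adjoint_plug hX₁ hψ₁ congruent]

theorem adjoint_plug_isometry (hX₁ : X₁.IsConnectorComplex) :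
    ContinuousLinearMap.adjoint (ContinuousLinearMap.adjoint (plug X₂ k X₁))
      ∘L ContinuousLinearMap.adjoint (plug X₂ k X₁) = 1 := by
  rw [ContinuousLinearMap.adjoint_adjoint, plug_comp_adjoint hX₁.coisometry]

/-- The bound is that of `X₂` on a particular kind of realization; the plugged-in reference attains
it because `V(X₁)†` preserves the value. -/
theorem isNormalized_contract (hX₂ : X₂.IsConnectorComplex) (hX₁ : X₁.IsConnectorComplex)
    (hψ₂ : X₂.IsFullySelfTesting μ₂ ψ₂) (hψ₁ : X₁.IsFullySelfTesting μ₁ ψ₁)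
    (congruent : X₁.M = X₂.A k) :
    IsNormalized (fun e => ∑ o, μ₂ o * contractTensor X₂ k X₁ o e) := by
  constructor
  · refine ⟨_, contractOps X₂ k X₁, ContinuousLinearMap.adjoint (plug X₂ k X₁) ψ₂,
      isPOVM_contractOps hX₂ hX₁, ?_, ?_⟩
    · rw [norm_of_adjoint_comp (adjoint_plug_isometry hX₁), hψ₂.self_tests.norm_state]
    · rw [← ContinuousLinearMap.comp_apply, bellOp_comp_adjoint_plug hX₁ hψ₁ congruent,
        ContinuousLinearMap.comp_apply, inner_of_adjoint_comp (adjoint_plug_isometry hX₁)]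
      exact hψ₂.self_tests.value_reference.symm
  · rintro _ ⟨I, A, ψ, hA, hψ, rfl⟩
    set e := Equiv.sumPiEquivProdPi I
    have h1 := DFunLike.congr_fun (bellOp_contract X₂ k X₁ μ₂ A) ψ
    rw [ContinuousLinearMap.comp_apply, ContinuousLinearMap.comp_apply] at h1
    have h2 := hψ₂.self_tests.normalized.split_re_inner_le k _ _ (connOp X₁.C (inlOps A)) (inrOps A)
      (hX₁.connector _ _ fun l => hA (Sum.inl l)) (fun j => hA (Sum.inr j)) (reindexOp e ψ)
    rw [norm_reindexOp, hψ, one_pow] at h2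
    have h3 : inner ℂ ψ (bellOp (fun e => ∑ o, μ₂ o * contractTensor X₂ k X₁ o e) A ψ)
        = inner ℂ (reindexOp e ψ) (reindexOp e
          (bellOp (fun e => ∑ o, μ₂ o * contractTensor X₂ k X₁ o e) A ψ)) :=
      ((reindex e).inner_map_map _ _).symm
    rw [h3, h1]
    exact h2

set_option maxHeartbeats 600000 in
-- Two stages. Operators of party `k` of `X₂` are realized on the range of `V(X₁)† ⊗ 𝟙` by Bell
-- operators of `X₁`, so cyclicity of `X₂` fills that range. It contains all `ψ₁ ⊗ |ρ⟩`, from which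
-- cyclicity of `X₁` reaches the whole space.
theorem cyclic_contract (hX₁ : X₁.IsConnectorComplex) (hψ₂ : X₂.IsFullySelfTesting μ₂ ψ₂)
    (hψ₁ : X₁.IsFullySelfTesting μ₁ ψ₁) (congruent : X₁.M = X₂.A k) :
    {v | ∃ f ∈ tensorPolynomials (contractOps X₂ k X₁),
      v = f (ContinuousLinearMap.adjoint (plug X₂ k X₁) ψ₂)} = Set.univ := by
  refine cyclic_of_forall_submodule fun S' hψS hS' => ?_
  set e₁ := contractEquiv X₂ k X₁
  set e₂ := Equiv.piSplitAt k fun j => Fin (X₂.party j).dim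
  set S := S'.comap (reindexOp e₁.symm).toLinearMap with hS
  have hinl : ∀ l e, ∀ v ∈ S, ampl _ (localOp l (X₁.A l e)) v ∈ S := by
    intro l e v hv
    have h1 := DFunLike.congr_fun
      (reindexOp_symm_intertwine _ (localOp_contractOps_inl X₂ k X₁ l e)) v
    have h2 := hS' (Sum.inl l) e _ hv
    rw [hS, Submodule.mem_comap]
    exact h1 ▸ h2
  have hinr : ∀ (j : {j // j ≠ k}) (e : (X₂.party j).Event), ∀ v ∈ S, tensor2 1
      (localOp (I := fun j : {j : X₂.ι // j ≠ k} => Fin (X₂.party j).dim) j (X₂.A j e)) v ∈ S := by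
    intro j e v hv
    have h1 := DFunLike.congr_fun
      (reindexOp_symm_intertwine _ (localOp_contractOps_inr X₂ k X₁ j e)) v
    have h2 := hS' (Sum.inr j) e _ hv
    rw [hS, Submodule.mem_comap]
    exact h1 ▸ h2
  set F := ampl (∀ j : {j : X₂.ι // j ≠ k}, Fin (X₂.party j).dim) (ContinuousLinearMap.adjoint X₁.V)
    with hF
  have hFk : ∀ c v, F (ampl _ (X₂.A k c) v) = ampl _ (connOp X₁.C X₁.A c) (F v) := by
    intro c v
    rw [← congruent, ← ContinuousLinearMap.comp_apply F, hF, ampl_comp,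
      ← hψ₁.connOp_comp_adjoint hX₁]
    rfl
  have hFr : ∀ T v, F (tensor2 1 T v) = tensor2 1 T (F v) := fun T v =>
    DFunLike.congr_fun (ampl_comp_tensor2 (ContinuousLinearMap.adjoint X₁.V) T) v
  have hrange : ∀ v, F v ∈ S := by
    refine hψ₂.self_tests.split_mem k S F ?_ (fun c v hv => ?_) (fun j c v hv => ?_)
    · rw [plug_eq, adjoint_plugOp] at hψS
      exact hψS
    · rw [hFk]
      exact ampl_bellOp_mem S hinl (X₁.C c) hv
    · rw [hFr]
      exact hinr j c _ hv
  have hStop : ∀ v, v ∈ S := by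
    obtain ⟨χ, hχ⟩ := hψ₁.mem_invariant
    refine hψ₁.self_tests.ampl_mem S hinl fun ρ => ?_
    have hχρ : F (tensorKet _ ρ χ) = tensorKet _ ρ (ContinuousLinearMap.adjoint X₁.V χ) :=
      DFunLike.congr_fun (ampl_tensorKet ρ (ContinuousLinearMap.adjoint X₁.V)) χ
    have h1 : tensorKet _ ρ (ContinuousLinearMap.adjoint X₁.V χ) ∈ S := by
      rw [← hχρ]
      exact hrange _
    rw [← hχ]
    exact h1
  rw [Submodule.eq_top_iff']
  intro v
  have h1 : reindexOp e₁.symm (reindexOp e₁ v) ∈ S' := hStop _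
  rwa [← ContinuousLinearMap.comp_apply, reindexOp_symm_comp] at h1

theorem exists_intertwiner_contract (hX₁ : X₁.IsConnectorComplex)
    (hψ₂ : X₂.IsFullySelfTesting μ₂ ψ₂)
    (hψ₁ : X₁.IsFullySelfTesting μ₁ ψ₁) (congruent : X₁.M = X₂.A k)
    {I : X₁.ι ⊕ {j : X₂.ι // j ≠ k} → Type}
    {A : ∀ j, OpSystem (contractParty X₂ k X₁ j).toLeg (I j)} (hA : ∀ j, IsPOVM (A j))
    {ψ : Hilb (∀ j, I j)} (hψ : ‖ψ‖ = 1)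
    (hv : (inner ℂ ψ
      (bellOp (fun e => ∑ o, μ₂ o * contractTensor X₂ k X₁ o e) A ψ)).re = 1) :
    ∃ W : Op (∀ j, Fin (contractParty X₂ k X₁ j).dim) (∀ j, I j),
      ContinuousLinearMap.adjoint W ∘L W = 1 ∧
      W (ContinuousLinearMap.adjoint (plug X₂ k X₁) ψ₂) = ψ ∧
      ∀ j e, localOp j (A j e) ∘L W = W ∘L localOp j (contractOps X₂ k X₁ j e) := by
  set e₀ := Equiv.sumPiEquivProdPi I
  set e₁ := contractEquiv X₂ k X₁
  set e₂ := Equiv.piSplitAt k fun j => Fin (X₂.party j).dim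
  have hv' : (inner ℂ (reindexOp e₀ ψ) (splitBell k (fun e => ∑ o, μ₂ o * X₂.C o e)
      (connOp X₁.C (inlOps A)) (inrOps A) (reindexOp e₀ ψ))).re = 1 := by
    have h1 := DFunLike.congr_fun (bellOp_contract X₂ k X₁ μ₂ A) ψ
    rw [ContinuousLinearMap.comp_apply, ContinuousLinearMap.comp_apply] at h1
    rw [← h1, ← hv]
    exact congrArg Complex.re ((reindex e₀).inner_map_map _ _)
  -- The self-test of `X₂` sees party `k` only through the POVM `connOp X₁.C`; `W₂` therefore knows
  -- nothing yet about the individual parties of `X₁`.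
  obtain ⟨W₂, hW₂, hW₂ψ, hW₂k, hW₂r⟩ := hψ₂.self_tests.exists_split_intertwiner k _ _
    (connOp X₁.C (inlOps A)) (inrOps A) (hX₁.connector _ _ fun l => hA (Sum.inl l))
    (fun j => hA (Sum.inr j)) (reindexOp e₀ ψ) (by rw [norm_reindexOp, hψ]) hv'
  obtain ⟨χ, hχ⟩ := hψ₁.mem_invariant
  obtain ⟨W, hiso, hWV, hWl, hWr⟩ := hψ₁.self_tests.exists_extension hX₁.coisometry
    (M := X₂.A k) (by rw [← congruent]; exact hψ₁.connOp_comp_adjoint hX₁)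
    (by rw [← congruent]; exact hψ₁.comp_connOp hX₁) hχ hψ₁.adjoint_mem
    (A := inlOps A) (fun l => hA (Sum.inl l)) hW₂ hW₂k
  refine ⟨reindexOp e₀.symm ∘L W ∘L reindexOp e₁, adjoint_comp_transport e₀.symm e₁.symm hiso,
    ?_, ?_⟩
  · have h1 : reindexOp e₁ (reindexOp e₁.symm
        (ampl _ (ContinuousLinearMap.adjoint X₁.V) (reindexOp e₂ ψ₂)))
        = ampl _ (ContinuousLinearMap.adjoint X₁.V) (reindexOp e₂ ψ₂) :=
      DFunLike.congr_fun (reindexOp_comp_symm e₁) _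
    rw [plug_eq, adjoint_plugOp]
    change reindexOp e₀.symm (W (reindexOp e₁ (reindexOp e₁.symm
      (ampl _ (ContinuousLinearMap.adjoint X₁.V) (reindexOp e₂ ψ₂))))) = ψ
    rw [h1, ← ContinuousLinearMap.comp_apply W, hWV, hW₂ψ]
    exact DFunLike.congr_fun (reindexOp_symm_comp e₀) ψ
  · rintro (l | j) e
    · have h1 : reindexOp e₀ ∘L localOp (Sum.inl l) (A (Sum.inl l) e)
          = ampl _ (localOp (I := fun l => I (Sum.inl l)) l (inlOps A l e)) ∘L reindexOp e₀ := by
        rw [ampl_eq_tensor2]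
        exact localOp_sumPi_inl l (A (Sum.inl l) e)
      exact transport_intertwine e₀.symm e₁.symm (hWl l e) (reindexOp_symm_intertwine _ h1).symm
        (reindexOp_symm_intertwine _ (localOp_contractOps_inl X₂ k X₁ l e)).symm
    · have h1 : reindexOp e₀ ∘L localOp (Sum.inr j) (A (Sum.inr j) e)
          = tensor2 1 (localOp (I := fun j => I (Sum.inr j)) j (inrOps A j e)) ∘L reindexOp e₀ :=
        localOp_sumPi_inr j (A (Sum.inr j) e)
      exact transport_intertwine e₀.symm e₁.symm (hWr _ _ (hW₂r j e))
        (reindexOp_symm_intertwine _ h1).symm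
        (reindexOp_symm_intertwine _ (localOp_contractOps_inr X₂ k X₁ j e)).symm

theorem fullySelfTests_contract (hX₂ : X₂.IsConnectorComplex) (hX₁ : X₁.IsConnectorComplex)
    (hψ₂ : X₂.IsFullySelfTesting μ₂ ψ₂) (hψ₁ : X₁.IsFullySelfTesting μ₁ ψ₁)
    (congruent : X₁.M = X₂.A k) :
    FullySelfTests (fun e => ∑ o, μ₂ o * contractTensor X₂ k X₁ o e) (contractOps X₂ k X₁)
      (ContinuousLinearMap.adjoint (plug X₂ k X₁) ψ₂) := by
  refine fullySelfTests_of_intertwiners ?_ ?_ (cyclic_contract hX₁ hψ₂ hψ₁ congruent)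
    (isNormalized_contract hX₂ hX₁ hψ₂ hψ₁ congruent) ?_
    (fun I A ψ hA hψ hv => exists_intertwiner_contract hX₁ hψ₂ hψ₁ congruent hA hψ hv)
  · rintro (l | j)
    · exact hψ₁.self_tests.projective l
    · exact hψ₂.self_tests.projective j
  · rw [norm_of_adjoint_comp (adjoint_plug_isometry hX₁), hψ₂.self_tests.norm_state]
  · rintro (l | j)
    · exact hψ₁.self_tests.adjoin_eq_top l
    · exact hψ₂.self_tests.adjoin_eq_top j

/-- Beyond the self-test, the contraction must again have its state in the invariant subspace and
cyclic there; otherwise it could not be used as a lower complex in a further contraction. -/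
theorem isFullySelfTesting_contract (hX₂ : X₂.IsConnectorComplex) (hX₁ : X₁.IsConnectorComplex)
    (hψ₂ : X₂.IsFullySelfTesting μ₂ ψ₂) (hψ₁ : X₁.IsFullySelfTesting μ₁ ψ₁)
    (congruent : X₁.M = X₂.A k) :
    (contract X₂ k X₁).IsFullySelfTesting μ₂ (contractState X₂ k X₁ ψ₂) where
  self_tests := fullySelfTests_contract hX₂ hX₁ hψ₂ hψ₁ congruent
  mem_invariant := by
    obtain ⟨x, hx⟩ := hψ₂.mem_invariant
    have hx' : ContinuousLinearMap.adjoint X₂.V x = ψ₂ := hx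
    refine ⟨x, ?_⟩
    change ContinuousLinearMap.adjoint (X₂.V ∘L plug X₂ k X₁) x
      = ContinuousLinearMap.adjoint (plug X₂ k X₁) ψ₂
    rw [ContinuousLinearMap.adjoint_comp, ContinuousLinearMap.comp_apply, hx']
  cyclic := by
    have hinter := connOp_comp_adjoint_plug hX₁ hψ₁ congruent
    ext v
    constructor
    · rintro ⟨x, hx⟩
      have hx' : ContinuousLinearMap.adjoint (X₂.V ∘L plug X₂ k X₁) x = v := hx
      have hx₂ : ContinuousLinearMap.adjoint X₂.V x ∈ (X₂.invariantSubspace : Set X₂.Space) :=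
        ⟨x, rfl⟩
      rw [hψ₂.cyclic] at hx₂
      obtain ⟨f, hf, hfx⟩ := hx₂
      obtain ⟨g, hg, hgf⟩ := exists_adjoin_intertwine hinter hf
      refine ⟨g, hg, ?_⟩
      rw [← hx', ContinuousLinearMap.adjoint_comp, ContinuousLinearMap.comp_apply, hfx]
      exact (DFunLike.congr_fun hgf ψ₂).symm
    · rintro ⟨g, hg, hgv⟩
      obtain ⟨f, hf, hgf⟩ := exists_adjoin_intertwine' hinter hg
      have hf₂ : f ψ₂ ∈ (X₂.invariantSubspace : Set X₂.Space) := by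
        rw [hψ₂.cyclic]
        exact ⟨f, hf, rfl⟩
      obtain ⟨x, hx⟩ := hf₂
      have hx' : ContinuousLinearMap.adjoint X₂.V x = f ψ₂ := hx
      refine ⟨x, ?_⟩
      change ContinuousLinearMap.adjoint (X₂.V ∘L plug X₂ k X₁) x = v
      rw [ContinuousLinearMap.adjoint_comp, ContinuousLinearMap.comp_apply, hx', hgv]
      exact (DFunLike.congr_fun hgf ψ₂).symm

end Contraction

theorem IsCongruentContraction.isFullySelfTesting {out : Party} {n : ℕ} {X : ConnectorData out}
    {μ : out.Event → ℝ} {ψ : X.Space} (h : X.IsCongruentContraction n μ ψ) :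
    X.IsConnectorComplex ∧ X.IsFullySelfTesting μ ψ := by
  induction h with
  | single X μ ψ hX hψ => exact ⟨hX, hψ⟩
  | contract X₂ μ₂ ψ₂ k X₁ μ₁ ψ₁ h₁ h₂ congruent ih₁ ih₂ =>
    exact ⟨isConnectorComplex_contract ih₂.1 ih₁.1 ih₁.2 congruent,
      isFullySelfTesting_contract ih₂.1 ih₁.1 ih₂.2 ih₁.2 congruent⟩

end ConnectorData

end TightConnectors

open TightConnectors in
theorem mainTheorem3 {out : Party} (n : ℕ) (X : ConnectorData out) (μ : out.Event → ℝ)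
    (ψ : X.Space) (h : X.IsCongruentContraction n μ ψ) :
    X.IsConnectorComplex ∧ FullySelfTests (X.bell μ) X.A ψ :=
  ⟨h.isFullySelfTesting.1, h.isFullySelfTesting.2.self_tests⟩
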